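/- Let $S$ be a locally noetherian scheme. For an affine open $U\subseteq S$ and $n\in\mathbb Z$ consider $\mathcal O_S(U)((z))\supseteq \mathcal O_S(U)[[z]]\cdot z^{-n}$; this gives sheaves $\mathcal O_S((z))\supseteq\mathcal O_S[[z]]z^{-n}$ on $S$. A Schur pair of rank $r$ over $S$ is a pair $(\mathcal A,\mathcal W)$ where $\mathcal A\subseteq\mathcal O_S((z))$ is a sheaf of $\mathcal O_S$-subalgebras and $\mathcal W\subseteq\mathcal O_S((z))^{\oplus r}$ is a sheaf of $\mathcal O_S$-submodules, both quasi-coherent as $\mathcal O_S$-modules, such that $\mathcal A\cap\mathcal O_S[[z]]$, $\mathcal O_S((z))/(\mathcal A+\mathcal O_S[[z]])$, $\mathcal W\cap\mathcal O_S[[z]]^{\oplus r}$ and $\mathcal O_S((z))^{\oplus r}/(\mathcal W+\mathcal O_S[[z]]^{\oplus r})$ are coherent and $\mathcal A\cdot\mathcal W\subseteq\mathcal W$. Put $\mathcal A^{(n)}:=\mathcal A\cap\mathcal O_S[[z]]z^{-n}$ and let $\mathrm{grd}(\mathcal A):=\mathcal O_S\oplus\bigoplus_{n\ge1}\mathcal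 A^{(n)}$, a sheaf of graded $\mathcal O_S$-algebras with $\mathcal O_S$ in degree $0$. Theorem. Let $(\mathcal A,\mathcal W)$ be a Schur pair of rank $r$ over $S$, and let $\pi:C:=\mathrm{Proj}(\mathrm{grd}(\mathcal A))\to S$. There is a section $\sigma:S\to C$ of $\pi$ that is a closed immersion, with image $P$ and ideal sheaf $\mathcal I\subset\mathcal O_C$, such that: 1. $C\setminus P=\mathrm{Spec}(\mathcal A)$; precisely, the canonical $S$-morphism $\mathrm{Spec}(\mathcal A)\to D_+(1)\subseteq C$, given by the section $1\in\mathcal A^{(1)}=\mathrm{grd}(\mathcal A)_1$ and the identification of the degree-$0$ part of $\mathrm{grd}(\mathcal A)[1^{-1}]$ with $\mathcal A$, is an open immersion with image $C\setminus P$. 2. $P$ is an effective Cartier divisor in $C$, and $\mathcal O_C(P)$ is relatively ample with respect to $\pi$. 3. The conormal sheaf $\mathcal I/\mathcal I^2$ is free of rank $1$ on $P$, that is, isomorphic to $\mathcal O_C/\mathcal I=\mathcal O_P$. 4. The formal completion $\widehat{\mathcal O}_C=\varprojlim_n\mathcal O_C/\mathcal I^n$ of $\mathcal O_C$ along $P$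 is isomorphic to $\mathcal O_P[[z]]$ as a formal $\mathcal O_P$-algebra: there is an isomorphism of sheaves of algebras over $\mathcal O_S\cong\mathcal O_P$ under which, for every $n$, the kernel of $\widehat{\mathcal O}_C\to\mathcal O_C/\mathcal I^n$ corresponds to $z^n\mathcal O_P[[z]]$. 5. $\bigcap_{n\ge0}\pi_*\mathcal O_C(-nP)=0$, where $\mathcal O_C(-nP)=\mathcal I^n$. -/

import Mathlib

open CategoryTheory Limits AlgebraicGeometry HomogeneousLocalization HomogeneousIdeal

universe u

attribute [local instance 2000] HahnSeries.instAlgebra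

noncomputable section

namespace RelativeCurve

lemma isPushout_of_isLocalization {R R' P Q : Type u} [CommRing R] [CommRing R'] [CommRing P]
    [CommRing Q] (α : R →+* P) (ψ : R →+* R') (γ : P →+* Q) (β : R' →+* Q) (f : R)
    (hψ : letI := ψ.toAlgebra; IsLocalization.Away f R')
    (hγ : letI := γ.toAlgebra; IsLocalization.Away (α f) Q)
    (comm : γ.comp α = β.comp ψ) :
    IsPushout (CommRingCat.ofHom α) (CommRingCat.ofHom ψ)
      (CommRingCat.ofHom γ) (CommRingCat.ofHom β) := by
  algebraize [α, ψ, γ, β, γ.comp α]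
  have : IsScalarTower R R' Q := .of_algebraMap_eq' comm
  have key : Algebra.IsPushout R P R' Q := by
    refine (Algebra.isLocalization_iff_isPushout (B := Q) (T := P) (.powers f) R').mp ?_
    rw [Algebra.algebraMapSubmonoid, Submonoid.map_powers]
    exact hγ
  exact (CommRingCat.isPushout_iff_isPushout ..).mpr key

lemma isPullback_of_openCover_squares {W X Y Z : Scheme.{u}} (fWX : W ⟶ X) (fWY : W ⟶ Y)
    (fXZ : X ⟶ Z) (fYZ : Y ⟶ Z) (𝒰 : X.OpenCover)
    (H : ∀ i, ∃ (V : Scheme.{u}) (a : V ⟶ W) (b : V ⟶ 𝒰.X i),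
      IsPullback a b fWX (𝒰.f i) ∧ IsPullback b (a ≫ fWY) (𝒰.f i ≫ fXZ) fYZ) :
    IsPullback fWX fWY fXZ fYZ := by
  refine Scheme.isPullback_of_openCover _ _ _ _ 𝒰 fun i ↦ ?_
  obtain ⟨V, a, b, h1, h2⟩ := H i
  refine IsPullback.of_iso h2 h1.isoPullback (Iso.refl _) (Iso.refl _) (Iso.refl _) ?_ ?_ ?_ ?_
  · rw [Iso.refl_hom, Category.comp_id]
    exact h1.isoPullback_hom_snd.symm
  · rw [Iso.refl_hom, Category.comp_id]
    exact (congrArg (· ≫ fWY) h1.isoPullback_hom_fst.symm).trans (Category.assoc _ _ _)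
  · simp
  · simp

section ProjBaseChange

variable {R R' A B : Type u} [CommRing R] [CommRing R'] [CommRing A] [CommRing B]
  [Algebra R A] [Algebra R' B] (𝒜 : ℕ → Submodule R A) (ℬ : ℕ → Submodule R' B)
  [GradedAlgebra 𝒜] [GradedAlgebra ℬ]

/-- The structure morphism `Proj 𝒜 ⟶ Spec R` of a graded `R`-algebra. -/
def projToSpec : Proj 𝒜 ⟶ Spec (.of R) :=
  Proj.toSpecZero 𝒜 ≫ Spec.map (CommRingCat.ofHom (algebraMap R (𝒜 0)))

variable {𝒜 ℬ} (φ : 𝒜 →+*ᵍ ℬ) (ψ : R →+* R')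

lemma irrelevant_le_map_of_localization (f : R)
    (hsurj : ∀ b : B, ∃ (n : ℕ) (a : A), algebraMap R' B (ψ f) ^ n * b = φ a)
    (hf : IsUnit (ψ f)) : ℬ₊ ≤ 𝒜₊.map φ := by
  rw [← toIdeal_le_toIdeal_iff, toIdeal_irrelevant_le]
  intro i hi b hb
  obtain ⟨n, a, ha⟩ := hsurj b
  have h1 : φ (DirectSum.decompose 𝒜 a i) = algebraMap R' B (ψ f) ^ n * b := by
    rw [GradedRingHom.map_directSumDecompose, ← ha, ← map_pow, ← Algebra.smul_def]
    exact DirectSum.decompose_of_mem_same _ (Submodule.smul_mem _ _ hb)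
  have h2 : (φ (DirectSum.decompose 𝒜 a i) : B) ∈ (𝒜₊.map φ).toIdeal :=
    Ideal.mem_map_of_mem _ (mem_irrelevant_of_mem 𝒜 hi (SetLike.coe_mem _))
  rw [h1] at h2
  exact ((Ideal.unit_mul_mem_iff_mem _ ((hf.map (algebraMap R' B)).pow n)).mp h2)


/-- The graded localization `B = A[1/f]` induces a localization of `(A_s)₀` for `s` homogeneous. -/
lemma isLocalization_away_map (f : R) {d : ℕ} (s : A) (hs : s ∈ 𝒜 d)
    (hcomp : ∀ r, φ (algebraMap R A r) = algebraMap R' B (ψ r))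
    (hf : IsUnit (ψ f))
    (hsurj : ∀ b : B, ∃ (n : ℕ) (a : A), algebraMap R' B (ψ f) ^ n * b = φ a)
    (hinj : ∀ a : A, φ a = 0 → ∃ n : ℕ, algebraMap R A f ^ n * a = 0) :
    letI := (Away.map φ s).toAlgebra
    IsLocalization.Away (fromZeroRingHom 𝒜 (.powers s) (algebraMap R (𝒜 0) f))
      (Away ℬ (φ s)) := by
  let := (Away.map φ s).toAlgebra
  have hval : ∀ n : ℕ, (fromZeroRingHom 𝒜 (.powers s) (algebraMap R (𝒜 0) f)) ^ n =
      Away.mk 𝒜 hs 0 (algebraMap R A f ^ n) (by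
        rw [← map_pow, zero_smul]; exact SetLike.algebraMap_mem_graded 𝒜 _) := by
    intro n
    rw [← map_pow, ← map_pow]
    apply HomogeneousLocalization.val_injective
    rw [Away.val_mk]
    change Localization.mk (algebraMap R A (f ^ n)) 1 = _
    rw [map_pow]
    congr 1
    ext; simp
  have hval' : ∀ n : ℕ, Away.map φ s
      ((fromZeroRingHom 𝒜 (.powers s) (algebraMap R (𝒜 0) f)) ^ n) =
      Away.mk ℬ (φ.map_mem hs) 0 (algebraMap R' B (ψ f) ^ n) (by
        rw [← map_pow, zero_smul]; exact SetLike.algebraMap_mem_graded ℬ _) := by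
    intro n
    rw [hval, Away.map_mk]
    apply HomogeneousLocalization.val_injective
    simp [Away.val_mk, hcomp]
  refine ⟨?_, ?_, ?_⟩
  · rintro ⟨_, n, rfl⟩
    rw [RingHom.algebraMap_toAlgebra]
    dsimp only
    rw [map_pow]
    refine IsUnit.pow n ?_
    have := hval' 1
    rw [pow_one] at this
    rw [this]
    obtain ⟨v, hv⟩ := hf.exists_right_inv
    refine IsUnit.of_mul_eq_one (Away.mk ℬ (φ.map_mem hs) 0 (algebraMap R' B v) (by
        rw [zero_smul]; exact SetLike.algebraMap_mem_graded ℬ _)) ?_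
    apply HomogeneousLocalization.val_injective
    simp [Away.val_mk, Localization.mk_mul, ← map_mul, hv]
  · intro z
    obtain ⟨n, b, hb, rfl⟩ := Away.mk_surjective ℬ (φ.map_mem hs) z
    obtain ⟨k, a, ha⟩ := hsurj b
    have h1 : φ (DirectSum.decompose 𝒜 a (n • d)) = algebraMap R' B (ψ f) ^ k * b := by
      rw [GradedRingHom.map_directSumDecompose, ← ha, ← map_pow, ← Algebra.smul_def]
      exact DirectSum.decompose_of_mem_same _ (Submodule.smul_mem _ _ hb)
    refine ⟨⟨Away.mk 𝒜 hs n _ (SetLike.coe_mem (DirectSum.decompose 𝒜 a (n • d))),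
      ⟨_, k, rfl⟩⟩, ?_⟩
    rw [RingHom.algebraMap_toAlgebra, Away.map_mk]
    dsimp only
    rw [hval']
    apply HomogeneousLocalization.val_injective
    simp only [val_mul, Away.val_mk, Localization.mk_mul, h1]
    congr 1
    · ring
    · ext; simp
  · intro x y hxy
    obtain ⟨n, a, ha, rfl⟩ := Away.mk_surjective 𝒜 hs x
    obtain ⟨m, b, hb, rfl⟩ := Away.mk_surjective 𝒜 hs y
    rw [RingHom.algebraMap_toAlgebra, Away.map_mk, Away.map_mk] at hxy
    have h2 := congrArg HomogeneousLocalization.val hxy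
    simp only [Away.val_mk, Localization.mk_eq_mk_iff, Localization.r_iff_exists] at h2
    obtain ⟨⟨_, p, rfl⟩, hp⟩ := h2
    dsimp only at hp
    obtain ⟨k, hk⟩ := hinj (s ^ p * (s ^ m * a) - s ^ p * (s ^ n * b)) (by
      simpa [sub_eq_zero] using hp)
    refine ⟨⟨_, k, rfl⟩, ?_⟩
    dsimp only
    rw [hval]
    apply HomogeneousLocalization.val_injective
    simp only [val_mul, Away.val_mk, Localization.mk_mul]
    rw [Localization.mk_eq_mk_iff, Localization.r_iff_exists]
    refine ⟨⟨_, p, rfl⟩, ?_⟩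
    simp only [Submonoid.coe_mul]
    linear_combination hk

lemma isPullback_awayι (hφ : ℬ₊ ≤ 𝒜₊.map φ) {d : ℕ} (hd : 0 < d) (s : A) (hs : s ∈ 𝒜 d) :
    IsPullback (Spec.map (CommRingCat.ofHom (Away.map φ s)))
      (Proj.awayι ℬ (φ s) (φ.map_mem hs) hd) (Proj.awayι 𝒜 s hs hd) (Proj.map φ hφ) := by
  refine IsOpenImmersion.isPullback _ _ _ _ (Proj.awayι_comp_map φ hφ hd s hs) ?_
  rw [Proj.opensRange_awayι, Proj.opensRange_awayι, Proj.map_preimage_basicOpen]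

lemma awayι_projToSpec {d : ℕ} (hd : 0 < d) (s : A) (hs : s ∈ 𝒜 d) :
    Proj.awayι 𝒜 s hs hd ≫ projToSpec 𝒜 = Spec.map (CommRingCat.ofHom
      ((fromZeroRingHom 𝒜 (.powers s)).comp (algebraMap R (𝒜 0)))) := by
  rw [projToSpec, Proj.awayι_toSpecZero_assoc, ← Spec.map_comp, ← CommRingCat.ofHom_comp]

lemma isPullback_projMap (f : R) (hφ : ℬ₊ ≤ 𝒜₊.map φ)
    (hψ : letI := ψ.toAlgebra; IsLocalization.Away f R')
    (hcomp : ∀ r, φ (algebraMap R A r) = algebraMap R' B (ψ r))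
    (hsurj : ∀ b : B, ∃ (n : ℕ) (a : A), algebraMap R' B (ψ f) ^ n * b = φ a)
    (hinj : ∀ a : A, φ a = 0 → ∃ n : ℕ, algebraMap R A f ^ n * a = 0) :
    IsPullback (Proj.map φ hφ) (projToSpec ℬ) (projToSpec 𝒜)
      (Spec.map (CommRingCat.ofHom ψ)) := by
  have hf : IsUnit (ψ f) := by
    let := ψ.toAlgebra
    exact IsLocalization.Away.algebraMap_isUnit f
  have h2 (d : ℕ) (hd : 0 < d) (s : A) (hs : s ∈ 𝒜 d) :
      IsPullback (Spec.map (CommRingCat.ofHom (Away.map φ s)))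
      (Proj.awayι ℬ (φ s) (φ.map_mem hs) hd ≫ projToSpec ℬ)
      (Proj.awayι 𝒜 s hs hd ≫ projToSpec 𝒜) (Spec.map (CommRingCat.ofHom ψ)) := by
    rw [awayι_projToSpec, awayι_projToSpec]
    refine isPullback_SpecMap_of_isPushout _ _ _ _ (isPushout_of_isLocalization _ _ _ _ f hψ
      (isLocalization_away_map φ ψ f s hs hcomp hf hsurj hinj) ?_)
    ext r
    change Localization.mk (φ (algebraMap R A r)) ⟨φ 1, _⟩ =
      Localization.mk (algebraMap R' B (ψ r)) 1
    rw [hcomp]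
    congr 1
    ext; simp
  exact isPullback_of_openCover_squares _ _ _ _ (Proj.affineOpenCover 𝒜).openCover fun i ↦
    ⟨_, _, _, (isPullback_awayι φ hφ i.1.2 i.2.1 i.2.2).flip, h2 _ i.1.2 i.2.1 i.2.2⟩

end ProjBaseChange

section Laurent

variable {R R' R'' : Type u} [CommRing R] [CommRing R'] [CommRing R'']

/-- The map `R((z)) → R'((z))` induced by `ψ : R → R'` on coefficients. -/
def laurentMap (ψ : R →+* R') : LaurentSeries R →+* LaurentSeries R' where
  toFun x := x.map ψ
  map_one' := by
    ext n
    by_cases hn : n = 0 <;> simp [HahnSeries.coeff_one, hn]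
  map_mul' x y := HahnSeries.map_mul (ψ : R →ₙ+* R')
  map_zero' := by ext; simp
  map_add' x y := by ext; simp

@[simp]
lemma laurentMap_coeff (ψ : R →+* R') (x : LaurentSeries R) (n : ℤ) :
    (laurentMap ψ x).coeff n = ψ (x.coeff n) := rfl

lemma laurentMap_id : laurentMap (RingHom.id R) = RingHom.id _ := by
  ext; rfl

lemma laurentMap_comp (ψ : R →+* R') (ψ' : R' →+* R'') :
    laurentMap (ψ'.comp ψ) = (laurentMap ψ').comp (laurentMap ψ) := by
  ext; rfl

lemma laurentMap_algebraMap (ψ : R →+* R') (r : R) :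
    laurentMap ψ (algebraMap R (LaurentSeries R) r) = algebraMap R' _ (ψ r) := by
  ext n
  by_cases hn : n = 0 <;>
    simp [HahnSeries.algebraMap_apply, HahnSeries.C_apply, hn]

lemma laurentMap_smul (ψ : R →+* R') (r : R) (x : LaurentSeries R) :
    laurentMap ψ (r • x) = ψ r • laurentMap ψ x := by
  ext n; simp

variable (R) in
/-- `R[[z]] · z⁻ⁿ ⊆ R((z))`: the Laurent series of order at most `n`, where the order is the order
of the pole at `z = 0`. -/
def orderLE (n : ℤ) : Submodule R (LaurentSeries R) where
  carrier := {x | ∀ k < -n, x.coeff k = 0}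
  add_mem' hx hy k hk := by simp [hx k hk, hy k hk]
  zero_mem' k _ := by simp
  smul_mem' r x hx k hk := by simp [hx k hk]

lemma mem_orderLE {n : ℤ} {x : LaurentSeries R} :
    x ∈ orderLE R n ↔ ∀ k < -n, x.coeff k = 0 := Iff.rfl

lemma orderLE_mono {m n : ℤ} (h : m ≤ n) : orderLE R m ≤ orderLE R n :=
  fun _ hx k hk ↦ hx k (by lia)

lemma mul_mem_orderLE {m n : ℤ} {x y : LaurentSeries R} (hx : x ∈ orderLE R m)
    (hy : y ∈ orderLE R n) : x * y ∈ orderLE R (m + n) := by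
  intro k hk
  rw [HahnSeries.coeff_mul]
  refine Finset.sum_eq_zero fun ij hij ↦ ?_
  rw [Finset.mem_antidiagonal] at hij
  by_cases h : ij.1 < -m
  · rw [hx _ h, zero_mul]
  · rw [hy _ (by lia), mul_zero]

lemma algebraMap_mem_orderLE (r : R) : algebraMap R (LaurentSeries R) r ∈ orderLE R 0 := by
  intro k hk
  simp [HahnSeries.algebraMap_apply, HahnSeries.C_apply, (by lia : k ≠ 0)]

lemma laurentMap_mem_orderLE (ψ : R →+* R') {n : ℤ} {x : LaurentSeries R} (hx : x ∈ orderLE R n) :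
    laurentMap ψ x ∈ orderLE R' n := fun k hk ↦ by simp [hx k hk]

/-- If the coefficients of pole order `> n` of `x` vanish after inverting `f`, then multiplication
by a power of `f` puts `x` into `R[[z]] · z⁻ⁿ`. -/
lemma exists_pow_smul_mem_orderLE (ψ : R →+* R') (f : R)
    (hψ : letI := ψ.toAlgebra; IsLocalization.Away f R') {n : ℤ} {x : LaurentSeries R}
    (hx : laurentMap ψ x ∈ orderLE R' n) : ∃ m : ℕ, f ^ m • x ∈ orderLE R n := by
  let := ψ.toAlgebra
  have h1 (k : ℤ) : ∃ m : ℕ, k < -n → f ^ m * x.coeff k = 0 := by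
    by_cases hk : k < -n
    · have := hx k hk
      rw [laurentMap_coeff] at this
      obtain ⟨⟨_, m, rfl⟩, hm⟩ := (IsLocalization.map_eq_zero_iff (.powers f) R' _).mp this
      exact ⟨m, fun _ ↦ hm⟩
    · exact ⟨0, fun h ↦ absurd h hk⟩
  choose m hm using h1
  obtain ⟨N, hN⟩ : ∃ N : ℤ, ∀ k < N, x.coeff k = 0 :=
    ⟨x.order, fun k hk ↦ HahnSeries.coeff_eq_zero_of_lt_order hk⟩
  refine ⟨∑ k ∈ Finset.Ico N (-n), m k, fun k hk ↦ ?_⟩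
  by_cases hkN : k < N
  · simp [hN k hkN]
  · have hle : m k ≤ ∑ k ∈ Finset.Ico N (-n), m k :=
      Finset.single_le_sum (f := m) (fun _ _ ↦ Nat.zero_le _) (by simp; lia)
    obtain ⟨c, hc⟩ := Nat.exists_eq_add_of_le' hle
    simp only [HahnSeries.coeff_smul, smul_eq_mul, hc, pow_add, mul_assoc, hm k hk, mul_zero]

end Laurent

section Grd

variable {R R' R'' : Type u} [CommRing R] [CommRing R'] [CommRing R'']
  (A : Subalgebra R (LaurentSeries R)) (A' : Subalgebra R' (LaurentSeries R'))
  (A'' : Subalgebra R'' (LaurentSeries R''))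

/-- The homogeneous components of `grd(A)`: `R` in degree `0`, and
`A⁽ⁿ⁾ = A ∩ R[[z]] · z⁻ⁿ` in degree `n ≥ 1`. -/
def grdComp : ℕ → Submodule R (LaurentSeries R)
  | 0 => 1
  | n + 1 => Subalgebra.toSubmodule A ⊓ orderLE R ((n + 1 : ℕ) : ℤ)

lemma grdComp_le (n : ℕ) : grdComp A n ≤ Subalgebra.toSubmodule A ⊓ orderLE R (n : ℤ) := by
  cases n with
  | zero =>
    intro x hx
    obtain ⟨r, rfl⟩ := Submodule.mem_one.mp hx
    exact ⟨A.algebraMap_mem r, by simpa using algebraMap_mem_orderLE r⟩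
  | succ n => exact le_rfl

lemma mem_grdComp_of_pos {n : ℕ} (hn : 0 < n) {x : LaurentSeries R} :
    x ∈ grdComp A n ↔ x ∈ A ∧ x ∈ orderLE R (n : ℤ) := by
  obtain ⟨n, rfl⟩ := Nat.exists_eq_succ_of_ne_zero hn.ne'
  rfl

lemma mul_mem_grdComp {m n : ℕ} {x y : LaurentSeries R} (hx : x ∈ grdComp A m)
    (hy : y ∈ grdComp A n) : x * y ∈ grdComp A (m + n) := by
  by_cases h : 0 < m + n
  · rw [mem_grdComp_of_pos A h]
    obtain ⟨hx1, hx2⟩ := grdComp_le A m hx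
    obtain ⟨hy1, hy2⟩ := grdComp_le A n hy
    exact ⟨A.mul_mem hx1 hy1, by push_cast; exact mul_mem_orderLE hx2 hy2⟩
  · obtain rfl : m = 0 := by lia
    obtain rfl : n = 0 := by lia
    obtain ⟨r, rfl⟩ := Submodule.mem_one.mp hx
    obtain ⟨s, rfl⟩ := Submodule.mem_one.mp hy
    exact Submodule.mem_one.mpr ⟨r * s, by simp⟩

/-- The graded `R`-algebra `grd(A) = R ⊕ ⨁_{n ≥ 1} A⁽ⁿ⁾`, realized as the algebra of polynomials
`∑ aₙ tⁿ` with `aₙ` in the component of degree `n`. -/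
def grdSubalgebra : Subalgebra R (Polynomial (LaurentSeries R)) where
  carrier := {p | ∀ n, p.coeff n ∈ grdComp A n}
  add_mem' hp hq n := by
    rw [Polynomial.coeff_add]; exact add_mem (hp n) (hq n)
  mul_mem' hp hq n := by
    rw [Polynomial.coeff_mul]
    refine sum_mem fun ij hij ↦ ?_
    rw [← Finset.HasAntidiagonal.mem_antidiagonal.mp hij]
    exact mul_mem_grdComp A (hp _) (hq _)
  algebraMap_mem' r n := by
    rw [IsScalarTower.algebraMap_apply R (LaurentSeries R), Polynomial.algebraMap_apply,
      Algebra.algebraMap_self, RingHom.id_apply, Polynomial.coeff_C]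
    split_ifs with h
    · subst h; exact Submodule.mem_one.mpr ⟨r, rfl⟩
    · exact zero_mem _

/-- The underlying ring of `grd(A)`. -/
def Grd : Type u := grdSubalgebra A

instance : CommRing (Grd A) := inferInstanceAs (CommRing (grdSubalgebra A))

instance : Algebra R (Grd A) := inferInstanceAs (Algebra R (grdSubalgebra A))

namespace Grd

variable {A}

/-- The component of degree `n` of an element of `grd(A)`. -/
def coeff (p : Grd A) (n : ℕ) : LaurentSeries R := (p : grdSubalgebra A).1.coeff n

lemma coeff_mem (p : Grd A) (n : ℕ) : p.coeff n ∈ grdComp A n := Subtype.property p n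

lemma ext {p q : Grd A} (h : ∀ n, p.coeff n = q.coeff n) : p = q :=
  Subtype.ext (Polynomial.ext h)

lemma coeff_zero (n : ℕ) : (0 : Grd A).coeff n = 0 := rfl

lemma coeff_add (p q : Grd A) (n : ℕ) : (p + q).coeff n = p.coeff n + q.coeff n :=
  Polynomial.coeff_add _ _ _

lemma coeff_smul (r : R) (p : Grd A) (n : ℕ) : (r • p).coeff n = r • p.coeff n :=
  Polynomial.coeff_smul _ _ _

lemma coeff_one (n : ℕ) : (1 : Grd A).coeff n = if n = 0 then 1 else 0 :=
  Polynomial.coeff_one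

lemma coeff_mul (p q : Grd A) (n : ℕ) :
    (p * q).coeff n = ∑ ij ∈ Finset.HasAntidiagonal.antidiagonal n, p.coeff ij.1 * q.coeff ij.2 :=
  Polynomial.coeff_mul _ _ _

/-- Taking components as an additive homomorphism. -/
def coeffHom (n : ℕ) : Grd A →+ LaurentSeries R where
  toFun p := p.coeff n
  map_zero' := coeff_zero n
  map_add' p q := coeff_add p q n

lemma coeff_sum {ι : Type*} (s : Finset ι) (p : ι → Grd A) (n : ℕ) :
    (∑ i ∈ s, p i).coeff n = ∑ i ∈ s, (p i).coeff n :=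
  map_sum (coeffHom n) _ _

/-- The degrees in which an element of `grd(A)` has a nonzero component. -/
def support (p : Grd A) : Finset ℕ := (p : grdSubalgebra A).1.support

lemma coeff_eq_zero {p : Grd A} {n : ℕ} (h : n ∉ p.support) : p.coeff n = 0 :=
  Polynomial.notMem_support_iff.mp h

variable (A) in
/-- The homogeneous element of `grd(A)` of degree `n` given by `a ∈ A⁽ⁿ⁾`. -/
def monomial (n : ℕ) (a : LaurentSeries R) (ha : a ∈ grdComp A n) : Grd A :=
  (⟨Polynomial.monomial n a, fun m ↦ by
    rw [Polynomial.coeff_monomial]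
    split_ifs with h
    · subst h; exact ha
    · exact zero_mem _⟩ : grdSubalgebra A)

lemma coeff_monomial (n : ℕ) (a : LaurentSeries R) (ha : a ∈ grdComp A n) (m : ℕ) :
    (monomial A n a ha).coeff m = if n = m then a else 0 :=
  Polynomial.coeff_monomial

end Grd

/-- The submodule of elements of `grd(A)` that are homogeneous of degree `n`. -/
def grdPiece (n : ℕ) : Submodule R (Grd A) where
  carrier := {p | ∀ m ≠ n, p.coeff m = 0}
  add_mem' hp hq m hm := by rw [Grd.coeff_add, hp m hm, hq m hm, add_zero]
  zero_mem' m _ := Grd.coeff_zero m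
  smul_mem' r p hp m hm := by rw [Grd.coeff_smul, hp m hm, smul_zero]

lemma Grd.monomial_mem (n : ℕ) (a : LaurentSeries R) (ha : a ∈ grdComp A n) :
    Grd.monomial A n a ha ∈ grdPiece A n := fun m hm ↦ by
  rw [Grd.coeff_monomial, if_neg hm.symm]

instance : SetLike.GradedMonoid (grdPiece A) where
  one_mem m hm := by rw [Grd.coeff_one, if_neg hm]
  mul_mem i j p q hp hq m hm := by
    rw [Grd.coeff_mul]
    refine Finset.sum_eq_zero fun ij hij ↦ ?_
    by_cases h : ij.1 = i
    · have h2 := Finset.HasAntidiagonal.mem_antidiagonal.mp hij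
      rw [hq ij.2 (by lia), mul_zero]
    · rw [hp ij.1 h, zero_mul]

lemma coeff_coeAddMonoidHom (x : DirectSum ℕ fun n ↦ grdPiece A n) (n : ℕ) :
    (DirectSum.coeAddMonoidHom (grdPiece A) x).coeff n = (x n).1.coeff n := by
  classical
  induction x using DirectSum.induction_on with
  | zero => simp
  | of i y =>
    rw [DirectSum.coeAddMonoidHom_of]
    by_cases h : i = n
    · subst h; simp
    · rw [y.2 n (Ne.symm h), DirectSum.of_eq_of_ne _ _ _ (Ne.symm h)]
      exact (Grd.coeff_zero n).symm
  | add x y hx hy =>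
    rw [map_add, Grd.coeff_add, hx, hy]
    exact (Grd.coeff_add _ _ _).symm

lemma grdPiece_isInternal : DirectSum.IsInternal (grdPiece A) := by
  classical
  constructor
  · intro x y hxy
    refine DFinsupp.ext fun n ↦ Subtype.ext (Grd.ext fun m ↦ ?_)
    by_cases h : m = n
    · subst h
      rw [← coeff_coeAddMonoidHom, ← coeff_coeAddMonoidHom, hxy]
    · rw [(x n).2 m h, (y n).2 m h]
  · intro p
    refine ⟨∑ n ∈ p.support, DirectSum.of (fun n ↦ grdPiece A n) n
      ⟨Grd.monomial A n (p.coeff n) (p.coeff_mem n), Grd.monomial_mem A n _ _⟩, ?_⟩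
    rw [map_sum]
    simp only [DirectSum.coeAddMonoidHom_of]
    refine Grd.ext fun m ↦ ?_
    rw [Grd.coeff_sum]
    simp only [Grd.coeff_monomial, Finset.sum_ite_eq']
    split_ifs with h
    · rfl
    · exact (Grd.coeff_eq_zero h).symm

instance : GradedAlgebra (grdPiece A) where
  __ := (grdPiece_isInternal A).chooseDecomposition

variable {A A' A''}

/-- The graded homomorphism `grd(A) → grd(A')` induced by a map of coefficients `R → R'` that
maps `A` to `A'`. -/
def grdMap (ψ : R →+* R') (h : ∀ a ∈ A, laurentMap ψ a ∈ A') : grdPiece A →+*ᵍ grdPiece A' where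
  __ := (((Polynomial.mapRingHom (laurentMap ψ)).comp
    (grdSubalgebra A).val.toRingHom).codRestrict (grdSubalgebra A') fun p n ↦ by
      change (Polynomial.map (laurentMap ψ) p.1).coeff n ∈ _
      rw [Polynomial.coeff_map]
      have hp := p.2 n
      cases n with
      | zero =>
        obtain ⟨r, hr⟩ := Submodule.mem_one.mp hp
        exact Submodule.mem_one.mpr ⟨ψ r, by rw [← hr, laurentMap_algebraMap]⟩
      | succ n => exact ⟨h _ hp.1, laurentMap_mem_orderLE ψ hp.2⟩ : Grd A →+* Grd A')
  map_mem {n p} hp m hm := by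
    exact (Polynomial.coeff_map _ _).trans ((congrArg _ (hp m hm)).trans (map_zero _))

lemma grdMap_coeff (ψ : R →+* R') (h : ∀ a ∈ A, laurentMap ψ a ∈ A') (p : Grd A) (n : ℕ) :
    (grdMap ψ h p).coeff n = laurentMap ψ (p.coeff n) :=
  Polynomial.coeff_map _ _

lemma grdMap_algebraMap (ψ : R →+* R') (h : ∀ a ∈ A, laurentMap ψ a ∈ A') (r : R) :
    grdMap ψ h (algebraMap R (Grd A) r) = algebraMap R' (Grd A') (ψ r) := by
  apply Subtype.ext
  change Polynomial.map (laurentMap ψ) (algebraMap R (Polynomial (LaurentSeries R)) r) =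
    algebraMap R' (Polynomial (LaurentSeries R')) (ψ r)
  rw [Polynomial.algebraMap_apply, Polynomial.algebraMap_apply, Polynomial.map_C,
    laurentMap_algebraMap]

lemma grdMap_id (h : ∀ a ∈ A, laurentMap (RingHom.id R) a ∈ A) :
    grdMap (RingHom.id R) h = GradedRingHom.id (grdPiece A) := by
  refine GradedRingHom.ext fun p ↦ Grd.ext fun n ↦ ?_
  change (grdMap (RingHom.id R) h p).coeff n = p.coeff n
  rw [grdMap_coeff, laurentMap_id, RingHom.id_apply]

lemma grdMap_comp (ψ : R →+* R') (ψ' : R' →+* R'') (h : ∀ a ∈ A, laurentMap ψ a ∈ A')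
    (h' : ∀ a ∈ A', laurentMap ψ' a ∈ A'')
    (h'' : ∀ a ∈ A, laurentMap (ψ'.comp ψ) a ∈ A'') :
    grdMap (ψ'.comp ψ) h'' = (grdMap ψ' h').comp (grdMap ψ h) := by
  refine GradedRingHom.ext fun p ↦ Grd.ext fun n ↦ ?_
  change (grdMap (ψ'.comp ψ) h'' p).coeff n = (grdMap ψ' h' (grdMap ψ h p)).coeff n
  rw [grdMap_coeff, grdMap_coeff, grdMap_coeff, laurentMap_comp, RingHom.comp_apply]

lemma smul_grdComp_of_localization (ψ : R →+* R') (f : R)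
    (hψ : letI := ψ.toAlgebra; IsLocalization.Away f R')
    (hsurj : ∀ a' ∈ A', ∃ (n : ℕ), ∃ a ∈ A, ψ f ^ n • a' = laurentMap ψ a) (n : ℕ)
    (a' : LaurentSeries R') (ha' : a' ∈ grdComp A' n) :
    ∃ m : ℕ, ∀ k ≥ m, ∃ a ∈ grdComp A n, ψ f ^ k • a' = laurentMap ψ a := by
  suffices ∃ m : ℕ, ∃ a ∈ grdComp A n, ψ f ^ m • a' = laurentMap ψ a by
    obtain ⟨m, a, ha, haa⟩ := this
    refine ⟨m, fun k hk ↦ ?_⟩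
    obtain ⟨c, rfl⟩ := Nat.exists_eq_add_of_le' hk
    exact ⟨f ^ c • a, Submodule.smul_mem _ _ ha, by
      rw [pow_add, mul_smul, haa, laurentMap_smul, map_pow]⟩
  cases n with
  | zero =>
    obtain ⟨r, rfl⟩ := Submodule.mem_one.mp ha'
    let := ψ.toAlgebra
    obtain ⟨m, r', hr'⟩ := IsLocalization.Away.surj f r
    refine ⟨m, algebraMap R _ r', Submodule.mem_one.mpr ⟨r', rfl⟩, ?_⟩
    rw [laurentMap_algebraMap, Algebra.smul_def, ← map_mul, mul_comm]
    exact congrArg _ hr'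
  | succ n =>
    obtain ⟨m, a, ha, haa⟩ := hsurj a' ha'.1
    obtain ⟨c, hc⟩ := exists_pow_smul_mem_orderLE ψ f hψ (n := ((n + 1 : ℕ) : ℤ)) (x := a) (by
      rw [← haa]; exact Submodule.smul_mem _ _ ha'.2)
    exact ⟨c + m, f ^ c • a, ⟨Subalgebra.smul_mem _ ha _, hc⟩, by
      rw [pow_add, mul_smul, haa, laurentMap_smul, map_pow]⟩

lemma grdMap_surj (ψ : R →+* R') (h : ∀ a ∈ A, laurentMap ψ a ∈ A') (f : R)
    (hψ : letI := ψ.toAlgebra; IsLocalization.Away f R')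
    (hsurj : ∀ a' ∈ A', ∃ (n : ℕ), ∃ a ∈ A, ψ f ^ n • a' = laurentMap ψ a) (b : Grd A') :
    ∃ (n : ℕ) (a : Grd A), algebraMap R' (Grd A') (ψ f) ^ n * b = grdMap ψ h a := by
  have h1 (n : ℕ) := smul_grdComp_of_localization ψ f hψ hsurj n (b.coeff n) (b.coeff_mem n)
  choose m hm using h1
  let N := ∑ n ∈ b.support, m n
  have h2 (n : ℕ) : ∃ a ∈ grdComp A n, ψ f ^ N • b.coeff n = laurentMap ψ a := by
    by_cases hn : n ∈ b.support
    · exact hm n N (Finset.single_le_sum (f := m) (fun _ _ ↦ Nat.zero_le _) hn)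
    · exact ⟨0, zero_mem _, by rw [Grd.coeff_eq_zero hn, smul_zero, map_zero]⟩
  choose a ha haa using h2
  refine ⟨N, ∑ n ∈ b.support, Grd.monomial A n (a n) (ha n), ?_⟩
  rw [← map_pow, ← Algebra.smul_def]
  refine Grd.ext fun n ↦ ?_
  rw [grdMap_coeff, Grd.coeff_sum, Grd.coeff_smul]
  simp only [Grd.coeff_monomial, Finset.sum_ite_eq']
  split_ifs with hn
  · exact haa n
  · rw [Grd.coeff_eq_zero hn, smul_zero, map_zero]

lemma grdMap_inj (ψ : R →+* R') (h : ∀ a ∈ A, laurentMap ψ a ∈ A') (f : R)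
    (hinj : ∀ a ∈ A, laurentMap ψ a = 0 → ∃ n : ℕ, f ^ n • a = 0)
    (p : Grd A) (hp : grdMap ψ h p = 0) : ∃ n : ℕ, algebraMap R (Grd A) f ^ n * p = 0 := by
  have h1 (n : ℕ) : ∃ m : ℕ, f ^ m • p.coeff n = 0 :=
    hinj _ (grdComp_le A n (p.coeff_mem n)).1 (by
      rw [← grdMap_coeff ψ h, hp, Grd.coeff_zero])
  choose m hm using h1
  refine ⟨∑ n ∈ p.support, m n, ?_⟩
  rw [← map_pow, ← Algebra.smul_def]
  refine Grd.ext fun n ↦ ?_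
  rw [Grd.coeff_smul, Grd.coeff_zero]
  by_cases hn : n ∈ p.support
  · obtain ⟨c, hc⟩ := Nat.exists_eq_add_of_le'
      (Finset.single_le_sum (f := m) (fun _ _ ↦ Nat.zero_le _) hn)
    rw [hc, pow_add, mul_smul, hm, smul_zero]
  · rw [Grd.coeff_eq_zero hn, smul_zero]

end Grd

section Dehomogenization

variable {R : Type u} [CommRing R] (A : Subalgebra R (LaurentSeries R))

lemma one_mem_grdComp_one : 1 ∈ grdComp A 1 :=
  (mem_grdComp_of_pos A one_pos).mpr ⟨A.one_mem, fun k hk ↦ by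
    rw [HahnSeries.coeff_one, if_neg (by lia)]⟩

/-- The element `1 ∈ A⁽¹⁾`, viewed as an element of degree `1` of `grd(A)`. -/
def Grd.oneOne : Grd A := Grd.monomial A 1 1 (one_mem_grdComp_one A)

lemma Grd.oneOne_mem : Grd.oneOne A ∈ grdPiece A 1 := Grd.monomial_mem A 1 _ _

/-- The ring homomorphism `grd(A) → A`, `∑ aₙ ↦ ∑ aₙ`. -/
def Grd.sumHom : Grd A →+* A :=
  ((Polynomial.evalRingHom (1 : LaurentSeries R)).comp
    (grdSubalgebra A).val.toRingHom).codRestrict A fun p ↦ by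
      change Polynomial.eval 1 p.1 ∈ A
      rw [Polynomial.eval_eq_sum]
      refine sum_mem fun n _ ↦ ?_
      dsimp only
      rw [one_pow, mul_one]
      exact (grdComp_le A n (p.2 n)).1

lemma Grd.sumHom_oneOne : Grd.sumHom A (Grd.oneOne A) = 1 := by
  apply Subtype.ext
  change Polynomial.eval 1 (Polynomial.monomial 1 (1 : LaurentSeries R)) = 1
  simp

/-- The canonical homomorphism from the degree `0` part of the localization of `grd(A)` at the
element `1` of degree `1` to `A`: a fraction `a / 1ⁿ` with `a ∈ A⁽ⁿ⁾` is mapped to `a`. -/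
def awayToA : Away (grdPiece A) (Grd.oneOne A) →+* A :=
  (Localization.awayLift (Grd.sumHom A) (Grd.oneOne A)
      (by rw [Grd.sumHom_oneOne]; exact isUnit_one)).comp
    (algebraMap (Away (grdPiece A) (Grd.oneOne A)) (Localization.Away (Grd.oneOne A)))

end Dehomogenization

section Schur

open Scheme.AffineZariskiSite

variable {S : Scheme.{u}}

/-- Restriction of functions from an affine open `U` to a principal open `V ⊆ U`. -/
def res {U V : S.AffineZariskiSite} (h : V ≤ U) : Γ(S, U.toOpens) →+* Γ(S, V.toOpens) :=
  (S.presheaf.map (homOfLE (toOpens_mono h)).op).hom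

lemma res_refl {U : S.AffineZariskiSite} : res (le_refl U) = RingHom.id _ := by
  ext x
  simp [res]

lemma res_trans {U V W : S.AffineZariskiSite} (h : V ≤ U) (h' : W ≤ V) :
    res (h'.trans h) = (res h').comp (res h) := by
  rw [res, res, res, ← CommRingCat.hom_comp, ← Functor.map_comp]
  rfl

lemma isLocalization_res (U : S.AffineZariskiSite) (f : Γ(S, U.toOpens)) :
    letI := (res (U.basicOpen_le f)).toAlgebra
    IsLocalization.Away f Γ(S, (U.basicOpen f).toOpens) :=
  U.2.isLocalization_basicOpen f

/-- `𝒪_S((z))^{⊕ r}` on the affine open `U`. -/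
abbrev LaurentVec (r : ℕ) (U : S.AffineZariskiSite) : Type u :=
  Fin r → LaurentSeries Γ(S, U.toOpens)

/-- The restriction map of `𝒪_S((z))^{⊕ r}`. -/
def LaurentVec.res {r : ℕ} {U V : S.AffineZariskiSite} (h : V ≤ U) (w : LaurentVec r U) :
    LaurentVec r V := fun i ↦ laurentMap (RelativeCurve.res h) (w i)

/-- `(𝒪_S[[z]] · z⁻ⁿ)^{⊕ r}` on the affine open `U`. -/
def LaurentVec.orderLE (r : ℕ) (n : ℤ) (U : S.AffineZariskiSite) :
    Submodule Γ(S, U.toOpens) (LaurentVec r U) :=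
  Submodule.pi Set.univ fun _ ↦ RelativeCurve.orderLE Γ(S, U.toOpens) n

/-- A quasi-coherent subsheaf of `𝒪_S`-modules `𝒲 ⊆ 𝒪_S((z))^{⊕ r}`, given by its sections over the
affine open subsets: for `U` affine and `f ∈ 𝒪_S(U)`, restriction maps `𝒲(U)` to `𝒲(D(f))`, and
exhibits `𝒲(D(f))` as the localization `𝒲(U)_f`. -/
structure IsQuasicoherentSubsheaf {r : ℕ}
    (W : ∀ U : S.AffineZariskiSite, Submodule Γ(S, U.toOpens) (LaurentVec r U)) : Prop where
  restrict_mem (U : S.AffineZariskiSite) (f : Γ(S, U.toOpens)) (w : LaurentVec r U) :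
    w ∈ W U → w.res (U.basicOpen_le f) ∈ W (U.basicOpen f)
  exists_of_mem (U : S.AffineZariskiSite) (f : Γ(S, U.toOpens))
    (w' : LaurentVec r (U.basicOpen f)) : w' ∈ W (U.basicOpen f) →
      ∃ n : ℕ, ∃ w ∈ W U, res (U.basicOpen_le f) f ^ n • w' = w.res (U.basicOpen_le f)
  exists_of_restrict_eq_zero (U : S.AffineZariskiSite) (f : Γ(S, U.toOpens))
    (w : LaurentVec r U) : w ∈ W U → w.res (U.basicOpen_le f) = 0 → ∃ n : ℕ, f ^ n • w = 0

/-- Membership in the infinite Grassmannian of rank `r` (and level `0`, and some index) over a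
locally noetherian scheme `S`: `𝒲 ⊆ 𝒪_S((z))^{⊕ r}` is quasi-coherent, and
`𝒲 ∩ 𝒪_S[[z]]^{⊕ r}` and `𝒪_S((z))^{⊕ r} / (𝒲 + 𝒪_S[[z]]^{⊕ r})` are coherent. -/
structure IsGrassmannian {r : ℕ}
    (W : ∀ U : S.AffineZariskiSite, Submodule Γ(S, U.toOpens) (LaurentVec r U)) : Prop where
  quasicoherent : IsQuasicoherentSubsheaf W
  finite_inf (U : S.AffineZariskiSite) :
    Module.Finite Γ(S, U.toOpens) ↥(W U ⊓ LaurentVec.orderLE r 0 U)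
  finite_quotient (U : S.AffineZariskiSite) :
    Module.Finite Γ(S, U.toOpens) (LaurentVec r U ⧸ (W U ⊔ LaurentVec.orderLE r 0 U))

variable (S) in
/-- A Schur pair `(𝒜, 𝒲)` of rank `r` over `S`. -/
structure SchurPair (r : ℕ) where
  /-- the sheaf of `𝒪_S`-subalgebras `𝒜 ⊆ 𝒪_S((z))` -/
  A (U : S.AffineZariskiSite) : Subalgebra Γ(S, U.toOpens) (LaurentSeries Γ(S, U.toOpens))
  /-- the sheaf of `𝒪_S`-submodules `𝒲 ⊆ 𝒪_S((z))^{⊕ r}` -/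
  W (U : S.AffineZariskiSite) : Submodule Γ(S, U.toOpens) (LaurentVec r U)
  A_mem : IsGrassmannian (r := 1) fun U ↦
    (Subalgebra.toSubmodule (A U)).comap (LinearMap.proj 0 : LaurentVec 1 U →ₗ[_] _)
  W_mem : IsGrassmannian W
  smul_mem (U : S.AffineZariskiSite) (a : LaurentSeries Γ(S, U.toOpens)) (w : LaurentVec r U) :
    a ∈ A U → w ∈ W U → (fun i ↦ a * w i) ∈ W U

namespace SchurPair

variable {r : ℕ} (p : SchurPair S r)

lemma A_restrict {U V : S.AffineZariskiSite} (h : V ≤ U) (a : LaurentSeries Γ(S, U.toOpens))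
    (ha : a ∈ p.A U) : laurentMap (res h) a ∈ p.A V := by
  obtain ⟨f, hf⟩ := id h
  obtain rfl : U.basicOpen f = V := Subtype.ext hf
  exact p.A_mem.quasicoherent.restrict_mem U f (fun _ ↦ a) ha

lemma A_surj (U : S.AffineZariskiSite) (f : Γ(S, U.toOpens)) (a' : LaurentSeries _)
    (ha' : a' ∈ p.A (U.basicOpen f)) : ∃ n : ℕ, ∃ a ∈ p.A U,
      res (U.basicOpen_le f) f ^ n • a' = laurentMap (res (U.basicOpen_le f)) a := by
  obtain ⟨n, w, hw, h⟩ := p.A_mem.quasicoherent.exists_of_mem U f (fun _ ↦ a') ha'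
  exact ⟨n, w 0, hw, congrFun h 0⟩

lemma A_inj (U : S.AffineZariskiSite) (f : Γ(S, U.toOpens)) (a : LaurentSeries _)
    (ha : a ∈ p.A U) (h : laurentMap (res (U.basicOpen_le f)) a = 0) :
    ∃ n : ℕ, f ^ n • a = 0 := by
  obtain ⟨n, hn⟩ := p.A_mem.quasicoherent.exists_of_restrict_eq_zero U f (fun _ ↦ a) ha
    (funext fun _ ↦ h)
  exact ⟨n, congrFun hn 0⟩

/-- The restriction homomorphisms of the sheaf of graded algebras `grd(𝒜)`. -/
def grdRes {U V : S.AffineZariskiSite} (h : V ≤ U) : grdPiece (p.A U) →+*ᵍ grdPiece (p.A V) :=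
  grdMap (res h) (p.A_restrict h)

lemma grdMap_congr {R R' : Type u} [CommRing R] [CommRing R']
    {A : Subalgebra R (LaurentSeries R)} {A' : Subalgebra R' (LaurentSeries R')} {ψ ψ' : R →+* R'}
    (e : ψ = ψ') (h : ∀ a ∈ A, laurentMap ψ a ∈ A') (h' : ∀ a ∈ A, laurentMap ψ' a ∈ A') :
    grdMap ψ h = grdMap ψ' h' := by
  subst e; rfl

lemma grdRes_refl (U : S.AffineZariskiSite) : p.grdRes (le_refl U) = GradedRingHom.id _ :=
  (grdMap_congr res_refl _ (fun a ha ↦ by rwa [laurentMap_id])).trans (grdMap_id _)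

lemma grdRes_trans {U V W : S.AffineZariskiSite} (h : V ≤ U) (h' : W ≤ V) :
    p.grdRes (h'.trans h) = (p.grdRes h').comp (p.grdRes h) :=
  (grdMap_congr (res_trans h h') _
    (fun a ha ↦ by rw [laurentMap_comp]; exact p.A_restrict h' _ (p.A_restrict h _ ha))).trans
    (grdMap_comp _ _ _ _ _)

lemma irrelevant_le_map_grdRes {U V : S.AffineZariskiSite} (h : V ≤ U) :
    (grdPiece (p.A V))₊ ≤ (grdPiece (p.A U))₊.map (p.grdRes h) := by
  obtain ⟨f, hf⟩ := id h
  obtain rfl : U.basicOpen f = V := Subtype.ext hf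
  have hloc := isLocalization_res U f
  refine irrelevant_le_map_of_localization _ (res h) f
    (grdMap_surj (res h) _ f hloc (p.A_surj U f)) ?_
  let := (res h).toAlgebra
  exact IsLocalization.Away.algebraMap_isUnit f

lemma projMap_congr {A B : Type u} [CommRing A] [CommRing B] {σ τ : Type u} [SetLike σ A]
    [AddSubgroupClass σ A] [SetLike τ B] [AddSubgroupClass τ B] {𝒜 : ℕ → σ} {ℬ : ℕ → τ}
    [GradedRing 𝒜] [GradedRing ℬ] {φ φ' : 𝒜 →+*ᵍ ℬ} (h : φ = φ') (hφ : ℬ₊ ≤ 𝒜₊.map φ)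
    (hφ' : ℬ₊ ≤ 𝒜₊.map φ') : Proj.map φ hφ = Proj.map φ' hφ' := by
  subst h; rfl

/-- The functor `U ↦ Proj (grd(𝒜)(U))` on affine opens. -/
def projFunctor : S.AffineZariskiSite ⥤ Scheme.{u} where
  obj U := Proj (grdPiece (p.A U))
  map {V U} i := Proj.map (p.grdRes i.le) (p.irrelevant_le_map_grdRes i.le)
  map_id U := by
    rw [← Proj.map_id]
    refine projMap_congr ?_ _ _
    exact p.grdRes_refl U
  map_comp {W V U} i j := by
    rw [← Proj.map_comp]
    exact projMap_congr (p.grdRes_trans j.le i.le) _ _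

lemma isPullback_projFunctor {V U : S.AffineZariskiSite} (i : V ⟶ U) :
    IsPullback (p.projFunctor.map i) (projToSpec (grdPiece (p.A V))) (projToSpec (grdPiece (p.A U)))
      (Spec.map (CommRingCat.ofHom (res i.le))) := by
  obtain ⟨f, hf⟩ := id i.le
  obtain rfl : U.basicOpen f = V := Subtype.ext hf
  have hloc := isLocalization_res U f
  exact isPullback_projMap (p.grdRes i.le) (res i.le) f (p.irrelevant_le_map_grdRes i.le) hloc
    (grdMap_algebraMap _ _) (grdMap_surj _ _ f hloc (p.A_surj U f))
    (grdMap_inj _ _ f (p.A_inj U f))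

/-- The structure morphisms `Proj (grd(𝒜)(U)) ⟶ U`. -/
def projToOpen (U : S.AffineZariskiSite) : Proj (grdPiece (p.A U)) ⟶ U.1.toScheme :=
  projToSpec (grdPiece (p.A U)) ≫ U.2.isoSpec.inv

lemma isPullback_projToOpen {V U : S.AffineZariskiSite} (i : V ⟶ U) :
    IsPullback (p.projFunctor.map i) (p.projToOpen V) (p.projToOpen U)
      (S.homOfLE (toOpens_mono i.le)) :=
  (p.isPullback_projFunctor i).paste_vert
    (IsPullback.of_vert_isIso ⟨((restrictIsoSpec S).inv.naturality i)⟩)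

/-- The gluing datum for the relative `Proj` of `grd(𝒜)`. -/
def projGluing : (directedCover S).RelativeGluingData where
  functor := p.projFunctor
  natTrans :=
    { app U := p.projToOpen U
      naturality _ _ i := (p.isPullback_projToOpen i).w }
  equifibered _ _ i := p.isPullback_projToOpen i

/-- The scheme `C = Proj (grd(𝒜))`, glued from the schemes `Proj (grd(𝒜)(U))` for `U ⊆ S` affine
open. -/
def C : Scheme.{u} := p.projGluing.glued

/-- The projection `π : C ⟶ S`. -/
def π : p.C ⟶ S := p.projGluing.toBase

/-- The inclusion of the open subscheme `π⁻¹(U) = Proj (grd(𝒜)(U))` into `C`. -/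
def ιC (U : S.AffineZariskiSite) : Proj (grdPiece (p.A U)) ⟶ p.C :=
  p.projGluing.cover.f U

/-- The sheaf of algebras `𝒜` on the affine opens. -/
def ringFunctor : S.AffineZariskiSiteᵒᵖ ⥤ CommRingCat.{u} where
  obj U := .of (p.A U.unop)
  map {U V} i := CommRingCat.ofHom
    (((laurentMap (res i.unop.le)).comp (p.A U.unop).val.toRingHom).codRestrict (p.A V.unop)
      fun a ↦ p.A_restrict i.unop.le _ a.2)
  map_id U := by
    refine CommRingCat.hom_ext (RingHom.ext fun a ↦ Subtype.ext ?_)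
    change laurentMap (res (le_refl U.unop)) a.1 = a.1
    rw [res_refl, laurentMap_id, RingHom.id_apply]
  map_comp {U V W} i j := by
    refine CommRingCat.hom_ext (RingHom.ext fun a ↦ Subtype.ext ?_)
    change laurentMap (res (j.unop.le.trans i.unop.le)) a.1 =
      laurentMap (res j.unop.le) (laurentMap (res i.unop.le) a.1)
    rw [res_trans, laurentMap_comp, RingHom.comp_apply]

/-- The structure homomorphism `𝒪_S ⟶ 𝒜` on the affine opens. -/
def ringStructure : (toOpensFunctor S).op ⋙ S.presheaf ⟶ p.ringFunctor where
  app U := CommRingCat.ofHom (algebraMap Γ(S, U.unop.toOpens) (p.A U.unop))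
  naturality U V i := by
    refine CommRingCat.hom_ext (RingHom.ext fun a ↦ Subtype.ext ?_)
    exact (laurentMap_algebraMap (res i.unop.le) a).symm

lemma coequifibered_ringStructure : p.ringStructure.Coequifibered := by
  rw [coequifibered_iff_forall_isLocalizationAway]
  intro U f
  let ψ : p.A U →+* p.A (U.basicOpen f) := (p.ringFunctor.map (homOfLE (U.basicOpen_le f)).op).hom
  have hψ (a : p.A U) : (ψ a).1 = laurentMap (res (U.basicOpen_le f)) a.1 := rfl
  let := ψ.toAlgebra
  change IsLocalization.Away (algebraMap Γ(S, U.toOpens) (p.A U) f) (p.A (U.basicOpen f))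
  have hf : ψ (algebraMap _ _ f) = algebraMap _ _ (res (U.basicOpen_le f) f) :=
    Subtype.ext (laurentMap_algebraMap _ _)
  refine ⟨?_, ?_, ?_⟩
  · rintro ⟨_, n, rfl⟩
    have h1 : IsUnit (res (U.basicOpen_le f) f) := by
      let := (res (U.basicOpen_le f)).toAlgebra
      have := isLocalization_res U f
      exact IsLocalization.Away.algebraMap_isUnit f
    change IsUnit (ψ (algebraMap _ _ f ^ n))
    rw [map_pow, hf]
    exact (h1.map _).pow n
  · intro a'
    obtain ⟨n, a, ha, h⟩ := p.A_surj U f a'.1 a'.2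
    refine ⟨⟨⟨a, ha⟩, ⟨_, n, rfl⟩⟩, ?_⟩
    change a' * ψ (algebraMap _ _ f ^ n) = ψ ⟨a, ha⟩
    rw [map_pow, hf, ← map_pow, mul_comm, ← Algebra.smul_def]
    exact Subtype.ext h
  · intro a b hab
    obtain ⟨n, hn⟩ := p.A_inj U f (a - b).1 (a - b).2 (by
      rw [← hψ, map_sub]
      exact congrArg Subtype.val (sub_eq_zero.mpr hab : ψ a - ψ b = 0))
    refine ⟨⟨_, n, rfl⟩, ?_⟩
    change algebraMap _ _ f ^ n * a = algebraMap _ _ f ^ n * b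
    rw [← sub_eq_zero, ← mul_sub, ← map_pow, ← Algebra.smul_def]
    exact Subtype.ext hn

/-- The relative spectrum `Spec(𝒜)`. -/
def specA : Scheme.{u} := (relativeGluingData p.coequifibered_ringStructure).glued

/-- The projection `Spec(𝒜) ⟶ S`. -/
def specAToBase : p.specA ⟶ S := (relativeGluingData p.coequifibered_ringStructure).toBase

/-- The inclusion of the open subscheme `Spec(𝒜(U))` into `Spec(𝒜)`. -/
def ιSpecA (U : S.AffineZariskiSite) : Spec (.of (p.A U)) ⟶ p.specA :=
  (relativeGluingData p.coequifibered_ringStructure).cover.f U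

/-- The canonical morphism `Spec(𝒜(U)) ⟶ D₊(1) ⊆ Proj (grd(𝒜)(U)) ⊆ C`, where `1` is the section
`1 ∈ 𝒜⁽¹⁾` of degree `1`. -/
def specAToC (U : S.AffineZariskiSite) : Spec (.of (p.A U)) ⟶ p.C :=
  Spec.map (CommRingCat.ofHom (awayToA (p.A U))) ≫
    Proj.awayι (grdPiece (p.A U)) (Grd.oneOne (p.A U)) (Grd.oneOne_mem (p.A U)) one_pos ≫ p.ιC U

end SchurPair
end Schur

section Divisor

variable {X S : Scheme.{u}}

/-- Restriction of functions from an affine open to a smaller one. -/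
def affineRes {V V' : X.affineOpens} (h : V'.1 ≤ V.1) : Γ(X, V) →+* Γ(X, V') :=
  (X.presheaf.map (homOfLE h).op).hom

/-- The closed subscheme defined by the ideal sheaf `I` is an (effective) Cartier divisor: locally
`I` is generated by one nonzerodivisor. -/
def IsEffectiveCartier (I : X.IdealSheafData) : Prop :=
  ∀ x : X, ∃ V : X.affineOpens, x ∈ V.1 ∧ ∃ f ∈ nonZeroDivisors Γ(X, V), I.ideal V = Ideal.span {f}

/-- The sections over the open subset `W` of the sheaf `𝒪_X(nP) = ℋom(Iⁿ, 𝒪_X)`, where `I` is the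
ideal sheaf of the Cartier divisor `P`. -/
structure DivisorSection (I : X.IdealSheafData) (n : ℕ) (W : X.Opens) where
  /-- the homomorphism `Iⁿ(V) → 𝒪_X(V)` for an affine open `V ⊆ W` -/
  hom (V : X.affineOpens) (hV : V.1 ≤ W) : ↥(I.ideal V ^ n) →ₗ[Γ(X, V)] Γ(X, V)
  restrict (V V' : X.affineOpens) (hV : V.1 ≤ W) (hV' : V'.1 ≤ V.1)
    (a : ↥(I.ideal V ^ n)) (a' : ↥(I.ideal V' ^ n)) (h : a'.1 = affineRes hV' a.1) :
    hom V' (hV'.trans hV) a' = affineRes hV' (hom V hV a)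

/-- The open set of points at which a section of the invertible sheaf `𝒪_X(nP)` generates it. -/
def DivisorSection.nonvanishing {I : X.IdealSheafData} {n : ℕ} {W : X.Opens}
    (s : DivisorSection I n W) : X.Opens :=
  ⨆ (V : X.affineOpens) (hV : V.1 ≤ W) (a : ↥(I.ideal V ^ n)), X.basicOpen (s.hom V hV a)

/-- For a Cartier divisor `P` with ideal sheaf `I`, the invertible sheaf `𝒪_X(P)` is relatively
ample for `f : X ⟶ S`: `f` is quasi-compact and, for every affine open `U ⊆ S`, the sheaf `𝒪_X(P)`
is ample on `f⁻¹(U)`, i.e. every point of `f⁻¹(U)` has an affine neighbourhood which is the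
nonvanishing set of a section over `f⁻¹(U)` of some `𝒪_X(nP)`, `n ≥ 1`. -/
def IsRelativelyAmple (f : X ⟶ S) (I : X.IdealSheafData) : Prop :=
  QuasiCompact f ∧ ∀ U : S.affineOpens, ∀ x ∈ f ⁻¹ᵁ U.1, ∃ n : ℕ, 0 < n ∧
    ∃ s : DivisorSection I n (f ⁻¹ᵁ U.1), x ∈ s.nonvanishing ∧ IsAffineOpen s.nonvanishing

/-- The conormal sheaf `I/I²` of the closed subscheme `P` defined by `I` is free of rank `1` on `P`:
there is an isomorphism of sheaves `𝒪_X/I ≅ I/I²`. -/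
def IsConormalFreeOfRankOne (I : X.IdealSheafData) : Prop :=
  ∃ φ : ∀ V : X.affineOpens, (Γ(X, V) ⧸ I.ideal V) ≃ₗ[Γ(X, V)] (I.ideal V).Cotangent,
    ∀ (V V' : X.affineOpens) (h : V'.1 ≤ V.1) (g : Γ(X, V)) (y : I.ideal V) (y' : I.ideal V'),
      y'.1 = affineRes h y.1 → φ V (Ideal.Quotient.mk _ g) = (I.ideal V).toCotangent y →
        φ V' (Ideal.Quotient.mk _ (affineRes h g)) = (I.ideal V').toCotangent y'

/-- For a section `σ : S ⟶ X` of `f : X ⟶ S` with image `P`, an isomorphism between the formal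
completion of `𝒪_X` along `P` and `𝒪_P[[z]]`, as formal `𝒪_P`-algebras. Here `P` is identified
with `S` through `σ`, and the algebra structure of the completion comes from `f`. -/
structure FormalTrivialization (f : X ⟶ S) (σ : S ⟶ X) where
  /-- the isomorphism on sections over an affine open `V` -/
  iso (V : X.affineOpens) :
    AdicCompletion (σ.ker.ideal V) Γ(X, V) ≃+* PowerSeries Γ(S, σ ⁻¹ᵁ V.1)
  /-- It is compatible with the filtrations, hence an isomorphism of topological rings. -/
  eval_eq_zero_iff (V : X.affineOpens) (n : ℕ) (x : AdicCompletion (σ.ker.ideal V) Γ(X, V)) :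
    AdicCompletion.evalₐ (σ.ker.ideal V) n x = 0 ↔ PowerSeries.X ^ n ∣ iso V x
  /-- It is a homomorphism of algebras. -/
  iso_algebraMap (V : X.affineOpens) (U : S.Opens) (h : V.1 ≤ f ⁻¹ᵁ U) (c : Γ(S, U)) :
    iso V (algebraMap Γ(X, V) _ (f.appLE U V.1 h c)) =
      PowerSeries.C (σ.app V.1 (f.appLE U V.1 h c))
  /-- It is compatible with restriction to smaller affine opens. -/
  restrict (V V' : X.affineOpens) (h : V'.1 ≤ V.1)
    (x : AdicCompletion (σ.ker.ideal V) Γ(X, V)) (x' : AdicCompletion (σ.ker.ideal V') Γ(X, V'))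
    (hx : ∀ (n : ℕ) (b : Γ(X, V)), AdicCompletion.evalₐ (σ.ker.ideal V) n x =
      Ideal.Quotient.mk _ b → AdicCompletion.evalₐ (σ.ker.ideal V') n x' =
        Ideal.Quotient.mk _ (affineRes h b)) :
    iso V' x' = PowerSeries.map (S.presheaf.map (homOfLE (σ.preimage_mono h)).op).hom (iso V x)

/-- The sections of `𝒪_X(-nP) = Iⁿ` over the open subset `W`. -/
def powSections (I : X.IdealSheafData) (n : ℕ) (W : X.Opens) : Ideal Γ(X, W) :=
  ⨅ (V : X.affineOpens) (hV : V.1 ≤ W),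
    (I.ideal V ^ n).comap (X.presheaf.map (homOfLE hV).op).hom

end Divisor

end RelativeCurve

end

/-! Over an affine open U of S write R for the functions on U and A for 𝒜(U). As R((z))/(A + R[[z]])
is finitely generated, A + R[[z]]z⁻ᴺ is all of R((z)) for some N. Hence A contains elements with
leading coefficient 1 of every large pole order, in particular a and b of consecutive orders M and M
+ 1 (`nonempty_chart`). Put s = ab, of degree d = 2M + 1. The opens D₊(1) and D₊(s) cover Proj
(`Chart.oneOne_or_s_notMem`), because a homogeneous prime containing the element 1 of degree 1
together with a or b contains the irrelevant ideal. The open D₊(1) is Spec A, since every element of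
A has finite pole order (`awayToA_bijective`).

The divisor P lies in D₊(s). The homomorphism ∑ aₙ ↦ ∑ zⁿaₙ from grd(A) to R[[z]] maps s to a unit,
so it induces a morphism from Spec R[[z]] to C and an expansion of the functions on D₊(s). Inside
R((z)) the expansion of x/sᵏ is x/(ab)ᵏ; it is therefore injective, and f = a²/s, which is a/b in
R((z)), expands to z times a unit. Moreover f generates the ideal of functions with zero constant
coefficient (`Chart.f_dvd_of_constantCoeff`). Setting z = 0 and gluing over all U gives σ, a section
of the separated morphism π and hence a closed immersion.

The local statements about P are read off from the expansion. `IsExpansion` isolates what is needed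
to identify the completion with R[[z]] and to trivialize I/I² by an element whose expansion starts
with z. The ideal of P need not be principal on an arbitrary affine open, so these properties are
first proved where there is a parameter and then patched (`SchurPair.isExpansion`). A function lying
in all powers of I near P has zero expansion, so it vanishes on D₊(s), and then on D₊(1) because ab
is a unit of R((z)).

For ampleness, the constant 1 is a section of 𝒪(P) that generates it exactly on D₊(1). The function
ab on D₊(1) is a section of 𝒪(dP) that generates it exactly on D₊(s), because there Iᵈ is generated
by 1/s (`Chart.exists_κ_eq`). Both opens are affine. -/

noncomputable section

namespace RelativeCurve

/-! ### Power series expansion of elements of grd(A). -/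

section Twist

variable {R : Type u} [CommRing R] {A : Subalgebra R (LaurentSeries R)}

lemma ofPowerSeries_mk_coeff {x : LaurentSeries R} (hx : x ∈ orderLE R 0) :
    HahnSeries.ofPowerSeries ℤ R (PowerSeries.mk fun k ↦ x.coeff k) = x := by
  ext n
  obtain ⟨k, rfl⟩ | hn : (∃ k : ℕ, (k : ℤ) = n) ∨ n < 0 := by
    by_cases h : 0 ≤ n
    · exact .inl ⟨n.toNat, by lia⟩
    · exact .inr (by lia)
  · exact (HahnSeries.ofPowerSeries_apply_coeff _ _).trans (PowerSeries.coeff_mk _ _)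
  · rw [hx n (by lia), HahnSeries.ofPowerSeries_apply, HahnSeries.embDomain_of_notMem_range]
    rintro ⟨k, hk⟩
    have : (k : ℤ) = n := hk
    lia

lemma coeff_single_mul' (n : ℤ) (x : LaurentSeries R) (m : ℤ) :
    (HahnSeries.single n 1 * x).coeff m = x.coeff (m - n) := by
  have := HahnSeries.coeff_single_mul_add (r := (1 : R)) (x := x) (a := m - n) (b := n)
  rwa [sub_add_cancel, one_mul] at this

lemma single_mul_single_neg (n : ℤ) :
    HahnSeries.single n 1 * HahnSeries.single (-n) 1 = (1 : LaurentSeries R) := by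
  rw [HahnSeries.single_mul_single, add_neg_cancel, one_mul]; rfl

lemma isUnit_single (n : ℤ) : IsUnit (HahnSeries.single n 1 : LaurentSeries R) :=
  .of_mul_eq_one _ (single_mul_single_neg n)

lemma single_mul_mem_orderLE {n m : ℤ} {x : LaurentSeries R} (hx : x ∈ orderLE R n)
    (h : n ≤ m + 0) : HahnSeries.single m 1 * x ∈ orderLE R 0 := fun k hk ↦ by
  rw [coeff_single_mul']
  exact hx _ (by lia)

lemma orderLE_pred {n : ℤ} {x : LaurentSeries R} (hx : x ∈ orderLE R n) (h : x.coeff (-n) = 0) :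
    x ∈ orderLE R (n - 1) := fun k hk ↦ by
  obtain rfl | h' : k = -n ∨ k < -n := by lia
  · exact h
  · exact hx k h'

lemma exists_mem_orderLE (x : LaurentSeries R) : ∃ n : ℕ, 0 < n ∧ x ∈ orderLE R (n : ℤ) :=
  ⟨(-x.order).toNat + 1, by lia, fun k hk ↦ HahnSeries.coeff_eq_zero_of_lt_order (by lia)⟩

namespace Grd

lemma monomial_mul {m n : ℕ} {x y : LaurentSeries R} (hx : x ∈ grdComp A m)
    (hy : y ∈ grdComp A n) :
    monomial A m x hx * monomial A n y hy = monomial A (m + n) (x * y) (mul_mem_grdComp A hx hy) :=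
  Subtype.ext (Polynomial.monomial_mul_monomial m n x y)

lemma monomial_congr {m n : ℕ} (h : m = n) {x y : LaurentSeries R} (h' : x = y)
    (hx : x ∈ grdComp A m) (hy : y ∈ grdComp A n) : monomial A m x hx = monomial A n y hy := by
  subst h h'; rfl

lemma pow_mem_grdComp {m : ℕ} {x : LaurentSeries R} (hx : x ∈ grdComp A m) (k : ℕ) :
    x ^ k ∈ grdComp A (k * m) := by
  induction k with
  | zero => rw [pow_zero, zero_mul]; exact Submodule.one_le.mp le_rfl
  | succ k ih => rw [pow_succ, Nat.succ_mul]; exact mul_mem_grdComp A ih hx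

lemma monomial_pow {m : ℕ} {x : LaurentSeries R} (hx : x ∈ grdComp A m) (k : ℕ) :
    monomial A m x hx ^ k = monomial A (k * m) (x ^ k) (pow_mem_grdComp hx k) := by
  refine Subtype.ext ((Polynomial.monomial_pow (n := m) (r := x) k).trans ?_)
  rw [mul_comm]; rfl

lemma eq_monomial_of_mem {n : ℕ} {p : Grd A} (hp : p ∈ grdPiece A n) :
    p = monomial A n (p.coeff n) (p.coeff_mem n) := ext fun m ↦ by
  rw [coeff_monomial]
  split_ifs with h
  · rw [h]
  · exact hp m (Ne.symm h)

variable (A) in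
/-- The ring homomorphism `grd(A) → R((z))`, `∑ aₙ ↦ ∑ zⁿ aₙ`. -/
def twist : Grd A →+* LaurentSeries R :=
  (Polynomial.evalRingHom (HahnSeries.single 1 1)).comp (grdSubalgebra A).val.toRingHom

lemma twist_apply (p : Grd A) :
    twist A p = ∑ n ∈ p.support, HahnSeries.single (n : ℤ) 1 * p.coeff n := by
  refine (Polynomial.eval_eq_sum).trans (Finset.sum_congr rfl fun n _ ↦ ?_)
  change p.coeff n * HahnSeries.single (1 : ℤ) (1 : R) ^ n = _
  rw [HahnSeries.single_pow, one_pow, mul_comm, nsmul_one]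

lemma twist_monomial {n : ℕ} {x : LaurentSeries R} (hx : x ∈ grdComp A n) :
    twist A (monomial A n x hx) = HahnSeries.single (n : ℤ) 1 * x := by
  refine (Polynomial.eval_monomial (x := HahnSeries.single (1 : ℤ) (1 : R))).trans ?_
  rw [HahnSeries.single_pow, one_pow, mul_comm, nsmul_one]

/-- A component of degree n has a pole of order at most n, which the factor zⁿ cancels. -/
lemma twist_mem (p : Grd A) : twist A p ∈ orderLE R 0 := by
  rw [twist_apply]
  exact sum_mem fun n _ ↦ single_mul_mem_orderLE (grdComp_le A n (p.coeff_mem n)).2 (by lia)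

variable (A) in
/-- The ring homomorphism `grd(A) → R[[z]]`, `∑ aₙ ↦ ∑ zⁿ aₙ`. -/
def toPowerSeries : Grd A →+* PowerSeries R where
  toFun p := PowerSeries.mk fun k ↦ (twist A p).coeff k
  map_one' := HahnSeries.ofPowerSeries_injective (Γ := ℤ) (by
    rw [ofPowerSeries_mk_coeff (twist_mem _), map_one, map_one])
  map_mul' p q := HahnSeries.ofPowerSeries_injective (Γ := ℤ) (by
    rw [ofPowerSeries_mk_coeff (twist_mem _), map_mul (HahnSeries.ofPowerSeries ℤ R),
      ofPowerSeries_mk_coeff (twist_mem _), ofPowerSeries_mk_coeff (twist_mem _), map_mul])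
  map_zero' := HahnSeries.ofPowerSeries_injective (Γ := ℤ) (by
    rw [ofPowerSeries_mk_coeff (twist_mem _), map_zero, map_zero])
  map_add' p q := HahnSeries.ofPowerSeries_injective (Γ := ℤ) (by
    rw [ofPowerSeries_mk_coeff (twist_mem _), map_add (HahnSeries.ofPowerSeries ℤ R),
      ofPowerSeries_mk_coeff (twist_mem _), ofPowerSeries_mk_coeff (twist_mem _), map_add])

lemma coeff_toPowerSeries (p : Grd A) (k : ℕ) :
    PowerSeries.coeff k (toPowerSeries A p) = (twist A p).coeff k :=
  PowerSeries.coeff_mk _ fun k : ℕ ↦ (twist A p).coeff k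

lemma ofPowerSeries_toPowerSeries (p : Grd A) :
    HahnSeries.ofPowerSeries ℤ R (toPowerSeries A p) = twist A p :=
  ofPowerSeries_mk_coeff (twist_mem p)

lemma ofPowerSeries_toPowerSeries_monomial {n : ℕ} {x : LaurentSeries R} (hx : x ∈ grdComp A n) :
    HahnSeries.ofPowerSeries ℤ R (toPowerSeries A (monomial A n x hx)) =
      HahnSeries.single (n : ℤ) 1 * x :=
  (ofPowerSeries_toPowerSeries _).trans (twist_monomial hx)

lemma constantCoeff_toPowerSeries_monomial {n : ℕ} {x : LaurentSeries R} (hx : x ∈ grdComp A n) :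
    PowerSeries.constantCoeff (toPowerSeries A (monomial A n x hx)) = x.coeff (-n) := by
  rw [← PowerSeries.coeff_zero_eq_constantCoeff_apply]
  rw [coeff_toPowerSeries, twist_monomial, coeff_single_mul']
  simp

lemma toPowerSeries_algebraMap (r : R) :
    toPowerSeries A (algebraMap R (Grd A) r) = PowerSeries.C r := by
  refine HahnSeries.ofPowerSeries_injective (Γ := ℤ) ?_
  rw [ofPowerSeries_toPowerSeries, HahnSeries.ofPowerSeries_C]
  exact Polynomial.eval_C

variable {R' : Type u} [CommRing R'] {A' : Subalgebra R' (LaurentSeries R')}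

lemma toPowerSeries_grdMap (ψ : R →+* R') (h : ∀ a ∈ A, laurentMap ψ a ∈ A') (p : Grd A) :
    toPowerSeries A' (grdMap ψ h p) = PowerSeries.map ψ (toPowerSeries A p) := by
  ext k
  rw [PowerSeries.coeff_map, coeff_toPowerSeries, coeff_toPowerSeries, ← laurentMap_coeff]
  congr 1
  refine (Polynomial.eval_map _ _).trans ?_
  refine .trans ?_ (Polynomial.hom_eval₂ _ (RingHom.id _) (laurentMap ψ) _).symm
  congr 1
  ext n
  by_cases hn : n = 1 <;> simp [hn]

lemma sumHom_monomial {n : ℕ} {x : LaurentSeries R} (hx : x ∈ grdComp A n) :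
    (sumHom A (monomial A n x hx)).1 = x := by
  refine (Polynomial.eval_monomial).trans ?_
  rw [one_pow, mul_one]

lemma sumHom_grdMap (ψ : R →+* R') (h : ∀ a ∈ A, laurentMap ψ a ∈ A') (p : Grd A) :
    (sumHom A' (grdMap ψ h p)).1 = laurentMap ψ (sumHom A p).1 := by
  refine (Polynomial.eval_map _ _).trans ?_
  refine .trans ?_ (Polynomial.hom_eval₂ _ (RingHom.id _) (laurentMap ψ) _).symm
  rw [map_one]
  rfl

lemma sumHom_algebraMap (r : R) : sumHom A (algebraMap R (Grd A) r) = algebraMap R A r :=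
  Subtype.ext Polynomial.eval_C

end Grd

end Twist

/-! ### Morphisms from affine schemes to Proj. -/

section ProjMk

variable {σ A : Type u} [CommRing A] [SetLike σ A] [AddSubgroupClass σ A] (𝒜 : ℕ → σ)
  [GradedRing 𝒜] {T T' : Type u} [CommRing T] [CommRing T']

/-- The map from the degree `0` part of `A[1/s]` induced by a ring homomorphism on `A` that maps
`s` to a unit. -/
def liftAway (f : A →+* T) (s : A) (hs : IsUnit (f s)) : Away 𝒜 s →+* T :=
  (Localization.awayLift f s hs).comp (algebraMap (Away 𝒜 s) (Localization.Away s))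

lemma liftAway_mk_mul (f : A →+* T) {s : A} (hs : IsUnit (f s)) {d : ℕ} (hd : s ∈ 𝒜 d) (n : ℕ)
    (x : A) (hx : x ∈ 𝒜 (n • d)) :
    liftAway 𝒜 f s hs (Away.mk 𝒜 hd n x hx) * f s ^ n = f x := by
  obtain ⟨v, hv⟩ := hs.exists_right_inv
  change Localization.awayLift f s hs (Away.mk 𝒜 hd n x hx).val * _ = _
  rw [Away.val_mk, Localization.awayLift_mk _ _ _ v hv, mul_assoc, ← mul_pow, mul_comm v, hv,
    one_pow, mul_one]

lemma liftAway_ext {s : A} {d : ℕ} (hd : s ∈ 𝒜 d) (f : A →+* T) (hs : IsUnit (f s))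
    (g : Away 𝒜 s →+* T)
    (h : ∀ n x hx, g (Away.mk 𝒜 hd n x hx) * f s ^ n = f x) : g = liftAway 𝒜 f s hs := by
  ext y
  obtain ⟨n, x, hx, rfl⟩ := Away.mk_surjective 𝒜 hd y
  exact (hs.pow n).mul_right_cancel ((h n x hx).trans (liftAway_mk_mul 𝒜 f hs hd n x hx).symm)

lemma comp_liftAway {s : A} {d : ℕ} (hd : s ∈ 𝒜 d) (f : A →+* T) (hs : IsUnit (f s))
    (g : T →+* T') :
    g.comp (liftAway 𝒜 f s hs) = liftAway 𝒜 (g.comp f) s (hs.map g) :=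
  liftAway_ext 𝒜 hd _ _ _ fun n x hx ↦ by
    rw [RingHom.comp_apply, RingHom.comp_apply, RingHom.comp_apply, ← map_pow, ← map_mul,
      liftAway_mk_mul]

lemma liftAway_comp_awayMap {s s' x : A} {d d' : ℕ} (hd : s ∈ 𝒜 d) (hd' : s' ∈ 𝒜 d')
    (h : x = s * s') (f : A →+* T) (hs : IsUnit (f s)) (hx : IsUnit (f x)) :
    (liftAway 𝒜 f x hx).comp (awayMap 𝒜 hd' h) = liftAway 𝒜 f s hs :=
  liftAway_ext 𝒜 hd _ _ _ fun n y hy ↦ by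
    subst h
    have hs' : IsUnit (f s') := isUnit_of_mul_isUnit_right (by rwa [← map_mul])
    rw [RingHom.comp_apply, awayMap_mk]
    refine (hs'.pow n).mul_right_cancel ?_
    rw [mul_assoc, ← mul_pow, ← map_mul, liftAway_mk_mul, map_mul, map_pow]

lemma liftAway_comp_map {σ' B : Type u} [CommRing B] [SetLike σ' B] [AddSubgroupClass σ' B]
    {ℬ : ℕ → σ'} [GradedRing ℬ] (φ : 𝒜 →+*ᵍ ℬ) {s : A} {d : ℕ} (hd : s ∈ 𝒜 d)
    (f : B →+* T) (g : A →+* T) (h : ∀ a, f (φ a) = g a) (hs : IsUnit (f (φ s)))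
    (hs' : IsUnit (g s)) :
    (liftAway ℬ f (φ s) hs).comp (Away.map φ s) = liftAway 𝒜 g s hs' :=
  liftAway_ext 𝒜 hd _ _ _ fun n x hx ↦ by
    rw [RingHom.comp_apply, Away.map_mk, ← h, ← h, liftAway_mk_mul]

/-- The morphism to `Proj` induced by a ring homomorphism `f` that maps the homogeneous element `s`
of positive degree to a unit. -/
def projMk (f : A →+* T) {s : A} {d : ℕ} (hd : s ∈ 𝒜 d) (hpos : 0 < d) (hs : IsUnit (f s)) :
    Spec (.of T) ⟶ Proj 𝒜 :=
  Spec.map (CommRingCat.ofHom (liftAway 𝒜 f s hs)) ≫ Proj.awayι 𝒜 s hd hpos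

variable {𝒜}

/-- Both morphisms factor through D₊(s s'), where they are given by the same localization. This
independence of s is what makes the arbitrary choices of charts over different affine opens
compatible. -/
lemma projMk_congr (f : A →+* T) {s : A} {d : ℕ} (hd : s ∈ 𝒜 d) (hpos : 0 < d)
    (hs : IsUnit (f s)) {s' : A} {d' : ℕ} (hd' : s' ∈ 𝒜 d') (hpos' : 0 < d')
    (hs' : IsUnit (f s')) : projMk 𝒜 f hd hpos hs = projMk 𝒜 f hd' hpos' hs' := by
  have key {s : A} {d : ℕ} (hd : s ∈ 𝒜 d) (hpos : 0 < d) (hs : IsUnit (f s)) {s' : A} {d' : ℕ}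
      (hd' : s' ∈ 𝒜 d') {x : A} (hx : x = s * s') {e : ℕ} (he : x ∈ 𝒜 e) (hpe : 0 < e)
      (hd'' : e = d + d') (hux : IsUnit (f x)) :
      projMk 𝒜 f hd hpos hs = projMk 𝒜 f he hpe hux := by
    subst hd''
    rw [projMk, projMk, ← liftAway_comp_awayMap 𝒜 hd hd' hx f hs hux, CommRingCat.ofHom_comp,
      Spec.map_comp, Category.assoc, Proj.SpecMap_awayMap_awayι]
  have hu : IsUnit (f (s * s')) := by rw [map_mul]; exact hs.mul hs'
  rw [key hd hpos hs hd' rfl (SetLike.mul_mem_graded hd hd') (by lia) rfl hu,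
    key hd' hpos' hs' hd (mul_comm s s') (SetLike.mul_mem_graded hd hd') (by lia) (add_comm _ _) hu]

lemma specMap_projMk (f : A →+* T) {s : A} {d : ℕ} (hd : s ∈ 𝒜 d) (hpos : 0 < d)
    (hs : IsUnit (f s)) (g : T →+* T') :
    Spec.map (CommRingCat.ofHom g) ≫ projMk 𝒜 f hd hpos hs =
      projMk 𝒜 (g.comp f) hd hpos (hs.map g) := by
  rw [projMk, projMk, ← Category.assoc, ← Spec.map_comp, ← CommRingCat.ofHom_comp,
    comp_liftAway 𝒜 hd]

lemma projMk_projMap {σ' B : Type u} [CommRing B] [SetLike σ' B] [AddSubgroupClass σ' B]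
    {ℬ : ℕ → σ'} [GradedRing ℬ] (φ : 𝒜 →+*ᵍ ℬ) (hφ : ℬ₊ ≤ 𝒜₊.map φ) {s : A} {d : ℕ}
    (hd : s ∈ 𝒜 d) (hpos : 0 < d) (f : B →+* T) (g : A →+* T) (h : ∀ a, f (φ a) = g a)
    (hs : IsUnit (g s)) {s' : B} {d' : ℕ} (hd' : s' ∈ ℬ d') (hpos' : 0 < d')
    (hs' : IsUnit (f s')) :
    projMk ℬ f hd' hpos' hs' ≫ Proj.map φ hφ = projMk 𝒜 g hd hpos hs := by
  have hs'' : IsUnit (f (φ s)) := (h s).symm ▸ hs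
  rw [projMk_congr f hd' hpos' hs' (s' := φ s) (φ.map_mem hd) hpos hs'', projMk, projMk,
    Category.assoc,
    Proj.awayι_comp_map φ hφ hpos s hd, ← Category.assoc, ← Spec.map_comp,
    ← CommRingCat.ofHom_comp, liftAway_comp_map 𝒜 φ hd f g h]

lemma projMk_projToSpec {R A : Type u} [CommRing R] [CommRing A] [Algebra R A]
    {𝒜 : ℕ → Submodule R A} [GradedAlgebra 𝒜] (f : A →+* T) {s : A} {d : ℕ} (hd : s ∈ 𝒜 d)
    (hpos : 0 < d) (hs : IsUnit (f s)) :
    projMk 𝒜 f hd hpos hs ≫ projToSpec 𝒜 =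
      Spec.map (CommRingCat.ofHom (f.comp (algebraMap R A))) := by
  rw [projMk, Category.assoc, awayι_projToSpec, ← Spec.map_comp, ← CommRingCat.ofHom_comp]
  congr 2
  ext r
  have hx : algebraMap R A r ∈ 𝒜 (0 • d) := by
    rw [zero_smul]; exact SetLike.algebraMap_mem_graded 𝒜 r
  refine .trans (congrArg (liftAway 𝒜 f s hs) (a₂ := Away.mk 𝒜 hd 0 (algebraMap R A r) hx) ?_) ?_
  · apply HomogeneousLocalization.val_injective
    rw [Away.val_mk]
    change Localization.mk (algebraMap R A r) 1 = _
    congr 1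
    ext; simp
  · simpa using liftAway_mk_mul 𝒜 f hs hd 0 _ hx

/-- On D₊(s) the open D₊(g) is defined by gᵈ/sᵐ. Its image in `T` times the unit f(s)ᵐ is f(g)ᵈ, and
a prime contains f(g)ᵈ exactly when it contains f(g). -/
lemma projMk_preimage_basicOpen (f : A →+* T) {s : A} {d : ℕ} (hd : s ∈ 𝒜 d) (hpos : 0 < d)
    (hs : IsUnit (f s)) {g : A} {m : ℕ} (hm : g ∈ 𝒜 m) (hmpos : 0 < m) :
    projMk 𝒜 f hd hpos hs ⁻¹ᵁ Proj.basicOpen 𝒜 g = PrimeSpectrum.basicOpen (f g) := by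
  rw [projMk, Scheme.Hom.comp_preimage, Proj.awayι_preimage_basicOpen 𝒜 hd hpos hm hmpos]
  ext x
  change liftAway 𝒜 f s hs _ ∉ x.asIdeal ↔ f g ∉ x.asIdeal
  rw [not_iff_not]
  have h := liftAway_mk_mul 𝒜 f hs hd m (g ^ d) (by
    convert! SetLike.pow_mem_graded d hm using 2; exact mul_comm _ _)
  rw [← Ideal.mul_unit_mem_iff_mem _ (hs.pow m), h, map_pow]
  exact x.2.pow_mem_iff_mem d hpos

end ProjMk

/-! ### The charts D₊(s) and D₊(1) over an affine base. -/

section Chart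

variable {R : Type u} [CommRing R] (A : Subalgebra R (LaurentSeries R))

/-- Lifts of finitely many generators of the quotient all lie in a single step of the exhaustive
filtration. -/
lemma exists_sup_eq_top_of_finite_quotient {M : Type*} [AddCommGroup M] [Module R M]
    (F : ℕ → Submodule R M) (hF : Monotone F) (hM : ∀ x, ∃ n, x ∈ F n) (K : Submodule R M)
    [h : Module.Finite R (M ⧸ (K ⊔ F 0))] : ∃ n, K ⊔ F n = ⊤ := by
  classical
  obtain ⟨s, hs⟩ := h.fg_top
  choose x hx using Submodule.mkQ_surjective (K ⊔ F 0)
  choose n hn using hM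
  refine ⟨s.sup fun y ↦ n (x y), ?_⟩
  have h1 : (⊤ : Submodule R (M ⧸ (K ⊔ F 0))) ≤
      (K ⊔ F (s.sup fun y ↦ n (x y))).map (K ⊔ F 0).mkQ := by
    rw [← hs, Submodule.span_le]
    exact fun y hy ↦ ⟨x y, Submodule.mem_sup_right
      (hF (Finset.le_sup (f := fun y ↦ n (x y)) hy) (hn _)), hx y⟩
  have h2 := Submodule.comap_mono (f := (K ⊔ F 0).mkQ) h1
  rw [Submodule.comap_top, Submodule.comap_map_eq, Submodule.ker_mkQ, sup_eq_left.mpr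
    (sup_le_sup_left (hF (Nat.zero_le _)) _)] at h2
  exact top_le_iff.mp h2

/-- Elements `a, b ∈ A` with leading coefficient `1` whose pole orders are consecutive integers
`M, M + 1`. -/
structure Chart where
  /-- the pole order of `a` -/
  M : ℕ
  -- The covering argument divides an element of degree M·i or (M + 1)·i, with i ≥ 1, by the element
  -- 1 of degree 1. The bound keeps the resulting degree positive; in degree 0 the algebra contains
  -- only R and not all of A ∩ R[[z]].
  two_le : 2 ≤ M
  /-- an element of pole order `M` -/
  a : LaurentSeries R
  /-- an element of pole order `M + 1` -/
  b : LaurentSeries R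
  a_mem : a ∈ A
  b_mem : b ∈ A
  a_order : a ∈ orderLE R (M : ℤ)
  b_order : b ∈ orderLE R ((M + 1 : ℕ) : ℤ)
  a_coeff : a.coeff (-M : ℤ) = 1
  b_coeff : b.coeff (-(M + 1 : ℕ) : ℤ) = 1

variable {A}

/-- Write z⁻ⁿ = a + y with y of pole order at most N < n. Then a has the same coefficients as z⁻ⁿ in
all degrees up to -n. -/
lemma exists_monic_of_sup_eq_top {N : ℕ}
    (h : Subalgebra.toSubmodule A ⊔ orderLE R (N : ℤ) = ⊤) {n : ℕ} (hn : N < n) :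
    ∃ a ∈ A, a ∈ orderLE R (n : ℤ) ∧ a.coeff (-n : ℤ) = 1 := by
  have hx : HahnSeries.single (-n : ℤ) (1 : R) ∈
      Subalgebra.toSubmodule A ⊔ orderLE R (N : ℤ) := by rw [h]; exact Submodule.mem_top
  obtain ⟨a, ha, y, hy, hay⟩ := Submodule.mem_sup.mp hx
  have hc (k : ℤ) : a.coeff k + y.coeff k = (HahnSeries.single (-n : ℤ) (1 : R)).coeff k := by
    rw [← hay]; rfl
  refine ⟨a, ha, fun k hk ↦ ?_, ?_⟩
  · have := hc k
    rwa [hy k (by lia), HahnSeries.coeff_single_of_ne (by lia), add_zero] at this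
  · have := hc (-n)
    rwa [hy _ (by lia), HahnSeries.coeff_single_same, add_zero] at this

lemma nonempty_chart (h : ∃ N : ℕ, Subalgebra.toSubmodule A ⊔ orderLE R (N : ℤ) = ⊤) :
    Nonempty (Chart A) := by
  obtain ⟨N, h⟩ := h
  obtain ⟨a, ha, ha', ha''⟩ := exists_monic_of_sup_eq_top h (n := N + 2) (by lia)
  obtain ⟨b, hb, hb', hb''⟩ := exists_monic_of_sup_eq_top h (n := N + 2 + 1) (by lia)
  exact ⟨⟨N + 2, by lia, a, b, ha, hb, ha', hb', ha'', hb''⟩⟩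

/-- The coefficient at the extreme index is the constant coefficient of the associated power series,
hence multiplicative. -/
lemma coeff_pow_of_mem_grdComp {n : ℕ} {x : LaurentSeries R} (hx : x ∈ grdComp A n) (k : ℕ) :
    (x ^ k).coeff (-(k * n : ℕ) : ℤ) = x.coeff (-n) ^ k := by
  rw [← Grd.constantCoeff_toPowerSeries_monomial (Grd.pow_mem_grdComp hx k), ← Grd.monomial_pow hx,
    map_pow, map_pow, Grd.constantCoeff_toPowerSeries_monomial hx]

namespace Chart

variable (c : Chart A)

/-- The degree of `c.s`. -/
def d : ℕ := 2 * c.M + 1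

lemma d_pos : 0 < c.d := Nat.succ_pos _

lemma a_mem_grdComp : c.a ∈ grdComp A c.M :=
  (mem_grdComp_of_pos A (by have := c.two_le; lia)).mpr ⟨c.a_mem, c.a_order⟩

lemma b_mem_grdComp : c.b ∈ grdComp A (c.M + 1) :=
  (mem_grdComp_of_pos A (by lia)).mpr ⟨c.b_mem, c.b_order⟩

lemma ab_mem_grdComp : c.a * c.b ∈ grdComp A c.d := by
  have := mul_mem_grdComp A c.a_mem_grdComp c.b_mem_grdComp
  rwa [show c.M + (c.M + 1) = c.d by rw [d]; lia] at this

/-- The homogeneous element `a b` of `grd(A)`. -/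
def s : Grd A := Grd.monomial A c.d (c.a * c.b) c.ab_mem_grdComp

lemma s_mem : c.s ∈ grdPiece A c.d := Grd.monomial_mem A _ _ _

lemma s_eq : c.s = Grd.monomial A _ c.a c.a_mem_grdComp * Grd.monomial A _ c.b c.b_mem_grdComp := by
  rw [Grd.monomial_mul]
  exact Grd.monomial_congr (by rw [d]; lia) rfl _ _

lemma isUnit_a : IsUnit (Grd.toPowerSeries A (.monomial A _ c.a c.a_mem_grdComp)) := by
  rw [PowerSeries.isUnit_iff_constantCoeff, Grd.constantCoeff_toPowerSeries_monomial, c.a_coeff]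
  exact isUnit_one

lemma isUnit_b : IsUnit (Grd.toPowerSeries A (.monomial A _ c.b c.b_mem_grdComp)) := by
  rw [PowerSeries.isUnit_iff_constantCoeff, Grd.constantCoeff_toPowerSeries_monomial, c.b_coeff]
  exact isUnit_one

lemma isUnit_s : IsUnit (Grd.toPowerSeries A c.s) := by
  rw [s_eq, map_mul]
  exact c.isUnit_a.mul c.isUnit_b

lemma ofPowerSeries_toPowerSeries_s : HahnSeries.ofPowerSeries ℤ R (Grd.toPowerSeries A c.s) =
    HahnSeries.single (c.d : ℤ) 1 * (c.a * c.b) :=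
  Grd.ofPowerSeries_toPowerSeries_monomial _

lemma isUnit_ab : IsUnit (c.a * c.b) := by
  have h := c.isUnit_s.map (HahnSeries.ofPowerSeries ℤ R)
  rw [ofPowerSeries_toPowerSeries_s] at h
  exact isUnit_of_mul_isUnit_right h

/-- The degree `0` part of `grd(A)[1/s]`. -/
abbrev B : Type u := Away (grdPiece A) c.s

/-- The fraction `x / sᵏ`. -/
def frac (k : ℕ) (x : LaurentSeries R) (hx : x ∈ grdComp A (k • c.d)) : c.B :=
  Away.mk (grdPiece A) c.s_mem k (Grd.monomial A _ x hx) (Grd.monomial_mem A _ _ _)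

lemma exists_eq_frac (y : c.B) : ∃ k x hx, y = c.frac k x hx := by
  obtain ⟨k, p, hp, rfl⟩ := Away.mk_surjective (grdPiece A) c.s_mem y
  refine ⟨k, _, p.coeff_mem _, ?_⟩
  rw [frac]
  congr 1
  exact Grd.eq_monomial_of_mem hp

/-- The expansion of the elements of `grd(A)[1/s]₀` as power series. -/
def expand : c.B →+* PowerSeries R :=
  liftAway (grdPiece A) (Grd.toPowerSeries A) c.s c.isUnit_s

/-- The twists z^{kd} in numerator and denominator cancel, so the expansion of x/sᵏ is x/(ab)ᵏ in
R((z)). Identities between fractions thereby become identities of Laurent series, to be checked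
after multiplication by a power of the unit ab (see `ext_expand`). -/
lemma expand_frac_mul (k : ℕ) (x : LaurentSeries R) (hx : x ∈ grdComp A (k • c.d)) :
    HahnSeries.ofPowerSeries ℤ R (c.expand (c.frac k x hx)) * (c.a * c.b) ^ k = x := by
  have h := congrArg (HahnSeries.ofPowerSeries ℤ R) (liftAway_mk_mul (grdPiece A)
    (Grd.toPowerSeries A) c.isUnit_s c.s_mem k _ (Grd.monomial_mem A _ x hx))
  rw [map_mul, map_pow, Grd.ofPowerSeries_toPowerSeries_monomial, ofPowerSeries_toPowerSeries_s,
    mul_pow, HahnSeries.single_pow, one_pow,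
    mul_left_comm, show (k • (c.d : ℤ)) = ((k • c.d : ℕ) : ℤ) by simp] at h
  exact (isUnit_single _).mul_left_cancel h

lemma expand_injective : Function.Injective c.expand := by
  rw [injective_iff_map_eq_zero]
  intro y hy
  obtain ⟨k, x, hx, rfl⟩ := c.exists_eq_frac y
  have h := c.expand_frac_mul k x hx
  rw [hy, map_zero, zero_mul] at h
  apply HomogeneousLocalization.val_injective
  rw [frac, Away.val_mk, HomogeneousLocalization.val_zero,
    show Grd.monomial A _ x hx = 0 from Grd.ext fun m ↦ by
      rw [Grd.coeff_monomial, Grd.coeff_zero, ← h, ite_self]]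
  exact Localization.mk_zero _

lemma ext_expand {y y' : c.B} (n : ℕ)
    (h : HahnSeries.ofPowerSeries ℤ R (c.expand y) * (c.a * c.b) ^ n =
      HahnSeries.ofPowerSeries ℤ R (c.expand y') * (c.a * c.b) ^ n) : y = y' :=
  c.expand_injective (HahnSeries.ofPowerSeries_injective ((c.isUnit_ab.pow n).mul_right_cancel h))

/-- The pole order of a² is at most 2M = d - 1, one less than its degree here allows; this gap is
the origin of the simple zero of `f`. -/
lemma a_sq_mem : c.a ^ 2 ∈ grdComp A (1 • c.d) :=
  (mem_grdComp_of_pos A (by rw [d]; lia)).mpr ⟨A.pow_mem c.a_mem 2, orderLE_mono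
    (by rw [d]; lia) (sq c.a ▸ mul_mem_orderLE c.a_order c.a_order)⟩

/-- The parameter `a² / s` along the section at infinity. -/
def f : c.B := c.frac 1 (c.a ^ 2) c.a_sq_mem

/-- The expansion of f times zᵈab equals zᵈa² = z·(zᴹa)², where both zᵈab and zᴹa are units of
R[[z]]. -/
lemma expand_f : ∃ u, IsUnit u ∧ c.expand c.f = PowerSeries.X * u := by
  obtain ⟨ua, hua⟩ := c.isUnit_a
  obtain ⟨us, hus⟩ := c.isUnit_s
  refine ⟨ua ^ 2 * us⁻¹, (ua ^ 2 * us⁻¹).isUnit, us.isUnit.mul_right_cancel ?_⟩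
  rw [mul_assoc, mul_assoc, Units.inv_mul, mul_one]
  refine HahnSeries.ofPowerSeries_injective (Γ := ℤ) ?_
  rw [map_mul, hus, hua, map_mul, map_pow, ofPowerSeries_toPowerSeries_s,
    Grd.ofPowerSeries_toPowerSeries_monomial, mul_left_comm, HahnSeries.ofPowerSeries_X,
    show c.a * c.b = (c.a * c.b) ^ 1 from (pow_one _).symm, f, expand_frac_mul, mul_pow,
    HahnSeries.single_pow, ← mul_assoc, HahnSeries.single_mul_single, one_pow, one_mul, d]
  congr 2
  simp; lia

/-- For y = x/sᵏ the quotient by f must be xb²/s^{k+1}. The vanishing constant coefficient lowers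
the pole order of x to at most kd - 1, and kd - 1 + 2(M + 1) = (k + 1)d, so this numerator has
admissible degree. -/
lemma f_dvd_of_constantCoeff {y : c.B} (hy : PowerSeries.constantCoeff (c.expand y) = 0) :
    c.f ∣ y := by
  obtain ⟨k, x, hx, rfl⟩ := c.exists_eq_frac y
  have hle := grdComp_le A _ hx
  have hx' : x.coeff (-(k • c.d : ℕ) : ℤ) = 0 := by
    have h := congrArg PowerSeries.constantCoeff (liftAway_mk_mul (grdPiece A)
      (Grd.toPowerSeries A) c.isUnit_s c.s_mem k _ (Grd.monomial_mem A _ x hx))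
    rw [map_mul] at h
    rw [← Grd.constantCoeff_toPowerSeries_monomial hx, ← h]
    exact (congrArg (· * _) hy).trans (zero_mul _)
  have hw : x * c.b ^ 2 ∈ grdComp A ((k + 1) • c.d) := by
    refine (mem_grdComp_of_pos A (by simp [d])).mpr
      ⟨A.mul_mem hle.1 (A.pow_mem c.b_mem 2), ?_⟩
    refine orderLE_mono ?_ (mul_mem_orderLE (orderLE_pred hle.2 hx')
      (sq c.b ▸ mul_mem_orderLE c.b_order c.b_order))
    rw [d]; simp; lia
  refine ⟨c.frac (k + 1) _ hw, c.ext_expand (1 + (k + 1)) ?_⟩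
  rw [map_mul, map_mul, pow_add (c.a * c.b) 1 (k + 1), mul_mul_mul_comm, f, expand_frac_mul,
    expand_frac_mul, ← pow_add, show 1 + (k + 1) = k + 2 by lia, pow_add (c.a * c.b) k, ← mul_assoc,
    expand_frac_mul]
  ring

/-- The fraction `1 / s` in degree `0`. -/
def κ : c.B := c.frac 1 1 (by
  rw [one_smul]
  refine (mem_grdComp_of_pos A c.d_pos).mpr ⟨A.one_mem, fun k hk ↦ ?_⟩
  rw [HahnSeries.coeff_one, if_neg (by lia)])

lemma b_pow_mem : c.b ^ (2 * c.d) ∈ grdComp A ((c.d + 1) • c.d) := by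
  have h := Grd.pow_mem_grdComp c.b_mem_grdComp (2 * c.d)
  rwa [show 2 * c.d * (c.M + 1) = (c.d + 1) • c.d by rw [smul_eq_mul, d]; ring] at h

lemma a_pow_mem : c.a ^ (2 * c.d) ∈ grdComp A ((2 * c.M) • c.d) := by
  have h := Grd.pow_mem_grdComp c.a_mem_grdComp (2 * c.d)
  rwa [show 2 * c.d * c.M = (2 * c.M) • c.d by rw [smul_eq_mul]; ring] at h

/-- In R((z)) one has f = a/b and κ = 1/(ab), which forces g = b^{2d}/(ab)^{d+1}. Its inverse is
a^{2d}/(ab)^{2M}, because d + 1 + 2M = 2d. Consequently, on D₊(s), the locus κ = 0 is P as a set,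
and κ generates the d-th power of the ideal of P. -/
lemma exists_κ_eq : ∃ g : c.B, IsUnit g ∧ c.κ = c.f ^ c.d * g := by
  refine ⟨c.frac _ _ c.b_pow_mem, .of_mul_eq_one (c.frac _ _ c.a_pow_mem)
    (c.ext_expand (c.d + 1 + 2 * c.M) ?_), c.ext_expand (c.d + (c.d + 1)) ?_⟩
  · rw [map_mul, map_mul, pow_add, mul_mul_mul_comm, expand_frac_mul, expand_frac_mul, map_one,
      map_one, one_mul, ← pow_add, mul_comm (c.b ^ _), ← mul_pow]
    congr 1
    rw [d]; lia
  · rw [map_mul, map_mul, map_pow, map_pow, pow_add _ c.d (c.d + 1), mul_mul_mul_comm,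
      expand_frac_mul, ← mul_pow]
    have hf := c.expand_frac_mul 1 _ c.a_sq_mem
    rw [pow_one] at hf
    rw [f, hf]
    have h := c.expand_frac_mul 1 1 (by
      rw [one_smul]
      refine (mem_grdComp_of_pos A c.d_pos).mpr ⟨A.one_mem, fun k hk ↦ ?_⟩
      rw [HahnSeries.coeff_one, if_neg (by lia)])
    rw [show (c.a * c.b) ^ c.d * (c.a * c.b) ^ (c.d + 1) = (c.a * c.b) ^ 1 * (c.a * c.b) ^ (2 * c.d)
      by rw [← pow_add, ← pow_add]; congr 1; lia, ← mul_assoc, κ, h, one_mul, mul_pow]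
    ring

lemma κ_eq_isLocalizationElem :
    Away.isLocalizationElem c.s_mem (Grd.oneOne_mem A) = c.κ := by
  apply HomogeneousLocalization.val_injective
  rw [Away.isLocalizationElem, κ, frac, Away.val_mk, Away.val_mk, Grd.oneOne, Grd.monomial_pow]
  congr 1
  exact Grd.monomial_congr (by rw [smul_eq_mul]; lia) (one_pow _) _ _

/-- A prime containing s contains a or b; let m be the degree of that monic element. If y has degree
i and leading coefficient r, then yᵐ - rᵐaⁱ (or with b in place of a) has pole order below mi, so it
is divisible by the element 1 of degree 1. If the prime also contains that element, it contains yᵐ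
and hence y, for all y of positive degree. -/
lemma oneOne_or_s_notMem (x : Proj (grdPiece A)) :
    x ∈ Proj.basicOpen (grdPiece A) c.s ⊔ Proj.basicOpen (grdPiece A) (Grd.oneOne A) := by
  by_contra hx
  rw [TopologicalSpace.Opens.mem_sup, not_or, Proj.mem_basicOpen, Proj.mem_basicOpen, not_not,
    not_not] at hx
  obtain ⟨hs, ht⟩ := hx
  have key {m : ℕ} (hm : 2 ≤ m) (a : LaurentSeries R) (ha : a ∈ grdComp A m)
      (ha' : a.coeff (-m) = 1) (h : Grd.monomial A m a ha ∈ x.asHomogeneousIdeal) : False := by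
    refine x.not_irrelevant_le ?_
    rw [← toIdeal_le_toIdeal_iff, toIdeal_irrelevant_le]
    intro i hi y hy
    rw [Grd.eq_monomial_of_mem hy]
    set y0 := y.coeff i
    have hy0 : y0 ∈ grdComp A i := y.coeff_mem i
    set r := y0.coeff (-i)
    have h1 := Grd.pow_mem_grdComp hy0 m
    have h2 := Submodule.smul_mem _ (r ^ m) (Grd.pow_mem_grdComp ha i)
    -- The coefficients of index -mi cancel, so the difference already lives in degree mi - 1.
    have hw : y0 ^ m - r ^ m • a ^ i ∈ grdComp A (m * i - 1) := by
      have hpos : 2 ≤ m * i := by nlinarith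
      rw [mul_comm i m] at h2
      have hmem := grdComp_le A _ (sub_mem h1 h2)
      refine (mem_grdComp_of_pos A (by lia)).mpr ⟨hmem.1, ?_⟩
      have := orderLE_pred hmem.2 ?_
      · exact orderLE_mono (by push_cast [show 1 ≤ m * i by lia]; lia) this
      · have e2 := coeff_pow_of_mem_grdComp ha i
        rw [mul_comm i m] at e2
        rw [HahnSeries.coeff_sub, HahnSeries.coeff_smul, coeff_pow_of_mem_grdComp hy0, e2, ha',
          one_pow, smul_eq_mul, mul_one, sub_self]
    have hpow : Grd.monomial A i y0 hy0 ^ m = (r ^ m) • Grd.monomial A m a ha ^ i +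
        Grd.oneOne A * Grd.monomial A _ _ hw := by
      rw [Grd.monomial_pow, Grd.monomial_pow, Grd.oneOne, Grd.monomial_mul]
      refine Grd.ext fun k ↦ ?_
      have : 0 < m * i := by positivity
      rw [Grd.coeff_add, Grd.coeff_smul, Grd.coeff_monomial, Grd.coeff_monomial, Grd.coeff_monomial,
        mul_comm i m, show 1 + (m * i - 1) = m * i by lia]
      split_ifs
      · rw [one_mul, add_sub_cancel]
      · simp
    refine x.isPrime.mem_of_pow_mem m ?_
    rw [hpow]
    refine add_mem (Submodule.smul_of_tower_mem _ _ (Ideal.pow_mem_of_mem _ h i hi))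
      (Ideal.mul_mem_right _ _ ht)
  rw [c.s_eq] at hs
  obtain h | h := x.isPrime.mem_or_mem hs
  · exact key c.two_le _ _ c.a_coeff h
  · exact key (by have := c.two_le; lia) _ _ c.b_coeff h

lemma basicOpen_sup_basicOpen :
    Proj.basicOpen (grdPiece A) c.s ⊔ Proj.basicOpen (grdPiece A) (Grd.oneOne A) = ⊤ :=
  top_le_iff.mp fun x _ ↦ c.oneOne_or_s_notMem x

end Chart

lemma awayToA_mk (n : ℕ) (x : LaurentSeries R) (hx : x ∈ grdComp A (n • 1)) :
    (awayToA A (Away.mk (grdPiece A) (Grd.oneOne_mem A) n (Grd.monomial A _ x hx)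
      (Grd.monomial_mem A _ _ _))).1 = x := by
  have h := liftAway_mk_mul (grdPiece A) (Grd.sumHom A) (s := Grd.oneOne A)
    (by rw [Grd.sumHom_oneOne]; exact isUnit_one) (Grd.oneOne_mem A) n _ (Grd.monomial_mem A _ x hx)
  have h1 : Grd.sumHom A (Grd.oneOne A) ^ n = 1 := by rw [Grd.sumHom_oneOne, one_pow]
  rw [h1, mul_one] at h
  exact (congrArg Subtype.val h).trans (Grd.sumHom_monomial hx)

/-- A fraction x/1ⁿ is determined by the Laurent series x. Conversely, an element of A has pole
order at most n for some n, and n is taken positive so that the degree n component is A⁽ⁿ⁾. -/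
lemma awayToA_bijective : Function.Bijective (awayToA A) := by
  constructor
  · rw [injective_iff_map_eq_zero]
    intro y hy
    obtain ⟨n, p, hp, rfl⟩ := Away.mk_surjective (grdPiece A) (Grd.oneOne_mem A) y
    have hp' := Grd.eq_monomial_of_mem hp
    have h := awayToA_mk n _ (p.coeff_mem (n • 1))
    have h0 : p = 0 := by
      rw [hp']
      refine Grd.ext fun m ↦ ?_
      rw [Grd.coeff_monomial, ← h]
      simp only [← hp', hy]
      rw [Grd.coeff_zero]
      exact ite_self _
    subst h0
    apply HomogeneousLocalization.val_injective
    rw [Away.val_mk, HomogeneousLocalization.val_zero]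
    exact Localization.mk_zero _
  · intro a
    obtain ⟨n, hn, ha⟩ := exists_mem_orderLE a.1
    have hx : a.1 ∈ grdComp A (n • 1) := by
      rw [smul_eq_mul, mul_one]
      exact (mem_grdComp_of_pos A hn).mpr ⟨a.2, ha⟩
    exact ⟨_, Subtype.ext (awayToA_mk n _ hx)⟩

end Chart

/-! ### Pulling back functions along morphisms from an affine scheme. -/

section EvalOn

variable {X Y : Scheme.{u}} {T T' : Type u} [CommRing T] [CommRing T']

/-- Restriction of functions to a smaller open subset. -/
def opensRes {V V' : X.Opens} (h : V' ≤ V) : Γ(X, V) →+* Γ(X, V') :=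
  (X.presheaf.map (homOfLE h).op).hom

lemma opensRes_opensRes {V V' V'' : X.Opens} (h : V' ≤ V) (h' : V'' ≤ V') (x : Γ(X, V)) :
    opensRes h' (opensRes h x) = opensRes (h'.trans h) x := by
  rw [opensRes, opensRes, opensRes, ← RingHom.comp_apply, ← CommRingCat.hom_comp,
    ← Functor.map_comp]
  rfl

lemma opensRes_refl {V : X.Opens} (h : V ≤ V) (x : Γ(X, V)) : opensRes h x = x := by
  have : (homOfLE h).op = 𝟙 _ := Subsingleton.elim _ _
  rw [opensRes, this, CategoryTheory.Functor.map_id]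
  rfl

lemma opensRes_bijective_of_eq {V V' : X.Opens} (h : V' ≤ V) (e : V' = V) :
    Function.Bijective (opensRes h) := by
  subst e
  exact ⟨fun x y h ↦ by rwa [opensRes_refl, opensRes_refl] at h, fun x ↦ ⟨x, opensRes_refl _ x⟩⟩

/-- The pullback of functions on `V` to `T` along a morphism `Spec T ⟶ X` that lands in `V`. -/
def evalOn (q : Spec (.of T) ⟶ X) (V : X.Opens) (h : q ⁻¹ᵁ V = ⊤) : Γ(X, V) →+* T :=
  (q.appLE V ⊤ h.ge ≫ (Scheme.ΓSpecIso (.of T)).hom).hom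

lemma evalOn_congr {q q' : Spec (.of T) ⟶ X} (e : q = q') {V : X.Opens} (h : q ⁻¹ᵁ V = ⊤)
    (h' : q' ⁻¹ᵁ V = ⊤) (x : Γ(X, V)) : evalOn q V h x = evalOn q' V h' x := by
  subst e; rfl

lemma evalOn_opensRes (q : Spec (.of T) ⟶ X) {V V' : X.Opens} (i : V' ≤ V) (h : q ⁻¹ᵁ V = ⊤)
    (h' : q ⁻¹ᵁ V' = ⊤) (x : Γ(X, V)) : evalOn q V' h' (opensRes i x) = evalOn q V h x := by
  rw [evalOn, evalOn, opensRes, ← RingHom.comp_apply, ← CommRingCat.hom_comp, ← Category.assoc,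
    Scheme.Hom.map_appLE]

lemma evalOn_comp (q : Spec (.of T) ⟶ Y) (r : Y ⟶ X) (V : X.Opens) (h : (q ≫ r) ⁻¹ᵁ V = ⊤)
    (x : Γ(X, V)) : evalOn (q ≫ r) V h x = evalOn q (r ⁻¹ᵁ V) h (r.app V x) := by
  simp only [evalOn]
  rw [Scheme.Hom.comp_appLE, Category.assoc]
  rfl

lemma preimage_specMap_comp (g : T →+* T') {q : Spec (.of T) ⟶ X} {V : X.Opens}
    (h : q ⁻¹ᵁ V = ⊤) : (Spec.map (CommRingCat.ofHom g) ≫ q) ⁻¹ᵁ V = ⊤ := by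
  rw [Scheme.Hom.comp_preimage, h]; rfl

lemma evalOn_specMap_comp (g : T →+* T') (q : Spec (.of T) ⟶ X) (V : X.Opens) (h : q ⁻¹ᵁ V = ⊤)
    (h' : (Spec.map (CommRingCat.ofHom g) ≫ q) ⁻¹ᵁ V = ⊤) (x : Γ(X, V)) :
    evalOn (Spec.map (CommRingCat.ofHom g) ≫ q) V h' x = g (evalOn q V h x) := by
  have e : (Spec.map (CommRingCat.ofHom g) ≫ q).appLE V ⊤ h'.ge ≫ (Scheme.ΓSpecIso (.of T')).hom =
      (q.appLE V ⊤ h.ge ≫ (Scheme.ΓSpecIso (.of T)).hom) ≫ CommRingCat.ofHom g := by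
    rw [Category.assoc, ← Scheme.ΓSpecIso_naturality, ← Category.assoc,
      ← Scheme.Hom.appLE_comp_appLE _ _ V ⊤ ⊤ h.ge le_top]
    congr 2
  exact congrArg (fun f ↦ f.hom x) e

lemma preimage_basicOpen_evalOn (q : Spec (.of T) ⟶ X) (V : X.Opens) (h : q ⁻¹ᵁ V = ⊤)
    (x : Γ(X, V)) : q ⁻¹ᵁ X.basicOpen x = PrimeSpectrum.basicOpen (evalOn q V h x) := by
  have h1 := Scheme.basicOpen_appLE q ⊤ V h.ge x
  rw [top_inf_eq] at h1
  rw [← h1, basicOpen_eq_of_affine']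
  rfl

lemma evalOn_bijective (q : Spec (.of T) ⟶ X) [IsOpenImmersion q] (V : X.Opens)
    (hV : V = q.opensRange) (h : q ⁻¹ᵁ V = ⊤) : Function.Bijective (evalOn q V h) := by
  have := q.isIso_app V hV.le
  have h1 : q.appLE V ⊤ h.ge = q.app V ≫ (Spec (.of T)).presheaf.map (eqToHom h.symm).op := rfl
  have : IsIso (q.appLE V ⊤ h.ge ≫ (Scheme.ΓSpecIso (.of T)).hom) := by
    rw [h1]; infer_instance
  exact ConcreteCategory.bijective_of_isIso (q.appLE V ⊤ h.ge ≫ (Scheme.ΓSpecIso (.of T)).hom)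

lemma evalOn_fromSpec_self {U : X.Opens} (hU : IsAffineOpen U) (h : hU.fromSpec ⁻¹ᵁ U = ⊤)
    (x : Γ(X, U)) : evalOn (T := Γ(X, U)) hU.fromSpec U h x = x := by
  have h1 : hU.fromSpec.appLE U ⊤ h.ge ≫ (Scheme.ΓSpecIso Γ(X, U)).hom = 𝟙 _ := by
    rw [Scheme.Hom.appLE, ← Iso.eq_comp_inv, Category.id_comp, hU.fromSpec_app_self, Category.assoc,
      ← Functor.map_comp]
    exact (congrArg _ (CategoryTheory.Functor.map_id _ _)).trans (Category.comp_id _)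
  exact congrArg (fun f ↦ f.hom x) h1

lemma preimage_fromSpec_of_le {U V : X.Opens} (hU : IsAffineOpen U) (i : U ≤ V) :
    hU.fromSpec ⁻¹ᵁ V = ⊤ := by
  refine top_le_iff.mp fun y _ ↦ i ?_
  have : hU.fromSpec y ∈ hU.fromSpec.opensRange := ⟨y, rfl⟩
  rwa [hU.opensRange_fromSpec] at this

lemma evalOn_fromSpec {U V : X.Opens} (hU : IsAffineOpen U) (i : U ≤ V)
    (h : hU.fromSpec ⁻¹ᵁ V = ⊤) (x : Γ(X, V)) :
    evalOn (T := Γ(X, U)) hU.fromSpec V h x = opensRes i x := by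
  rw [← evalOn_fromSpec_self hU (preimage_fromSpec_of_le hU le_rfl) (opensRes i x)]
  exact (evalOn_opensRes _ i h _ x).symm

end EvalOn

/-! ### Morphisms out of relatively glued schemes. -/

section Gluing

variable {S Y : Scheme.{u}} {𝒰 : S.OpenCover} [Category 𝒰.I₀] [𝒰.LocallyDirected]
  [Small.{u} 𝒰.I₀] [Quiver.IsThin 𝒰.I₀] (G : 𝒰.RelativeGluingData)

lemma isOpenImmersion_cover (i : 𝒰.I₀) : IsOpenImmersion (G.cover.f i) :=
  G.cover.map_prop i

lemma map_cover {i j : 𝒰.I₀} (h : i ⟶ j) : G.functor.map h ≫ G.cover.f j = G.cover.f i :=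
  colimit.w G.functor h

/-- Morphisms out of a relatively glued scheme. -/
def gluedDesc (g : ∀ i, G.functor.obj i ⟶ Y)
    (h : ∀ {i j : 𝒰.I₀} (f : i ⟶ j), G.functor.map f ≫ g j = g i) : G.glued ⟶ Y :=
  colimit.desc G.functor
    { pt := Y
      ι := { app := g, naturality _ _ f := (h f).trans (Category.comp_id _).symm } }

lemma cover_gluedDesc (g : ∀ i, G.functor.obj i ⟶ Y)
    (h : ∀ {i j : 𝒰.I₀} (f : i ⟶ j), G.functor.map f ≫ g j = g i) (i : 𝒰.I₀) :
    G.cover.f i ≫ gluedDesc G g h = g i :=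
  colimit.ι_desc _ _

lemma cover_toBase (i : 𝒰.I₀) : G.cover.f i ≫ G.toBase = G.natTrans.app i ≫ 𝒰.f i :=
  G.ι_toBase i

lemma glued_hom_ext {f g : G.glued ⟶ Y} (h : ∀ i, G.cover.f i ≫ f = G.cover.f i ≫ g) : f = g :=
  colimit.hom_ext h

end Gluing

/-! ### The formal neighbourhood of infinity and the section σ. -/

namespace SchurPair

open Scheme.AffineZariskiSite

variable {S : Scheme.{u}} {r : ℕ} (p : SchurPair S r)

lemma nonempty_chart (U : S.AffineZariskiSite) : Nonempty (Chart (p.A U)) := by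
  have hfin := p.A_mem.finite_quotient U
  refine RelativeCurve.nonempty_chart ?_
  let F (n : ℕ) : Submodule Γ(S, U.toOpens) (LaurentVec 1 U) := LaurentVec.orderLE 1 n U
  have hF0 : F 0 = LaurentVec.orderLE 1 0 U := rfl
  rw [← hF0] at hfin
  obtain ⟨N, hN⟩ := exists_sup_eq_top_of_finite_quotient F
    (fun m n h x hx i _ ↦ orderLE_mono (by exact_mod_cast h) (hx i trivial))
    (fun x ↦ by
      obtain ⟨n, -, hn⟩ := exists_mem_orderLE (x 0)
      exact ⟨n, fun i _ ↦ by rwa [Subsingleton.elim i 0]⟩)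
    ((Subalgebra.toSubmodule (p.A U)).comap (LinearMap.proj 0 :
      LaurentVec 1 U →ₗ[Γ(S, U.toOpens)] LaurentSeries Γ(S, U.toOpens)))
  refine ⟨N, top_le_iff.mp fun x _ ↦ ?_⟩
  have hx : (fun _ ↦ x : LaurentVec 1 U) ∈ (⊤ : Submodule Γ(S, U.toOpens) (LaurentVec 1 U)) :=
    Submodule.mem_top
  rw [← hN] at hx
  obtain ⟨a, ha, y, hy, hay⟩ := Submodule.mem_sup.mp hx
  exact Submodule.mem_sup.mpr ⟨a 0, ha, y 0, hy 0 trivial, congrFun hay 0⟩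

/-- A choice of two monic elements of `𝒜(U)` of consecutive pole orders. -/
def chart (U : S.AffineZariskiSite) : Chart (p.A U) := (p.nonempty_chart U).some

instance (U : S.AffineZariskiSite) : IsOpenImmersion (p.ιC U) :=
  isOpenImmersion_cover p.projGluing U

instance (U : S.AffineZariskiSite) : IsOpenImmersion (p.ιSpecA U) :=
  isOpenImmersion_cover (relativeGluingData p.coequifibered_ringStructure) U

lemma projFunctor_map_ιC {V U : S.AffineZariskiSite} (i : V ≤ U) :
    Proj.map (p.grdRes i) (p.irrelevant_le_map_grdRes i) ≫ p.ιC U = p.ιC V :=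
  map_cover p.projGluing (homOfLE i)

lemma ιC_π (U : S.AffineZariskiSite) :
    p.ιC U ≫ p.π = projToSpec (grdPiece (p.A U)) ≫ U.2.fromSpec :=
  (cover_toBase p.projGluing U).trans (Category.assoc _ _ _)

lemma preimage_π (U : S.AffineZariskiSite) : p.π ⁻¹ᵁ U.toOpens = (p.ιC U).opensRange := by
  have := p.projGluing.toBase_preimage_eq_opensRange_ι U
  rwa [show ((directedCover S).f U).opensRange = U.toOpens from U.1.opensRange_ι] at this

/-- The infinitesimal neighbourhood `Spec 𝒪_S(U)[[z]] ⟶ C` of the section at infinity. -/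
def τ (U : S.AffineZariskiSite) : Spec (.of (PowerSeries Γ(S, U.toOpens))) ⟶ p.C :=
  projMk (grdPiece (p.A U)) (Grd.toPowerSeries (p.A U)) (p.chart U).s_mem (p.chart U).d_pos
    (p.chart U).isUnit_s ≫ p.ιC U

/-- The charts chosen over U and V are unrelated; `projMk_projMap` allows a different homogeneous
element on each side, so only compatibility of the expansions with restriction matters. -/
lemma specMap_τ {V U : S.AffineZariskiSite} (i : V ≤ U) :
    Spec.map (CommRingCat.ofHom (PowerSeries.map (res i))) ≫ p.τ U = p.τ V := by
  rw [τ, τ, ← p.projFunctor_map_ιC i, ← Category.assoc, ← Category.assoc, specMap_projMk]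
  congr 1
  exact (projMk_projMap (p.grdRes i) _ _ _ _ _
    (fun a ↦ Grd.toPowerSeries_grdMap (res i) (p.A_restrict i) a) _ _ _ _).symm

lemma τ_π (U : S.AffineZariskiSite) :
    p.τ U ≫ p.π = Spec.map (CommRingCat.ofHom PowerSeries.C) ≫ U.2.fromSpec := by
  rw [τ, Category.assoc, ιC_π, ← Category.assoc, projMk_projToSpec]
  congr 3
  exact RingHom.ext Grd.toPowerSeries_algebraMap

lemma specMap_constantCoeff_τ {V U : S.AffineZariskiSite} (i : V ≤ U) :
    Spec.map (CommRingCat.ofHom (res i)) ≫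
      Spec.map (CommRingCat.ofHom PowerSeries.constantCoeff) ≫ p.τ U =
    Spec.map (CommRingCat.ofHom PowerSeries.constantCoeff) ≫ p.τ V := by
  rw [← p.specMap_τ i, ← Spec.map_comp_assoc, ← Spec.map_comp_assoc, ← CommRingCat.ofHom_comp,
    ← CommRingCat.ofHom_comp]
  congr 3

/-- The cocone defining the section at infinity. -/
def sectionCocone : Cocone (toOpensFunctor S ⋙ S.presheaf.rightOp ⋙ Scheme.Spec) where
  pt := p.C
  ι :=
    { app U := Spec.map (CommRingCat.ofHom PowerSeries.constantCoeff) ≫ p.τ U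
      naturality V U i := by
        exact (p.specMap_constantCoeff_τ i.le).trans (Category.comp_id _).symm }

/-- The section at infinity. -/
def σ : S ⟶ p.C := (isColimitCocone S).desc p.sectionCocone

lemma fromSpec_σ (U : S.AffineZariskiSite) :
    U.2.fromSpec ≫ p.σ = Spec.map (CommRingCat.ofHom PowerSeries.constantCoeff) ≫ p.τ U :=
  (isColimitCocone S).fac p.sectionCocone U

lemma σ_π : p.σ ≫ p.π = 𝟙 S := by
  refine (isColimitCocone S).hom_ext fun U ↦ ?_
  change U.2.fromSpec ≫ _ = U.2.fromSpec ≫ _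
  rw [← Category.assoc, fromSpec_σ, Category.assoc, τ_π, ← Category.assoc, ← Spec.map_comp,
    ← CommRingCat.ofHom_comp, Category.comp_id]
  have : (PowerSeries.constantCoeff (R := Γ(S, U.toOpens))).comp PowerSeries.C = RingHom.id _ := by
    ext; simp
  rw [this]
  exact (congrArg (· ≫ _) (Spec.map_id _)).trans (Category.id_comp _)

lemma σ_preimage_preimage (U : S.Opens) : p.σ ⁻¹ᵁ p.π ⁻¹ᵁ U = U := by
  rw [← Scheme.Hom.comp_preimage, σ_π]; rfl

end SchurPair

/-! ### The open immersion of Spec(𝒜) and the affine cover of C by `Vs` and `Vt`. -/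

section LocalOnTarget

variable {X Y : Scheme.{u}}

lemma of_isPullback_openCover (P : MorphismProperty Scheme.{u}) [IsZariskiLocalAtTarget P]
    (f : X ⟶ Y) (𝒰 : Y.OpenCover)
    (H : ∀ i, ∃ (Z : Scheme.{u}) (g : Z ⟶ 𝒰.X i) (h : Z ⟶ X), IsPullback g h (𝒰.f i) f ∧ P g) :
    P f := by
  refine IsZariskiLocalAtTarget.of_openCover 𝒰 fun i ↦ ?_
  obtain ⟨Z, g, h, hp, hg⟩ := H i
  have e : 𝒰.pullbackHom f i = hp.flip.isoPullback.inv ≫ g := hp.flip.isoPullback_inv_snd.symm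
  have hiso : IsIso hp.flip.isoPullback.inv := Iso.isIso_inv _
  rw [e]
  exact (P.cancel_left_of_respectsIso hp.flip.isoPullback.inv g).mpr hg

end LocalOnTarget

namespace SchurPair

open Scheme.AffineZariskiSite

variable {S : Scheme.{u}} {r : ℕ} (p : SchurPair S r)

lemma isPullback_ιC (U : S.AffineZariskiSite) :
    IsPullback (p.projToOpen U) (p.ιC U) ((directedCover S).f U) p.π :=
  p.projGluing.isPullback_natTrans_ι_toBase U

instance isSeparated_π : IsSeparated p.π := by
  refine of_isPullback_openCover @IsSeparated p.π (directedCover S) fun U ↦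
    ⟨_, _, _, p.isPullback_ιC U, ?_⟩
  have : IsSeparated (projToSpec (grdPiece (p.A U))) := by
    rw [projToSpec]; infer_instance
  rw [projToOpen]
  infer_instance

instance isClosedImmersion_σ : IsClosedImmersion p.σ := by
  have : IsClosedImmersion (p.σ ≫ p.π) := by rw [σ_π]; infer_instance
  exact .of_comp p.σ p.π

lemma specAToC_eq (U : S.AffineZariskiSite) (h : IsUnit (Grd.sumHom (p.A U) (Grd.oneOne (p.A U)))) :
    p.specAToC U = projMk (grdPiece (p.A U)) (Grd.sumHom (p.A U)) (Grd.oneOne_mem (p.A U)) one_pos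
      h ≫ p.ιC U :=
  (Category.assoc _ _ _).symm

lemma isUnit_sumHom_oneOne (U : S.AffineZariskiSite) :
    IsUnit (Grd.sumHom (p.A U) (Grd.oneOne (p.A U))) := by
  rw [Grd.sumHom_oneOne]; exact isUnit_one

lemma specMap_specAToC {V U : S.AffineZariskiSite} (i : V ⟶ U) :
    Spec.map (p.ringFunctor.map i.op) ≫ p.specAToC U = p.specAToC V := by
  have e : Spec.map (p.ringFunctor.map i.op) ≫ p.specAToC U =
      (Spec.map (p.ringFunctor.map i.op) ≫ projMk (grdPiece (p.A U)) (Grd.sumHom (p.A U))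
        (Grd.oneOne_mem (p.A U)) one_pos (p.isUnit_sumHom_oneOne U)) ≫ p.ιC U :=
    (Category.assoc _ _ _).symm
  rw [e, p.specAToC_eq V (p.isUnit_sumHom_oneOne V), ← p.projFunctor_map_ιC i.le, ← Category.assoc]
  congr 1
  refine (specMap_projMk _ _ _ _ (p.ringFunctor.map i.op).hom).trans
    (projMk_projMap (p.grdRes i.le) _ _ _ _ _ (fun a ↦ ?_) _ _ _ _).symm
  exact Subtype.ext (Grd.sumHom_grdMap (res i.le) (p.A_restrict i.le) a)

/-- The canonical morphism `Spec(𝒜) ⟶ C`. -/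
def j : p.specA ⟶ p.C :=
  gluedDesc (relativeGluingData p.coequifibered_ringStructure) p.specAToC p.specMap_specAToC

lemma ιSpecA_j (U : S.AffineZariskiSite) : p.ιSpecA U ≫ p.j = p.specAToC U :=
  cover_gluedDesc (relativeGluingData p.coequifibered_ringStructure) _ _ U

lemma ιSpecA_specAToBase (U : S.AffineZariskiSite) : p.ιSpecA U ≫ p.specAToBase =
    Spec.map (CommRingCat.ofHom (algebraMap Γ(S, U.toOpens) (p.A U))) ≫ U.2.fromSpec :=
  (cover_toBase (relativeGluingData p.coequifibered_ringStructure) U).trans (Category.assoc _ _ _)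

lemma projMk_sumHom_projToSpec (U : S.AffineZariskiSite) :
    projMk (grdPiece (p.A U)) (Grd.sumHom (p.A U)) (Grd.oneOne_mem (p.A U)) one_pos
      (p.isUnit_sumHom_oneOne U) ≫ projToSpec (grdPiece (p.A U)) =
      Spec.map (CommRingCat.ofHom (algebraMap Γ(S, U.toOpens) (p.A U))) := by
  rw [projMk_projToSpec]
  congr 2
  exact RingHom.ext fun x ↦ Grd.sumHom_algebraMap x

lemma specAToC_π (U : S.AffineZariskiSite) : p.specAToC U ≫ p.π =
    Spec.map (CommRingCat.ofHom (algebraMap Γ(S, U.toOpens) (p.A U))) ≫ U.2.fromSpec := by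
  rw [p.specAToC_eq U (p.isUnit_sumHom_oneOne U), Category.assoc, ιC_π, ← Category.assoc,
    projMk_sumHom_projToSpec]

lemma j_π : p.j ≫ p.π = p.specAToBase := by
  refine glued_hom_ext (relativeGluingData p.coequifibered_ringStructure) fun U ↦ ?_
  change p.ιSpecA U ≫ _ = p.ιSpecA U ≫ _
  refine Eq.trans ?_ (p.ιSpecA_specAToBase U).symm
  refine (Category.assoc _ _ _).symm.trans ?_
  exact (congrArg (· ≫ p.π) (p.ιSpecA_j U)).trans (p.specAToC_π U)

/-- Over U both Spec(𝒜) and C are given by their charts, so the square is the left half of a pasting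
over S. It identifies the restriction of j to a chart of C with Spec A ⟶ Proj, which reduces the
open immersion property to `awayToA_bijective`. -/
lemma isPullback_j (U : S.AffineZariskiSite) :
    IsPullback (projMk (grdPiece (p.A U)) (Grd.sumHom (p.A U)) (Grd.oneOne_mem (p.A U)) one_pos
      (p.isUnit_sumHom_oneOne U)) (p.ιSpecA U) (p.ιC U) p.j := by
  have h := (relativeGluingData p.coequifibered_ringStructure).isPullback_natTrans_ι_toBase U
  refine IsPullback.of_right (h₁₂ := p.projToOpen U) (h₂₂ := p.π) (v₁₃ := (directedCover S).f U)
    ?_ ?_ (p.isPullback_ιC U)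
  · rw [j_π, projToOpen, ← Category.assoc, projMk_sumHom_projToSpec]
    exact h
  · rw [ιSpecA_j, p.specAToC_eq U (p.isUnit_sumHom_oneOne U)]

instance isOpenImmersion_j : IsOpenImmersion p.j := by
  refine of_isPullback_openCover @IsOpenImmersion p.j p.projGluing.cover fun U ↦
    ⟨_, _, _, p.isPullback_j U, ?_⟩
  have : IsIso (CommRingCat.ofHom (awayToA (p.A U))) :=
    (ConcreteCategory.isIso_iff_bijective _).mpr awayToA_bijective
  change IsOpenImmersion (Spec.map (CommRingCat.ofHom (awayToA (p.A U))) ≫ Proj.awayι _ _ _ _)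
  infer_instance

/-- The affine open neighbourhood `D₊(s)` of the section at infinity in `π⁻¹(U)`. -/
def Vs (U : S.AffineZariskiSite) : p.C.Opens :=
  p.ιC U ''ᵁ Proj.basicOpen (grdPiece (p.A U)) (p.chart U).s

/-- The affine open subset `D₊(1)` of `π⁻¹(U)`. -/
def Vt (U : S.AffineZariskiSite) : p.C.Opens :=
  p.ιC U ''ᵁ Proj.basicOpen (grdPiece (p.A U)) (Grd.oneOne (p.A U))

lemma Vs_sup_Vt (U : S.AffineZariskiSite) : p.Vs U ⊔ p.Vt U = p.π ⁻¹ᵁ U.toOpens := by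
  rw [preimage_π, ← Scheme.Hom.image_top_eq_opensRange, ← (p.chart U).basicOpen_sup_basicOpen]
  exact TopologicalSpace.Opens.ext (Set.image_union _ _ _).symm

lemma isAffineOpen_Vs (U : S.AffineZariskiSite) : IsAffineOpen (p.Vs U) :=
  (Proj.isAffineOpen_basicOpen _ _ (p.chart U).s_mem (p.chart U).d_pos).image_of_isOpenImmersion _

lemma isAffineOpen_Vt (U : S.AffineZariskiSite) : IsAffineOpen (p.Vt U) :=
  (Proj.isAffineOpen_basicOpen _ _ (Grd.oneOne_mem _) one_pos).image_of_isOpenImmersion _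

instance quasiCompact_π : QuasiCompact p.π :=
  quasiCompact_iff_forall_isAffineOpen.mpr fun U hU ↦ by
    have h := p.Vs_sup_Vt ⟨U, hU⟩
    rw [← show p.Vs ⟨U, hU⟩ ⊔ p.Vt ⟨U, hU⟩ = p.π ⁻¹ᵁ U from h]
    exact (p.isAffineOpen_Vs _).isCompact.union (p.isAffineOpen_Vt _).isCompact

lemma Vs_le (U : S.AffineZariskiSite) : p.Vs U ≤ p.π ⁻¹ᵁ U.toOpens :=
  le_sup_left.trans (p.Vs_sup_Vt U).le

lemma Vt_le (U : S.AffineZariskiSite) : p.Vt U ≤ p.π ⁻¹ᵁ U.toOpens :=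
  le_sup_right.trans (p.Vs_sup_Vt U).le

/-- The chart `D₊(s)` as an open immersion. -/
def ιs (U : S.AffineZariskiSite) : Spec (.of (p.chart U).B) ⟶ p.C :=
  Proj.awayι (grdPiece (p.A U)) (p.chart U).s (p.chart U).s_mem (p.chart U).d_pos ≫ p.ιC U

instance (U : S.AffineZariskiSite) : IsOpenImmersion (p.ιs U) := by unfold ιs; infer_instance

lemma opensRange_ιs (U : S.AffineZariskiSite) : (p.ιs U).opensRange = p.Vs U := by
  exact (Scheme.Hom.opensRange_comp _ _).trans
    (congrArg (p.ιC U ''ᵁ ·) (Proj.opensRange_awayι _ _ _ _))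

instance (U : S.AffineZariskiSite) : IsOpenImmersion (p.specAToC U) := by
  rw [← ιSpecA_j]; infer_instance

lemma opensRange_specAToC (U : S.AffineZariskiSite) : (p.specAToC U).opensRange = p.Vt U := by
  have : IsIso (CommRingCat.ofHom (awayToA (p.A U))) :=
    (ConcreteCategory.isIso_iff_bijective _).mpr awayToA_bijective
  have h : p.specAToC U = Spec.map (CommRingCat.ofHom (awayToA (p.A U))) ≫
    (Proj.awayι (grdPiece (p.A U)) (Grd.oneOne (p.A U)) (Grd.oneOne_mem (p.A U)) one_pos ≫
      p.ιC U) := rfl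
  simp only [h]
  rw [Scheme.Hom.opensRange_comp_of_isIso, Scheme.Hom.opensRange_comp, Proj.opensRange_awayι]
  rfl

lemma τ_eq (U : S.AffineZariskiSite) :
    p.τ U = Spec.map (CommRingCat.ofHom (p.chart U).expand) ≫ p.ιs U :=
  Category.assoc _ _ _

lemma τ_preimage_Vs (U : S.AffineZariskiSite) : p.τ U ⁻¹ᵁ p.Vs U = ⊤ := by
  rw [← opensRange_ιs, τ_eq, Scheme.Hom.comp_preimage, Scheme.Hom.preimage_opensRange]
  rfl

lemma τ_preimage_Vt (U : S.AffineZariskiSite) : p.τ U ⁻¹ᵁ p.Vt U =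
    PrimeSpectrum.basicOpen (Grd.toPowerSeries (p.A U) (Grd.oneOne (p.A U))) := by
  rw [τ, Vt, Scheme.Hom.comp_preimage, Scheme.Hom.preimage_image_eq,
    projMk_preimage_basicOpen _ _ _ _ (Grd.oneOne_mem _) one_pos]

lemma σ_preimage_Vs (U : S.AffineZariskiSite) : p.σ ⁻¹ᵁ p.Vs U = U.toOpens := by
  apply le_antisymm
  · exact (p.σ.preimage_mono (p.Vs_le U)).trans (p.σ_preimage_preimage _).le
  · intro x hx
    rw [← SetLike.mem_coe, ← U.2.range_fromSpec] at hx
    obtain ⟨y, rfl⟩ := hx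
    have h : (U.2.fromSpec ≫ p.σ) ⁻¹ᵁ p.Vs U = ⊤ := by
      rw [fromSpec_σ, Scheme.Hom.comp_preimage, τ_preimage_Vs]; rfl
    exact h.ge (Set.mem_univ y)

/-- The element 1 of degree 1 expands to z, which vanishes along z = 0. -/
lemma σ_preimage_Vt (U : S.AffineZariskiSite) : p.σ ⁻¹ᵁ p.Vt U = ⊥ := by
  refine le_bot_iff.mp fun x hx ↦ ?_
  have hx' : x ∈ U.toOpens := (p.σ_preimage_preimage _).le (p.σ.preimage_mono (p.Vt_le U) hx)
  rw [← SetLike.mem_coe, ← U.2.range_fromSpec] at hx'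
  obtain ⟨y, rfl⟩ := hx'
  have h : (U.2.fromSpec ≫ p.σ) ⁻¹ᵁ p.Vt U = ⊥ := by
    rw [fromSpec_σ, Scheme.Hom.comp_preimage, τ_preimage_Vt]
    refine le_bot_iff.mp fun z hz ↦ hz ?_
    change PowerSeries.constantCoeff (Grd.toPowerSeries (p.A U) (Grd.oneOne (p.A U))) ∈ z.asIdeal
    rw [Grd.oneOne, Grd.constantCoeff_toPowerSeries_monomial, HahnSeries.coeff_one,
      if_neg (by simp)]
    exact zero_mem _
  exact h.le hx

end SchurPair

/-! ### The complement of P and the expansion of functions near P. -/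

lemma section_ext {X : Scheme.{u}} {V : X.Opens} {x y : Γ(X, V)}
    (h : ∀ z ∈ V, ∃ (V' : X.Opens) (i : V' ≤ V), z ∈ V' ∧ opensRes i x = opensRes i y) : x = y := by
  refine TopCat.Presheaf.section_ext X.sheaf V x y fun z hz ↦ ?_
  obtain ⟨V', i, hz', e⟩ := h z hz
  have h1 := congrArg (X.presheaf.germ V' z hz').hom e
  have key (w : Γ(X, V)) : (X.presheaf.germ V' z hz').hom (opensRes i w) =
      (X.presheaf.germ V z hz).hom w :=
    X.presheaf.germ_res_apply (homOfLE i) z hz' w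
  rw [key, key] at h1
  exact h1

/-- The variable lies in every maximal ideal of R[[z]], since 1 - vz is always a unit. So each point
specializes to a closed point of the locus z = 0, which is a copy of Spec R. -/
lemma exists_mem_closure_range_constantCoeff {R : Type u} [CommRing R]
    (y : PrimeSpectrum (PowerSeries R)) :
    ∃ z : PrimeSpectrum R, y ⤳ z.comap PowerSeries.constantCoeff := by
  obtain ⟨m, hm, hle⟩ := Ideal.exists_le_maximal y.asIdeal y.2.ne_top
  have hX : PowerSeries.X ∈ m := by
    by_contra hX
    obtain ⟨v, w, hw, e⟩ := hm.exists_inv hX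
    refine hm.ne_top (Ideal.eq_top_of_isUnit_mem _ hw ?_)
    rw [PowerSeries.isUnit_iff_constantCoeff]
    have h := congrArg PowerSeries.constantCoeff e
    rw [map_add, map_mul, PowerSeries.constantCoeff_X, mul_zero, zero_add, map_one] at h
    rw [h]
    exact isUnit_one
  have hr : (⟨m, hm.isPrime⟩ : PrimeSpectrum (PowerSeries R)) ∈
      Set.range (PrimeSpectrum.comap (PowerSeries.constantCoeff (R := R))) := by
    rw [range_comap_of_surjective _ _ PowerSeries.constantCoeff_surj]
    intro w hw
    obtain ⟨v, rfl⟩ := PowerSeries.X_dvd_iff.mpr hw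
    exact Ideal.mul_mem_right _ _ hX
  obtain ⟨z, hz⟩ := hr
  refine ⟨z, ?_⟩
  rw [hz]
  exact (PrimeSpectrum.le_iff_specializes _ _).mp hle

namespace Chart

variable {R : Type u} [CommRing R] {A : Subalgebra R (LaurentSeries R)} (c : Chart A)

lemma exists_expand_eq (x : R) : ∃ y, c.expand y = PowerSeries.C x := by
  have hx : algebraMap R (LaurentSeries R) x ∈ grdComp A (0 • c.d) := by
    rw [zero_smul]; exact Submodule.mem_one.mpr ⟨x, rfl⟩
  refine ⟨c.frac 0 _ hx, HahnSeries.ofPowerSeries_injective (Γ := ℤ) ?_⟩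
  have h := c.expand_frac_mul 0 _ hx
  rw [pow_zero, mul_one] at h
  rw [h, HahnSeries.ofPowerSeries_C, HahnSeries.algebraMap_apply]
  rfl

lemma constantCoeff_expand_surjective :
    Function.Surjective (PowerSeries.constantCoeff.comp c.expand) := fun x ↦ by
  obtain ⟨y, hy⟩ := c.exists_expand_eq x
  exact ⟨y, by rw [RingHom.comp_apply, hy]; simp⟩

lemma f_mem_of_κ_mem {P : Ideal c.B} [P.IsPrime] (h : c.κ ∈ P) : c.f ∈ P := by
  obtain ⟨g, hg, e⟩ := c.exists_κ_eq
  rw [e] at h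
  refine (‹P.IsPrime›.mem_or_mem h).elim (fun h ↦ ‹P.IsPrime›.mem_of_pow_mem _ h) fun h ↦ ?_
  exact absurd (Ideal.eq_top_of_isUnit_mem _ h hg) ‹P.IsPrime›.ne_top

/-- A prime containing κ contains f, hence the kernel of the surjection from `c.B` to R given by the
constant coefficient. Thus the points of D₊(s) outside D₊(1) lie on P. -/
lemma exists_comap_constantCoeff_eq (y : PrimeSpectrum c.B) (h : c.κ ∈ y.asIdeal) :
    ∃ z : PrimeSpectrum R, z.comap (PowerSeries.constantCoeff.comp c.expand) = y := by
  have h1 : y ∈ Set.range (PrimeSpectrum.comap (PowerSeries.constantCoeff.comp c.expand)) := by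
    rw [range_comap_of_surjective _ _ c.constantCoeff_expand_surjective]
    intro w hw
    obtain ⟨v, rfl⟩ := c.f_dvd_of_constantCoeff hw
    exact Ideal.mul_mem_right _ _ (c.f_mem_of_κ_mem h)
  exact h1

end Chart

namespace SchurPair

open Scheme.AffineZariskiSite

variable {S : Scheme.{u}} {r : ℕ} (p : SchurPair S r)

lemma ιs_preimage_Vt (U : S.AffineZariskiSite) :
    p.ιs U ⁻¹ᵁ p.Vt U = PrimeSpectrum.basicOpen (p.chart U).κ := by
  rw [← (p.chart U).κ_eq_isLocalizationElem,
    ← Proj.awayι_preimage_basicOpen (grdPiece (p.A U)) (p.chart U).s_mem (p.chart U).d_pos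
      (Grd.oneOne_mem (p.A U)) one_pos]
  refine (Scheme.Hom.comp_preimage _ (p.ιC U) _).trans ?_
  rw [Vt, Scheme.Hom.preimage_image_eq]

lemma σ_notMem_Vt (U : S.AffineZariskiSite) (z : S) : p.σ z ∉ p.Vt U := fun h ↦
  (p.σ_preimage_Vt U).le (show z ∈ p.σ ⁻¹ᵁ p.Vt U from h)

lemma mem_Vt_of_notMem_range (U : S.AffineZariskiSite) {x : p.C} (hx : x ∈ p.π ⁻¹ᵁ U.toOpens)
    (hσ : x ∉ Set.range p.σ) : x ∈ p.Vt U := by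
  rw [← p.Vs_sup_Vt U] at hx
  refine hx.elim (fun hs ↦ ?_) id
  rw [SetLike.mem_coe, ← opensRange_ιs] at hs
  obtain ⟨y, rfl⟩ := hs
  have key : y ∈ p.ιs U ⁻¹ᵁ p.Vt U := by
    rw [ιs_preimage_Vt]
    intro hy
    obtain ⟨z, rfl⟩ := (p.chart U).exists_comap_constantCoeff_eq y hy
    refine hσ ⟨U.2.fromSpec z, ?_⟩
    have h := p.fromSpec_σ U
    rw [τ_eq] at h
    exact congrArg (fun q ↦ q.base z) h
  exact key

lemma j_ιSpecA_mem_Vt (U : S.AffineZariskiSite) (y : Spec (.of (p.A U))) :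
    p.j (p.ιSpecA U y) ∈ p.Vt U := by
  rw [← opensRange_specAToC]
  exact ⟨y, congrArg (fun q ↦ q.base y) (p.ιSpecA_j U).symm⟩

lemma mem_range_j_of_mem_Vt (U : S.AffineZariskiSite) {x : p.C} (hx : x ∈ p.Vt U) :
    x ∈ Set.range p.j := by
  rw [← opensRange_specAToC] at hx
  obtain ⟨y, rfl⟩ := hx
  exact ⟨p.ιSpecA U y, congrArg (fun q ↦ q.base y) (p.ιSpecA_j U)⟩

lemma exists_mem_affine {X : Scheme.{u}} (x : X) : ∃ U : X.AffineZariskiSite, x ∈ U.toOpens := by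
  obtain ⟨U, hU, hxU, -⟩ := exists_isAffineOpen_mem_and_subset (U := ⊤) (x := x) trivial
  exact ⟨⟨U, hU⟩, hxU⟩

lemma range_j : Set.range p.j = (Set.range p.σ)ᶜ := by
  ext x
  constructor
  · rintro ⟨y, rfl⟩ ⟨z, hz⟩
    obtain ⟨U, y, rfl⟩ := (relativeGluingData p.coequifibered_ringStructure).cover.exists_eq y
    exact p.σ_notMem_Vt U z (hz ▸ p.j_ιSpecA_mem_Vt U y)
  · intro hx
    obtain ⟨U, hU⟩ := exists_mem_affine (p.π x)
    exact p.mem_range_j_of_mem_Vt U (p.mem_Vt_of_notMem_range U hU hx)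

/-- Open sets are stable under generization, and every point of Spec R[[z]] specializes to the locus
z = 0, which is mapped into V. Hence functions on any neighbourhood of σ(W) have expansions, not
only those on the chosen chart. -/
lemma τ_preimage (W : S.AffineZariskiSite) {V : p.C.Opens} (i : W.toOpens ≤ p.σ ⁻¹ᵁ V) :
    p.τ W ⁻¹ᵁ V = ⊤ := by
  refine top_le_iff.mp fun y _ ↦ ?_
  obtain ⟨z, hz⟩ := exists_mem_closure_range_constantCoeff y
  refine (hz.map (p.τ W).continuous).mem_open V.2 ?_
  have h : (W.2.fromSpec ≫ p.σ) ⁻¹ᵁ V = ⊤ := by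
    rw [Scheme.Hom.comp_preimage]
    exact preimage_fromSpec_of_le W.2 i
  rw [fromSpec_σ] at h
  exact h.ge (Set.mem_univ z)

/-- The expansion of a function on a neighbourhood `V` of `σ(W)` as a power series. -/
def Θ (W : S.AffineZariskiSite) {V : p.C.Opens} (i : W.toOpens ≤ p.σ ⁻¹ᵁ V) :
    Γ(p.C, V) →+* PowerSeries Γ(S, W.toOpens) :=
  evalOn (p.τ W) V (p.τ_preimage W i)

lemma Θ_opensRes (W : S.AffineZariskiSite) {V V' : p.C.Opens} (i : W.toOpens ≤ p.σ ⁻¹ᵁ V')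
    (h : V' ≤ V) (x : Γ(p.C, V)) :
    p.Θ W i (opensRes h x) = p.Θ W (i.trans (p.σ.preimage_mono h)) x :=
  evalOn_opensRes _ _ _ _ _

lemma map_Θ_of_le {W W' : S.AffineZariskiSite} (h : W' ≤ W) {V : p.C.Opens}
    (i : W.toOpens ≤ p.σ ⁻¹ᵁ V) (x : Γ(p.C, V)) :
    PowerSeries.map (res h) (p.Θ W i x) = p.Θ W' ((toOpens_mono h).trans i) x := by
  rw [Θ, ← evalOn_specMap_comp (PowerSeries.map (res h)) (p.τ W) V _
    (preimage_specMap_comp _ (p.τ_preimage W i))]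
  exact evalOn_congr (p.specMap_τ h) _ _ _

/-- The order on `S.AffineZariskiSite` only sees principal opens, so `map_Θ_of_le` does not apply to
an arbitrary inclusion. Coefficients are compared on opens that are principal in both W and W'. -/
lemma map_Θ {W W' : S.AffineZariskiSite} (h : W'.toOpens ≤ W.toOpens) {V : p.C.Opens}
    (i : W.toOpens ≤ p.σ ⁻¹ᵁ V) (x : Γ(p.C, V)) :
    PowerSeries.map (opensRes h) (p.Θ W i x) = p.Θ W' (h.trans i) x := by
  ext n
  refine section_ext fun z hz ↦ ?_
  obtain ⟨f, g, e, hf⟩ := exists_basicOpen_le_affine_inter W.2 W'.2 z ⟨h hz, hz⟩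
  have e1 : W.basicOpen f = W'.basicOpen g := Subtype.ext e
  have hle : W'.basicOpen g ≤ W := e1 ▸ W.basicOpen_le f
  refine ⟨(W'.basicOpen g).toOpens, toOpens_mono (W'.basicOpen_le g), e.le hf, ?_⟩
  have h1 := congrArg (PowerSeries.coeff n) (p.map_Θ_of_le hle i x)
  have h2 := congrArg (PowerSeries.coeff n) (p.map_Θ_of_le (W'.basicOpen_le g) (h.trans i) x)
  rw [PowerSeries.coeff_map] at h1 h2 ⊢
  rw [opensRes_opensRes]
  exact h1.trans h2.symm

lemma constantCoeff_Θ (W : S.AffineZariskiSite) {V : p.C.Opens} (i : W.toOpens ≤ p.σ ⁻¹ᵁ V)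
    (x : Γ(p.C, V)) : PowerSeries.constantCoeff (p.Θ W i x) = opensRes i (p.σ.app V x) := by
  have h : (W.2.fromSpec ≫ p.σ) ⁻¹ᵁ V = ⊤ := by
    rw [Scheme.Hom.comp_preimage]
    exact preimage_fromSpec_of_le W.2 i
  have h1 := evalOn_comp (T := Γ(S, W.toOpens)) W.2.fromSpec p.σ V h x
  have h2 := h1.trans (evalOn_fromSpec W.2 i (preimage_fromSpec_of_le W.2 i) _)
  rw [← h2, Θ, ← evalOn_specMap_comp PowerSeries.constantCoeff (p.τ W) V _
    (preimage_specMap_comp _ (p.τ_preimage W i))]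
  exact evalOn_congr (p.fromSpec_σ W).symm _ _ _

lemma Θ_π (W : S.AffineZariskiSite) {V : p.C.Opens} (i : W.toOpens ≤ p.σ ⁻¹ᵁ V) {U : S.Opens}
    (h : V ≤ p.π ⁻¹ᵁ U) (hW : W.toOpens ≤ U) (c : Γ(S, U)) :
    p.Θ W i (p.π.appLE U V h c) = PowerSeries.C (opensRes hW c) := by
  have h0 : p.π.appLE U V h c = opensRes h (p.π.app U c) := rfl
  have hU := preimage_fromSpec_of_le W.2 hW
  rw [h0, Θ_opensRes, Θ, ← evalOn_fromSpec W.2 hW hU, ← evalOn_specMap_comp PowerSeries.C _ U hU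
    (preimage_specMap_comp _ hU), ← evalOn_comp _ _ _ (by
      rw [τ_π]; exact preimage_specMap_comp _ hU)]
  exact evalOn_congr (p.τ_π W) _ _ _

lemma Θ_eq_expand (U : S.AffineZariskiSite) (x : Γ(p.C, p.Vs U)) :
    p.Θ U (p.σ_preimage_Vs U).ge x = (p.chart U).expand
      (evalOn (p.ιs U) (p.Vs U) (by rw [← opensRange_ιs]; exact Scheme.Hom.preimage_opensRange _)
        x) := by
  rw [← evalOn_specMap_comp (p.chart U).expand _ _ _ (by rw [← τ_eq]; exact p.τ_preimage_Vs U)]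
  exact evalOn_congr (p.τ_eq U) _ _ _

end SchurPair

/-! ### Completion and conormal module of a ring with an expansion. -/

section Expansion

variable {B R : Type*} [CommRing B] [CommRing R]

lemma PowerSeries.eq_of_X_pow_dvd_sub {x y : PowerSeries R}
    (h : ∀ n : ℕ, PowerSeries.X ^ n ∣ x - y) : x = y := by
  refine sub_eq_zero.mp (PowerSeries.ext fun n ↦ ?_)
  exact PowerSeries.X_pow_dvd_iff.mp (h (n + 1)) n (Nat.lt_succ_self n)

lemma exists_evalₐ_eq (I : Ideal B) (x : AdicCompletion I B) :
    ∃ c : ℕ → B, (∀ n, AdicCompletion.evalₐ I n x = Ideal.Quotient.mk _ (c n)) ∧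
      ∀ {m n}, m ≤ n → c n - c m ∈ I ^ m := by
  obtain ⟨c, rfl⟩ := AdicCompletion.mk_surjective I B x
  refine ⟨c.1, fun n ↦ AdicCompletion.evalₐ_mk I n c, fun {m n} hmn ↦ ?_⟩
  have h := SModEq.sub_mem.mp (c.2 hmn).symm
  rwa [smul_eq_mul, Ideal.mul_top] at h

/-- `Φ : B → R[[z]]` expands the functions on an affine scheme along the closed subscheme with ideal
`I` and coordinate ring `R`, in such a way that the completion of `B` along `I` is `R[[z]]`. -/
structure IsExpansion (Φ : B →+* PowerSeries R) (I : Ideal B) : Prop where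
  mem_iff (b : B) : b ∈ I ↔ PowerSeries.constantCoeff (Φ b) = 0
  surjective : Function.Surjective (PowerSeries.constantCoeff.comp Φ)
  mem_pow (n : ℕ) (b : B) : PowerSeries.X ^ n ∣ Φ b → b ∈ I ^ n
  exists_coeff_one : ∃ e ∈ I, PowerSeries.coeff 1 (Φ e) = 1

namespace IsExpansion

variable {Φ : B →+* PowerSeries R} {I : Ideal B} (h : IsExpansion Φ I)

include h

lemma X_dvd {b : B} (hb : b ∈ I) : PowerSeries.X ∣ Φ b :=
  PowerSeries.X_dvd_iff.mpr ((h.mem_iff b).mp hb)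

lemma X_pow_dvd {n : ℕ} {b : B} (hb : b ∈ I ^ n) : PowerSeries.X ^ n ∣ Φ b := by
  have h1 : I.map Φ ≤ Ideal.span {PowerSeries.X} :=
    Ideal.map_le_iff_le_comap.mpr fun b hb ↦ Ideal.mem_span_singleton.mpr (h.X_dvd hb)
  have h2 := Ideal.pow_right_mono h1 n (Ideal.map_pow Φ I n ▸ Ideal.mem_map_of_mem Φ hb)
  rwa [Ideal.span_singleton_pow, Ideal.mem_span_singleton] at h2

/-- Successive approximation: with Φ e = z·v and v(0) = 1, the next coefficient is corrected by
c·eⁿ, where c lifts it to `B`. -/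
lemma exists_X_pow_dvd_sub (q : PowerSeries R) (n : ℕ) : ∃ b, PowerSeries.X ^ n ∣ q - Φ b := by
  induction n with
  | zero => exact ⟨0, by simp⟩
  | succ n ih =>
    obtain ⟨b, g, hg⟩ := ih
    obtain ⟨c, hc⟩ := h.surjective (PowerSeries.constantCoeff g)
    obtain ⟨e, he, he1⟩ := h.exists_coeff_one
    obtain ⟨v, hv⟩ := h.X_dvd he
    have hv1 : PowerSeries.constantCoeff v = 1 := by
      rw [← he1, hv, ← zero_add 1, PowerSeries.coeff_succ_X_mul,
        PowerSeries.coeff_zero_eq_constantCoeff_apply]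
    refine ⟨b + c * e ^ n, ?_⟩
    rw [map_add, ← sub_sub, hg, map_mul, map_pow, hv, mul_pow,
      show PowerSeries.X ^ n * g - Φ c * (PowerSeries.X ^ n * v ^ n) =
        PowerSeries.X ^ n * (g - Φ c * v ^ n) by ring, pow_succ]
    refine mul_dvd_mul_left _ (PowerSeries.X_dvd_iff.mpr ?_)
    rw [map_sub, map_mul, map_pow, hv1, one_pow, mul_one, sub_eq_zero]
    exact hc.symm

lemma exists_series (x : AdicCompletion I B) : ∃ q : PowerSeries R, ∀ (n : ℕ) (b : B),
    AdicCompletion.evalₐ I n x = Ideal.Quotient.mk _ b → PowerSeries.X ^ n ∣ q - Φ b := by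
  obtain ⟨c, hc, hcc⟩ := exists_evalₐ_eq I x
  -- The coefficient of index n is well defined only modulo I^{n+1}, whence the shift.
  refine ⟨PowerSeries.mk fun n ↦ PowerSeries.coeff n (Φ (c (n + 1))), fun n b hb ↦ ?_⟩
  rw [hc, Ideal.Quotient.eq] at hb
  have h1 := h.X_pow_dvd hb
  rw [PowerSeries.X_pow_dvd_iff] at h1 ⊢
  intro m hm
  have h2 := PowerSeries.X_pow_dvd_iff.mp (h.X_pow_dvd (hcc (Nat.succ_le_of_lt hm))) m
    (Nat.lt_succ_self m)
  have h3 := h1 m hm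
  rw [map_sub, map_sub, sub_eq_zero] at h2 h3
  rw [map_sub, PowerSeries.coeff_mk, sub_eq_zero, ← h3, ← h2]

lemma exists_ringEquiv : ∃ iso : AdicCompletion I B ≃+* PowerSeries R,
    ∀ (x : AdicCompletion I B) (n : ℕ) (b : B),
      AdicCompletion.evalₐ I n x = Ideal.Quotient.mk _ b → PowerSeries.X ^ n ∣ iso x - Φ b := by
  choose F hF using h.exists_series
  -- A series is determined by its approximations, so each ring homomorphism axiom is checked on
  -- representatives modulo Iⁿ.
  have huniq (x : AdicCompletion I B) (q : PowerSeries R)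
      (hq : ∀ n, ∃ b, AdicCompletion.evalₐ I n x = Ideal.Quotient.mk _ b ∧
        PowerSeries.X ^ n ∣ q - Φ b) : F x = q := by
    refine PowerSeries.eq_of_X_pow_dvd_sub fun n ↦ ?_
    obtain ⟨b, hb, hd⟩ := hq n
    simpa using dvd_sub (hF x n b hb) hd
  let f : AdicCompletion I B →+* PowerSeries R :=
    { toFun := F
      map_one' := huniq _ _ fun n ↦ ⟨1, by rw [map_one, map_one], by simp⟩
      map_zero' := huniq _ _ fun n ↦ ⟨0, by rw [map_zero, map_zero], by simp⟩
      map_add' := fun x y ↦ huniq _ _ fun n ↦ by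
        obtain ⟨b, hb⟩ := Ideal.Quotient.mk_surjective (AdicCompletion.evalₐ I n x)
        obtain ⟨c, hc⟩ := Ideal.Quotient.mk_surjective (AdicCompletion.evalₐ I n y)
        refine ⟨b + c, by rw [map_add, map_add, hb, hc], ?_⟩
        rw [map_add, add_sub_add_comm]
        exact dvd_add (hF x n b hb.symm) (hF y n c hc.symm)
      map_mul' := fun x y ↦ huniq _ _ fun n ↦ by
        obtain ⟨b, hb⟩ := Ideal.Quotient.mk_surjective (AdicCompletion.evalₐ I n x)
        obtain ⟨c, hc⟩ := Ideal.Quotient.mk_surjective (AdicCompletion.evalₐ I n y)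
        refine ⟨b * c, by rw [map_mul, map_mul, hb, hc], ?_⟩
        rw [map_mul, show F x * F y - Φ b * Φ c = (F x - Φ b) * F y + Φ b * (F y - Φ c) by ring]
        exact dvd_add (Dvd.dvd.mul_right (hF x n b hb.symm) _)
          (Dvd.dvd.mul_left (hF y n c hc.symm) _) }
  refine ⟨RingEquiv.ofBijective f ⟨?_, fun q ↦ ?_⟩, hF⟩
  · rw [injective_iff_map_eq_zero]
    intro x hx
    refine AdicCompletion.ext_evalₐ fun n ↦ ?_
    obtain ⟨b, hb⟩ := Ideal.Quotient.mk_surjective (AdicCompletion.evalₐ I n x)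
    have h1 := hF x n b hb.symm
    rw [show F x = 0 from hx, zero_sub, dvd_neg] at h1
    rw [map_zero, ← hb, Ideal.Quotient.eq_zero_iff_mem]
    exact h.mem_pow n b h1
  · choose b hb using h.exists_X_pow_dvd_sub q
    refine ⟨AdicCompletion.mk I B ⟨b, fun {m n} hmn ↦ ?_⟩, huniq _ _ fun n ↦
      ⟨b n, AdicCompletion.evalₐ_mk I n _, hb n⟩⟩
    rw [SModEq.sub_mem, smul_eq_mul, Ideal.mul_top]
    refine h.mem_pow m _ ?_
    have h1 := dvd_sub ((pow_dvd_pow PowerSeries.X hmn).trans (hb n)) (hb m)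
    rwa [sub_sub_sub_cancel_left, ← map_sub] at h1

/-- The isomorphism between the completion and the ring of power series. -/
def ringEquiv : AdicCompletion I B ≃+* PowerSeries R := h.exists_ringEquiv.choose

lemma X_pow_dvd_ringEquiv_sub {x : AdicCompletion I B} {n : ℕ} {b : B}
    (hb : AdicCompletion.evalₐ I n x = Ideal.Quotient.mk _ b) :
    PowerSeries.X ^ n ∣ h.ringEquiv x - Φ b :=
  h.exists_ringEquiv.choose_spec x n b hb

lemma evalₐ_eq_zero_iff (n : ℕ) (x : AdicCompletion I B) :
    AdicCompletion.evalₐ I n x = 0 ↔ PowerSeries.X ^ n ∣ h.ringEquiv x := by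
  obtain ⟨b, hb⟩ := Ideal.Quotient.mk_surjective (AdicCompletion.evalₐ I n x)
  have h1 := h.X_pow_dvd_ringEquiv_sub hb.symm
  rw [← hb, Ideal.Quotient.eq_zero_iff_mem, dvd_iff_dvd_of_dvd_sub h1]
  exact ⟨h.X_pow_dvd, h.mem_pow n b⟩

lemma ringEquiv_algebraMap (b : B) : h.ringEquiv (algebraMap B _ b) = Φ b :=
  PowerSeries.eq_of_X_pow_dvd_sub fun n ↦
    h.X_pow_dvd_ringEquiv_sub ((AdicCompletion.evalₐ I n).commutes b)

/-- On I the coefficient of z has kernel I², and the class of an element e with that coefficient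
equal to 1 is a basis of I/I² over B/I. The characterization by coefficients does not mention e, so
the isomorphisms over different opens agree. -/
lemma exists_cotangentEquiv : ∃ φ : (B ⧸ I) ≃ₗ[B] I.Cotangent, ∀ (g : B) (y : I),
    φ (Ideal.Quotient.mk _ g) = I.toCotangent y ↔
      PowerSeries.coeff 1 (Φ y) = PowerSeries.constantCoeff (Φ g) := by
  obtain ⟨e, he, he1⟩ := h.exists_coeff_one
  have hcoeff {b : B} (hb : b ∈ I) : b ∈ I ^ 2 ↔ PowerSeries.coeff 1 (Φ b) = 0 := by
    refine ⟨fun h2 ↦ PowerSeries.X_pow_dvd_iff.mp (h.X_pow_dvd h2) 1 one_lt_two, fun h2 ↦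
      h.mem_pow 2 b (PowerSeries.X_pow_dvd_iff.mpr fun m hm ↦ ?_)⟩
    interval_cases m
    · rw [PowerSeries.coeff_zero_eq_constantCoeff_apply]
      exact (h.mem_iff b).mp hb
    · exact h2
  have hmul (g : B) : PowerSeries.coeff 1 (Φ (g * e)) = PowerSeries.constantCoeff (Φ g) := by
    obtain ⟨v, hv⟩ := h.X_dvd he
    have hv1 : PowerSeries.constantCoeff v = 1 := by
      rw [← he1, hv, ← zero_add 1, PowerSeries.coeff_succ_X_mul,
        PowerSeries.coeff_zero_eq_constantCoeff_apply]
    rw [map_mul, hv, mul_left_comm, ← zero_add 1, PowerSeries.coeff_succ_X_mul,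
      PowerSeries.coeff_zero_eq_constantCoeff_apply, map_mul, hv1, mul_one]
  let ψ : B →ₗ[B] I.Cotangent := LinearMap.toSpanSingleton B _ (I.toCotangent ⟨e, he⟩)
  have hψ (g : B) (y : I) : ψ g = I.toCotangent y ↔
      PowerSeries.coeff 1 (Φ y) = PowerSeries.constantCoeff (Φ g) := by
    rw [LinearMap.toSpanSingleton_apply, ← map_smul, Ideal.toCotangent_eq]
    change g * e - y ∈ I ^ 2 ↔ _
    rw [hcoeff (sub_mem (I.mul_mem_left _ he) y.2), map_sub, map_sub, hmul, sub_eq_zero, eq_comm]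
  have hker (g : B) : ψ g = 0 ↔ g ∈ I := by
    rw [← map_zero I.toCotangent, hψ, h.mem_iff, ZeroMemClass.coe_zero, map_zero, map_zero, eq_comm]
  refine ⟨LinearEquiv.ofBijective (Submodule.liftQ I ψ fun g hg ↦ (hker g).mpr hg) ⟨?_, fun y ↦ ?_⟩,
    hψ⟩
  · rw [injective_iff_map_eq_zero]
    intro g hg
    obtain ⟨g, rfl⟩ := Submodule.mkQ_surjective I g
    exact (Submodule.Quotient.mk_eq_zero I).mpr ((hker g).mp hg)
  · obtain ⟨y, rfl⟩ := I.toCotangent_surjective y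
    obtain ⟨g, hg⟩ := h.surjective (PowerSeries.coeff 1 (Φ y))
    exact ⟨Submodule.Quotient.mk g, (hψ g y).mpr hg.symm⟩

end IsExpansion

end Expansion

/-! ### Localization of functions on principal opens. -/

section BasicOpen

variable {X : Scheme.{u}} {U V : X.Opens} (hU : IsAffineOpen U) {f : Γ(X, U)} (i : V ≤ U)
  (e : V = X.basicOpen f)

include hU e

lemma isLocalization_opensRes :
    letI := (opensRes i).toAlgebra
    IsLocalization.Away f Γ(X, V) :=
  hU.isLocalization_of_eq_basicOpen f (homOfLE i) e

lemma isUnit_opensRes : IsUnit (opensRes i f) := by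
  let := (opensRes i).toAlgebra
  have := isLocalization_opensRes hU i e
  exact IsLocalization.Away.algebraMap_isUnit f

lemma exists_pow_mul_eq_of_opensRes_eq {x y : Γ(X, U)} (h : opensRes i x = opensRes i y) :
    ∃ n : ℕ, f ^ n * x = f ^ n * y := by
  let := (opensRes i).toAlgebra
  have := isLocalization_opensRes hU i e
  obtain ⟨⟨_, n, rfl⟩, hn⟩ := IsLocalization.exists_of_eq (M := .powers f) (S := Γ(X, V)) h
  exact ⟨n, hn⟩

lemma exists_opensRes_eq_pow_mul (y : Γ(X, V)) :
    ∃ (n : ℕ) (x : Γ(X, U)), opensRes i x = opensRes i f ^ n * y := by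
  let := (opensRes i).toAlgebra
  have := isLocalization_opensRes hU i e
  obtain ⟨n, x, hx⟩ := IsLocalization.Away.surj f y
  exact ⟨n, x, by rw [mul_comm]; exact hx.symm⟩

lemma exists_pow_mul_mem {K : Ideal Γ(X, U)} {x : Γ(X, U)}
    (h : opensRes i x ∈ K.map (opensRes i)) : ∃ n : ℕ, f ^ n * x ∈ K := by
  let := (opensRes i).toAlgebra
  have := isLocalization_opensRes hU i e
  obtain ⟨_, ⟨n, rfl⟩, hn⟩ :=
    (IsLocalization.algebraMap_mem_map_algebraMap_iff (.powers f) Γ(X, V) K x).mp h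
  exact ⟨n, hn⟩

lemma opensRes_mem_nonZeroDivisors {x : Γ(X, U)} (h : x ∈ nonZeroDivisors Γ(X, U)) :
    opensRes i x ∈ nonZeroDivisors Γ(X, V) := by
  let := (opensRes i).toAlgebra
  have := isLocalization_opensRes hU i e
  exact IsLocalization.map_nonZeroDivisors_le (.powers f) Γ(X, V) ⟨x, h, rfl⟩

end BasicOpen

/-! ### Transport of the parameter f along ring isomorphisms. -/

section Parameter

lemma ideal_eq_top_of_forall_mem_basicOpen {X : Scheme.{u}} {U : X.Opens} (hU : IsAffineOpen U)
    {K : Ideal Γ(X, U)}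
    (h : ∀ x ∈ U, ∃ g ∈ K, x ∈ X.basicOpen g) : K = ⊤ := by
  rw [← Ideal.span_eq K, ← hU.self_le_iSup_basicOpen_iff]
  intro x hx
  obtain ⟨g, hg, hxg⟩ := h x hx
  exact TopologicalSpace.Opens.mem_iSup.mpr ⟨⟨g, hg⟩, hxg⟩

lemma ideal_eq_span_of_ringEquiv {B B' R R' : Type*} [CommRing B] [CommRing B'] [CommRing R]
    [CommRing R'] (ε : B ≃+* B') {ρ : R →+* R'} (hρ : Function.Injective ρ)
    (Φ : B →+* PowerSeries R) (Φ' : B' →+* PowerSeries R')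
    (hΦ : ∀ x, PowerSeries.map ρ (Φ x) = Φ' (ε x)) (I : Ideal B)
    (hI : ∀ x, x ∈ I ↔ PowerSeries.constantCoeff (Φ x) = 0) (f : B')
    (hf : PowerSeries.X ∣ Φ' f)
    (hdvd : ∀ y, PowerSeries.constantCoeff (Φ' y) = 0 → f ∣ y) :
    I = Ideal.span {ε.symm f} := by
  have hmem (x : B) : x ∈ I ↔ PowerSeries.constantCoeff (Φ' (ε x)) = 0 := by
    rw [hI, ← hΦ, ← PowerSeries.coeff_zero_eq_constantCoeff_apply,
      ← PowerSeries.coeff_zero_eq_constantCoeff_apply, PowerSeries.coeff_map]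
    exact ((injective_iff_map_eq_zero' _).mp hρ _).symm
  ext x
  rw [hmem, Ideal.mem_span_singleton]
  constructor
  · intro hx
    have h1 := map_dvd ε.symm (hdvd _ hx)
    rwa [RingEquiv.symm_apply_apply] at h1
  · rintro ⟨y, rfl⟩
    rw [map_mul, map_mul, RingEquiv.apply_symm_apply, map_mul, PowerSeries.X_dvd_iff.mp hf,
      zero_mul]

lemma span_singleton_symm_pow_eq {B B' : Type*} [CommRing B] [CommRing B'] (ε : B ≃+* B')
    {I : Ideal B} {f κ g : B'} (hI : I = Ideal.span {ε.symm f}) (hg : IsUnit g) {d : ℕ} (h : κ = f ^ d * g) :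
    I ^ d = Ideal.span {ε.symm κ} := by
  rw [hI, Ideal.span_singleton_pow, h, map_mul, map_pow,
    Ideal.span_singleton_mul_right_unit (hg.map ε.symm)]

lemma exists_parameter_of_ringEquiv {B B' R R' : Type*} [CommRing B] [CommRing B'] [CommRing R]
    [CommRing R'] (ε : B ≃+* B') {ρ : R →+* R'} (hρ : Function.Bijective ρ)
    (Φ : B →+* PowerSeries R) (Φ' : B' →+* PowerSeries R')
    (hΦ : ∀ x, PowerSeries.map ρ (Φ x) = Φ' (ε x)) (hΦ' : Function.Injective Φ') (I : Ideal B)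
    (hI : ∀ x, x ∈ I ↔ PowerSeries.constantCoeff (Φ x) = 0) (f : B')
    (hf : ∃ u, IsUnit u ∧ Φ' f = PowerSeries.X * u)
    (hdvd : ∀ y, PowerSeries.constantCoeff (Φ' y) = 0 → f ∣ y) :
    ∃ f ∈ nonZeroDivisors B, I = Ideal.span {f} ∧
      ∃ u, IsUnit u ∧ Φ f = PowerSeries.X * u := by
  obtain ⟨u, hu, hf⟩ := hf
  let ρ' := RingEquiv.ofBijective ρ hρ
  have hΦf := hΦ (ε.symm f)
  rw [RingEquiv.apply_symm_apply, hf] at hΦf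
  have hinv (q : PowerSeries R) :
      PowerSeries.map (ρ'.symm : R' →+* R) (PowerSeries.map ρ q) = q := by
    ext n
    rw [PowerSeries.coeff_map, PowerSeries.coeff_map]
    exact ρ'.symm_apply_apply _
  refine ⟨ε.symm f, mem_nonZeroDivisors_iff_right.mpr fun x hx ↦ ?_,
    ideal_eq_span_of_ringEquiv ε hρ.1 Φ Φ' hΦ I hI f ⟨u, hf⟩ hdvd,
    PowerSeries.map (ρ'.symm : R' →+* R) u, hu.map _, ?_⟩
  · have h1 := congrArg (fun y ↦ Φ' (ε y)) hx
    rw [map_mul, map_mul, RingEquiv.apply_symm_apply, hf, map_zero, map_zero, mul_comm,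
      mul_assoc] at h1
    -- z is not a zero divisor in R[[z]] and u is a unit, so f inherits this property through the
    -- injective expansion.
    have h2 : u * Φ' (ε x) = 0 := PowerSeries.X_mul_cancel (h1.trans (mul_zero _).symm)
    have h3 := hΦ' ((hu.mul_right_eq_zero.mp h2).trans (map_zero _).symm)
    exact (map_eq_zero_iff _ ε.injective).mp h3
  · rw [← hinv (Φ (ε.symm f)), hΦf, map_mul, PowerSeries.map_X]

end Parameter

/-! ### P as a Cartier divisor, its conormal sheaf and the formal completion. -/

namespace SchurPair

variable {S : Scheme.{u}} {r : ℕ} (p : SchurPair S r)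

/-- The trace on `S` of an affine open of `C`. -/
def trace (V : p.C.affineOpens) : S.AffineZariskiSite := ⟨p.σ ⁻¹ᵁ V.1, V.2.preimage p.σ⟩

/-- The expansion of the functions on an affine open of `C` along the section at infinity. -/
def Φ (V : p.C.affineOpens) : Γ(p.C, V) →+* PowerSeries Γ(S, p.σ ⁻¹ᵁ V.1) :=
  p.Θ (p.trace V) le_rfl

lemma constantCoeff_Φ (V : p.C.affineOpens) (x : Γ(p.C, V)) :
    PowerSeries.constantCoeff (p.Φ V x) = p.σ.app V.1 x :=
  (p.constantCoeff_Θ (p.trace V) le_rfl x).trans (opensRes_refl _ _)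

lemma Φ_affineRes {V V' : p.C.affineOpens} (h : V'.1 ≤ V.1) (x : Γ(p.C, V)) :
    p.Φ V' (affineRes h x) = PowerSeries.map (opensRes (p.σ.preimage_mono h)) (p.Φ V x) :=
  (p.Θ_opensRes (p.trace V') le_rfl h x).trans
    (p.map_Θ (W := p.trace V) (W' := p.trace V') (p.σ.preimage_mono h) le_rfl x).symm

lemma mem_ker_ideal_iff (V : p.C.affineOpens) (x : Γ(p.C, V)) :
    x ∈ p.σ.ker.ideal V ↔ PowerSeries.constantCoeff (p.Φ V x) = 0 := by
  rw [constantCoeff_Φ, Scheme.Hom.ker_apply]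
  rfl

lemma constantCoeff_comp_Φ_surjective (V : p.C.affineOpens) :
    Function.Surjective (PowerSeries.constantCoeff.comp (p.Φ V)) := fun x ↦ by
  obtain ⟨y, hy⟩ := p.σ.app_surjective V.1 V.2 x
  exact ⟨y, (p.constantCoeff_Φ V y).trans hy⟩

/-- The ideal of the section at infinity is generated over `V` by a nonzerodivisor that is a
uniformizing parameter. -/
def HasParameter (V : p.C.affineOpens) : Prop :=
  ∃ f ∈ nonZeroDivisors Γ(p.C, V), p.σ.ker.ideal V = Ideal.span {f} ∧
    ∃ u, IsUnit u ∧ p.Φ V f = PowerSeries.X * u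

lemma HasParameter.of_eq_basicOpen {V V' : p.C.affineOpens} (hV : p.HasParameter V) {g : Γ(p.C, V)}
    (e : V'.1 = p.C.basicOpen g) : p.HasParameter V' := by
  obtain ⟨f, hf, hI, u, hu, hΦ⟩ := hV
  have h : V'.1 ≤ V.1 := e.le.trans (p.C.basicOpen_le g)
  refine ⟨affineRes h f, opensRes_mem_nonZeroDivisors V.2 h e hf, ?_, _, hu.map (PowerSeries.map
    (opensRes (p.σ.preimage_mono h))), ?_⟩
  · have h1 : (p.σ.ker.ideal V).map (affineRes h) = p.σ.ker.ideal V' :=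
      Scheme.IdealSheafData.map_ideal _ _
    rw [← h1, hI, Ideal.map_span, Set.image_singleton]
  · rw [Φ_affineRes, hΦ, map_mul, PowerSeries.map_X]

lemma hasParameter_of_disjoint {V : p.C.affineOpens} (h : p.σ ⁻¹ᵁ V.1 = ⊥) : p.HasParameter V := by
  have : Subsingleton Γ(S, p.σ ⁻¹ᵁ V.1) := by rw [h]; infer_instance
  -- Away from P the series ring is zero, so 1 = z·1 holds there and 1 is a parameter.
  refine ⟨1, one_mem _, ?_, 1, isUnit_one, Subsingleton.elim _ _⟩
  rw [Ideal.span_singleton_one, Ideal.eq_top_iff_one, mem_ker_ideal_iff]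
  exact Subsingleton.elim _ _

/-- `V_s` as an affine open. -/
def affineVs (U : S.AffineZariskiSite) : p.C.affineOpens := ⟨p.Vs U, p.isAffineOpen_Vs U⟩

lemma ιs_preimage_Vs (U : S.AffineZariskiSite) : p.ιs U ⁻¹ᵁ p.Vs U = ⊤ := by
  rw [← opensRange_ιs]; exact Scheme.Hom.preimage_opensRange _

/-- The isomorphism of the ring of functions on `V_s` with `grd(A)[1/s]₀`. -/
def equivB (U : S.AffineZariskiSite) : Γ(p.C, p.Vs U) ≃+* (p.chart U).B :=
  RingEquiv.ofBijective (evalOn (p.ιs U) (p.Vs U) (p.ιs_preimage_Vs U))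
    (evalOn_bijective _ _ (p.opensRange_ιs U).symm _)

lemma map_Φ_Vs (U : S.AffineZariskiSite) (x : Γ(p.C, p.Vs U)) :
    PowerSeries.map (opensRes (p.σ_preimage_Vs U).ge) (p.Φ (p.affineVs U) x) =
      (p.chart U).expand (p.equivB U x) :=
  (p.map_Θ (W := p.trace (p.affineVs U)) (W' := U) (p.σ_preimage_Vs U).ge le_rfl x).trans
    (p.Θ_eq_expand U x)

lemma hasParameter_Vs (U : S.AffineZariskiSite) : p.HasParameter (p.affineVs U) :=
  exists_parameter_of_ringEquiv (p.equivB U)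
    (opensRes_bijective_of_eq (p.σ_preimage_Vs U).ge (p.σ_preimage_Vs U).symm)
    (p.Φ (p.affineVs U)) (p.chart U).expand (p.map_Φ_Vs U) (p.chart U).expand_injective _
    (p.mem_ker_ideal_iff (p.affineVs U)) (p.chart U).f (p.chart U).expand_f
    fun _ ↦ (p.chart U).f_dvd_of_constantCoeff

lemma ker_ideal_Vs (U : S.AffineZariskiSite) :
    p.σ.ker.ideal (p.affineVs U) = Ideal.span {(p.equivB U).symm (p.chart U).f} :=
  ideal_eq_span_of_ringEquiv (p.equivB U)
    (opensRes_bijective_of_eq (p.σ_preimage_Vs U).ge (p.σ_preimage_Vs U).symm).1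
    (p.Φ (p.affineVs U)) (p.chart U).expand (p.map_Φ_Vs U) _
    (p.mem_ker_ideal_iff (p.affineVs U)) (p.chart U).f
    (have ⟨_, _, h⟩ := (p.chart U).expand_f; ⟨_, h⟩)
    fun _ ↦ (p.chart U).f_dvd_of_constantCoeff

lemma exists_hasParameter (x : p.C) : ∃ V : p.C.affineOpens, x ∈ V.1 ∧ p.HasParameter V := by
  obtain ⟨U, hU⟩ := exists_mem_affine (p.π x)
  by_cases hx : x ∈ p.Vt U
  · exact ⟨⟨p.Vt U, p.isAffineOpen_Vt U⟩, hx, p.hasParameter_of_disjoint (p.σ_preimage_Vt U)⟩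
  · have : x ∈ p.Vs U ⊔ p.Vt U := by rw [Vs_sup_Vt]; exact hU
    exact ⟨p.affineVs U, this.resolve_right hx, p.hasParameter_Vs U⟩

lemma isEffectiveCartier : IsEffectiveCartier p.σ.ker := fun x ↦ by
  obtain ⟨V, hx, f, hf, hI, -⟩ := p.exists_hasParameter x
  exact ⟨V, hx, f, hf, hI⟩

/-- Divisibility by a power of z is turned into membership in a power of I by splitting off one
factor f at a time. Multiplying f by a lift of u(0)⁻¹ normalizes the coefficient of z. -/
lemma HasParameter.isExpansion {V : p.C.affineOpens} (hV : p.HasParameter V) :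
    IsExpansion (p.Φ V) (p.σ.ker.ideal V) := by
  obtain ⟨f, hf, hI, u, hu, hΦ⟩ := hV
  refine ⟨p.mem_ker_ideal_iff V, p.constantCoeff_comp_Φ_surjective V, fun n ↦ ?_, ?_⟩
  · induction n with
    | zero => exact fun b _ ↦ by rw [pow_zero, Ideal.one_eq_top]; exact trivial
    | succ n ih =>
      intro b hb
      have hbI : b ∈ p.σ.ker.ideal V := (p.mem_ker_ideal_iff V b).mpr
        (PowerSeries.X_dvd_iff.mp ((dvd_pow_self _ n.succ_ne_zero).trans hb))
      rw [hI, Ideal.mem_span_singleton] at hbI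
      obtain ⟨c, rfl⟩ := hbI
      rw [pow_succ']
      refine Ideal.mul_mem_mul (hI ▸ Ideal.mem_span_singleton_self f) (ih c ?_)
      rw [map_mul, hΦ, mul_assoc, pow_succ'] at hb
      obtain ⟨w, hw⟩ := hb
      rw [mul_assoc] at hw
      exact (hu.dvd_mul_left).mp ⟨w, PowerSeries.X_mul_cancel hw⟩
  · obtain ⟨v, hv⟩ := hu.map (PowerSeries.constantCoeff (R := Γ(S, p.σ ⁻¹ᵁ V.1)))
    obtain ⟨g, hg⟩ := p.constantCoeff_comp_Φ_surjective V ↑v⁻¹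
    refine ⟨f * g, Ideal.mul_mem_right _ _ (hI ▸ Ideal.mem_span_singleton_self f), ?_⟩
    rw [map_mul, hΦ, mul_assoc, ← zero_add 1, PowerSeries.coeff_succ_X_mul,
      PowerSeries.coeff_zero_eq_constantCoeff_apply, map_mul, ← hv]
    exact (congrArg _ hg).trans v.mul_inv

lemma exists_basicOpen_hasParameter (V : p.C.affineOpens) {x : p.C} (hx : x ∈ V.1) :
    ∃ h : Γ(p.C, V), x ∈ p.C.basicOpen h ∧ p.HasParameter (p.C.affineBasicOpen h) := by
  obtain ⟨V₀, hx₀, h₀⟩ := p.exists_hasParameter x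
  obtain ⟨h, g, e, hxh⟩ := exists_basicOpen_le_affine_inter V.2 V₀.2 x ⟨hx, hx₀⟩
  exact ⟨h, hxh, h₀.of_eq_basicOpen p e⟩

lemma map_ker_ideal {V V' : p.C.affineOpens} (h : V'.1 ≤ V.1) :
    (p.σ.ker.ideal V).map (affineRes h) = p.σ.ker.ideal V' :=
  Scheme.IdealSheafData.map_ideal _ _

lemma ker_ideal_pow_eq_span {V V' : p.C.affineOpens} (h : V'.1 ≤ V.1) {n : ℕ} {x : Γ(p.C, V)}
    (hx : p.σ.ker.ideal V ^ n = Ideal.span {x}) :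
    p.σ.ker.ideal V' ^ n = Ideal.span {affineRes h x} := by
  rw [← map_ker_ideal p h, ← Ideal.map_pow, hx, Ideal.map_span, Set.image_singleton]

/-- The ideal of those h with hb ∈ Iⁿ contains, for each point of V, a function not vanishing there:
on a principal neighbourhood with a parameter the claim is known, and denominators are cleared. -/
lemma mem_pow_of_X_pow_dvd (V : p.C.affineOpens) (n : ℕ) {b : Γ(p.C, V)}
    (hb : PowerSeries.X ^ n ∣ p.Φ V b) : b ∈ p.σ.ker.ideal V ^ n := by
  suffices h : Submodule.comap (LinearMap.mulRight Γ(p.C, V) b) (p.σ.ker.ideal V ^ n) = ⊤ by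
    have h1 : (1 : Γ(p.C, V)) ∈
        Submodule.comap (LinearMap.mulRight Γ(p.C, V) b) (p.σ.ker.ideal V ^ n) := by
      rw [h]; exact trivial
    rw [Submodule.mem_comap, LinearMap.mulRight_apply, one_mul] at h1
    exact h1
  refine ideal_eq_top_of_forall_mem_basicOpen V.2 fun x hx ↦ ?_
  obtain ⟨h, hxh, hD⟩ := p.exists_basicOpen_hasParameter V hx
  have hle : (p.C.affineBasicOpen h).1 ≤ V.1 := p.C.basicOpen_le h
  have h1 := hD.isExpansion.mem_pow n (affineRes hle b) (by
    rw [Φ_affineRes, ← PowerSeries.map_X (opensRes (p.σ.preimage_mono hle)), ← map_pow]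
    exact map_dvd _ hb)
  rw [← p.map_ker_ideal hle, ← Ideal.map_pow] at h1
  obtain ⟨m, hm⟩ := exists_pow_mul_mem V.2 hle rfl h1
  refine ⟨h ^ (m + 1), ?_, ?_⟩
  · rw [Submodule.mem_comap, LinearMap.mulRight_apply, pow_succ', mul_assoc]
    exact Ideal.mul_mem_left _ _ hm
  · rwa [Scheme.basicOpen_pow _ _ m.succ_pos]

/-- Multiplying an element of I by g multiplies its coefficient of z by g(0). Hence the functions h
whose constant coefficient is the coefficient of z of some element of I form an ideal K, and it
suffices to find elements of K not vanishing at a given point. -/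
lemma exists_coeff_one_eq_one (V : p.C.affineOpens) :
    ∃ e ∈ p.σ.ker.ideal V, PowerSeries.coeff 1 (p.Φ V e) = 1 := by
  have hcoeff {V : p.C.affineOpens} (g : Γ(p.C, V)) {e : Γ(p.C, V)} (he : e ∈ p.σ.ker.ideal V) :
      PowerSeries.coeff 1 (p.Φ V (g * e)) =
        PowerSeries.constantCoeff (p.Φ V g) * PowerSeries.coeff 1 (p.Φ V e) := by
    rw [map_mul, PowerSeries.coeff_one_mul, (p.mem_ker_ideal_iff V e).mp he, mul_zero, zero_add,
      mul_comm]
  let K : Ideal Γ(p.C, V) :=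
    { carrier := {h | ∃ e ∈ p.σ.ker.ideal V,
        PowerSeries.coeff 1 (p.Φ V e) = PowerSeries.constantCoeff (p.Φ V h)}
      zero_mem' := ⟨0, zero_mem _, by simp⟩
      add_mem' := by
        rintro _ _ ⟨e, he, h⟩ ⟨e', he', h'⟩
        exact ⟨e + e', add_mem he he', by rw [map_add, map_add, map_add, map_add, h, h']⟩
      smul_mem' := by
        rintro g _ ⟨e, he, h⟩
        exact ⟨g * e, Ideal.mul_mem_left _ _ he, by
          rw [hcoeff g he, h, smul_eq_mul, map_mul, map_mul]⟩ }
  suffices hK : K = ⊤ by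
    have h1 : (1 : Γ(p.C, V)) ∈ K := by rw [hK]; exact trivial
    obtain ⟨e, he, h⟩ := h1
    exact ⟨e, he, by rw [h, map_one, map_one]⟩
  refine ideal_eq_top_of_forall_mem_basicOpen V.2 fun x hx ↦ ?_
  obtain ⟨h, hxh, hD⟩ := p.exists_basicOpen_hasParameter V hx
  have hle : (p.C.affineBasicOpen h).1 ≤ V.1 := p.C.basicOpen_le h
  obtain ⟨eD, heD, heD1⟩ := hD.isExpansion.exists_coeff_one
  obtain ⟨n, e, he⟩ := exists_opensRes_eq_pow_mul V.2 hle rfl eD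
  have he2 : affineRes hle e ∈ (p.σ.ker.ideal V).map (affineRes hle) := by
    rw [p.map_ker_ideal hle]
    exact he ▸ Ideal.mul_mem_left _ _ heD
  obtain ⟨m, hm⟩ := exists_pow_mul_mem V.2 hle rfl he2
  have h3 : affineRes hle (h ^ m * e) = affineRes hle (h ^ (m + n)) * eD := by
    rw [map_mul, pow_add, map_mul, mul_assoc]
    congr 1
    rw [map_pow]
    exact he
  have h4 := congrArg (fun y ↦ PowerSeries.coeff 1 (p.Φ (p.C.affineBasicOpen h) y)) h3
  rw [hcoeff _ heD, heD1, mul_one, Φ_affineRes, Φ_affineRes, PowerSeries.coeff_map,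
    ← PowerSeries.coeff_zero_eq_constantCoeff_apply, PowerSeries.coeff_map,
    PowerSeries.coeff_zero_eq_constantCoeff_apply] at h4
  -- A second clearing of denominators, now on S: the equality of coefficients holds only where the
  -- pullback of h along σ is invertible.
  obtain ⟨k, hk⟩ := exists_pow_mul_eq_of_opensRes_eq (p.trace V).2 (p.σ.preimage_mono hle)
    (f := p.σ.app V.1 h) (Scheme.preimage_basicOpen p.σ h) h4
  refine ⟨h ^ (k + (m + n) + 1), ?_, ?_⟩
  · rw [pow_succ']
    refine Ideal.mul_mem_left _ _ ⟨h ^ k * (h ^ m * e), Ideal.mul_mem_left _ _ hm, ?_⟩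
    rw [hcoeff _ hm, pow_add h k, (p.Φ V).map_mul (h ^ k) (h ^ (m + n)),
      PowerSeries.constantCoeff.map_mul, (p.Φ V).map_pow, PowerSeries.constantCoeff.map_pow,
      constantCoeff_Φ p V h]
    exact hk
  · rwa [Scheme.basicOpen_pow _ _ (Nat.succ_pos _)]

lemma isExpansion (V : p.C.affineOpens) : IsExpansion (p.Φ V) (p.σ.ker.ideal V) where
  mem_iff := p.mem_ker_ideal_iff V
  surjective := p.constantCoeff_comp_Φ_surjective V
  mem_pow _ _ := p.mem_pow_of_X_pow_dvd V _
  exists_coeff_one := p.exists_coeff_one_eq_one V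

lemma isConormalFreeOfRankOne : IsConormalFreeOfRankOne p.σ.ker := by
  choose φ hφ using fun V ↦ (p.isExpansion V).exists_cotangentEquiv
  refine ⟨φ, fun V V' h g y y' hy hg ↦ ?_⟩
  rw [hφ] at hg ⊢
  rw [hy, Φ_affineRes, Φ_affineRes, PowerSeries.coeff_map, hg,
    ← PowerSeries.coeff_zero_eq_constantCoeff_apply,
    ← PowerSeries.coeff_zero_eq_constantCoeff_apply, PowerSeries.coeff_map]

/-- The formal completion of `C` along the section at infinity is `𝒪_S[[z]]`. -/
def formalTrivialization : FormalTrivialization p.π p.σ where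
  iso V := (p.isExpansion V).ringEquiv
  eval_eq_zero_iff V n x := (p.isExpansion V).evalₐ_eq_zero_iff n x
  iso_algebraMap V U h c := by
    have hW : p.σ ⁻¹ᵁ V.1 ≤ U :=
      (p.σ.preimage_mono h).trans (p.σ_preimage_preimage U).le
    have h1 : p.Φ V (p.π.appLE U V.1 h c) = PowerSeries.C (opensRes hW c) :=
      p.Θ_π (p.trace V) le_rfl h hW c
    rw [IsExpansion.ringEquiv_algebraMap, ← constantCoeff_Φ, h1, PowerSeries.constantCoeff_C]
  restrict V V' h x x' hx := by
    refine PowerSeries.eq_of_X_pow_dvd_sub fun n ↦ ?_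
    obtain ⟨b, hb⟩ := Ideal.Quotient.mk_surjective
      (AdicCompletion.evalₐ (p.σ.ker.ideal V) n x)
    have h1 := (p.isExpansion V).X_pow_dvd_ringEquiv_sub hb.symm
    have h2 := (p.isExpansion V').X_pow_dvd_ringEquiv_sub (hx n b hb.symm)
    have h3 := map_dvd (PowerSeries.map (opensRes (p.σ.preimage_mono h))) h1
    rw [map_pow, PowerSeries.map_X, map_sub, ← p.Φ_affineRes h] at h3
    have h4 := dvd_sub h2 h3
    rw [sub_sub_sub_cancel_right] at h4
    exact h4

end SchurPair

/-! ### The intersection of the powers of the ideal of P, and density of `Vt`. -/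

namespace SchurPair

open Scheme.AffineZariskiSite

variable {S : Scheme.{u}} {r : ℕ} (p : SchurPair S r)

lemma specAToC_preimage_Vt (U : S.AffineZariskiSite) : p.specAToC U ⁻¹ᵁ p.Vt U = ⊤ := by
  rw [← opensRange_specAToC]; exact Scheme.Hom.preimage_opensRange _

/-- The isomorphism of the ring of functions on `V_t` with `A`. -/
def equivA (U : S.AffineZariskiSite) : Γ(p.C, p.Vt U) ≃+* p.A U :=
  RingEquiv.ofBijective (evalOn (p.specAToC U) (p.Vt U) (p.specAToC_preimage_Vt U))
    (evalOn_bijective _ _ (p.opensRange_specAToC U).symm _)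

lemma ab_mem (U : S.AffineZariskiSite) : (p.chart U).a * (p.chart U).b ∈ p.A U :=
  (p.A U).mul_mem (p.chart U).a_mem (p.chart U).b_mem

/-- The function `s / 1ᵈ` on `V_t`. -/
def α (U : S.AffineZariskiSite) : Γ(p.C, p.Vt U) :=
  (p.equivA U).symm ⟨(p.chart U).a * (p.chart U).b, p.ab_mem U⟩

lemma equivA_α (U : S.AffineZariskiSite) :
    p.equivA U (p.α U) = ⟨(p.chart U).a * (p.chart U).b, p.ab_mem U⟩ :=
  RingEquiv.apply_symm_apply _ _

lemma specAToC_preimage_Vs (U : S.AffineZariskiSite) :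
    p.specAToC U ⁻¹ᵁ p.Vs U = PrimeSpectrum.basicOpen
      (⟨(p.chart U).a * (p.chart U).b, p.ab_mem U⟩ : p.A U) := by
  rw [p.specAToC_eq U (p.isUnit_sumHom_oneOne U), Vs, Scheme.Hom.comp_preimage,
    Scheme.Hom.preimage_image_eq,
    projMk_preimage_basicOpen _ _ _ _ (p.chart U).s_mem (p.chart U).d_pos]
  congr 1
  exact Subtype.ext (Grd.sumHom_monomial _)

lemma basicOpen_α (U : S.AffineZariskiSite) : p.C.basicOpen (p.α U) = p.Vs U ⊓ p.Vt U := by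
  have h : p.specAToC U ⁻¹ᵁ p.C.basicOpen (p.α U) = p.specAToC U ⁻¹ᵁ p.Vs U := by
    rw [preimage_basicOpen_evalOn _ _ (p.specAToC_preimage_Vt U), specAToC_preimage_Vs]
    exact congrArg _ (p.equivA_α U)
  have hle : p.C.basicOpen (p.α U) ≤ p.Vt U := p.C.basicOpen_le _
  ext x
  constructor
  · intro hx
    refine ⟨?_, hle hx⟩
    have ht := hle hx
    rw [← opensRange_specAToC] at ht
    obtain ⟨y, rfl⟩ := ht
    exact h.le hx
  · rintro ⟨hs, ht⟩
    rw [SetLike.mem_coe, ← opensRange_specAToC] at ht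
    obtain ⟨y, rfl⟩ := ht
    exact h.ge hs

/-- The function α corresponds to ab, a unit of R((z)) and hence a nonzerodivisor in A. -/
lemma eq_zero_of_opensRes_α_eq_zero (U : S.AffineZariskiSite) {x : Γ(p.C, p.Vt U)}
    (h : opensRes (p.C.basicOpen_le (p.α U)) x = 0) : x = 0 := by
  obtain ⟨n, hn⟩ := exists_pow_mul_eq_of_opensRes_eq (p.isAffineOpen_Vt U) _ rfl
    (h.trans (map_zero (opensRes (p.C.basicOpen_le (p.α U)))).symm)
  have h1 := congrArg (fun y ↦ (p.equivA U y).1) hn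
  rw [mul_zero, map_zero, map_mul, map_pow, equivA_α] at h1
  have h2 : ((p.chart U).a * (p.chart U).b) ^ n * (p.equivA U x).1 = 0 := h1
  refine (map_eq_zero_iff _ (p.equivA U).injective).mp (Subtype.ext ?_)
  exact (((p.chart U).isUnit_ab.pow n).mul_right_eq_zero).mp h2

lemma eq_zero_of_forall_mem_pow_Vs (U : S.AffineZariskiSite) {x : Γ(p.C, p.Vs U)}
    (h : ∀ n, x ∈ p.σ.ker.ideal (p.affineVs U) ^ n) : x = 0 := by
  have h1 : p.Φ (p.affineVs U) x = 0 := PowerSeries.eq_of_X_pow_dvd_sub fun n ↦ by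
    rw [sub_zero]
    exact (p.isExpansion (p.affineVs U)).X_pow_dvd (h n)
  have h2 := ((congrArg _ h1).trans (map_zero _)).symm.trans (p.map_Φ_Vs U x)
  exact (map_eq_zero_iff _ (p.equivB U).injective).mp
    ((map_eq_zero_iff _ (p.chart U).expand_injective).mp h2.symm)

lemma exists_mem_affine_le {X : Scheme.{u}} {U : X.Opens} {x : X} (hx : x ∈ U) :
    ∃ U' : X.AffineZariskiSite, x ∈ U'.toOpens ∧ U'.toOpens ≤ U := by
  obtain ⟨U', hU, hxU, hle⟩ := exists_isAffineOpen_mem_and_subset hx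
  exact ⟨⟨U', hU⟩, hxU, hle⟩

lemma mem_Vs_or_mem_Vt {U : S.AffineZariskiSite} {x : p.C} (hx : x ∈ p.π ⁻¹ᵁ U.toOpens) :
    x ∈ p.Vs U ∨ x ∈ p.Vt U := by
  rw [← p.Vs_sup_Vt U] at hx
  exact hx

/-- On `Vs` such a section has zero expansion and so vanishes. On `Vt` it then vanishes on the
overlap, the locus where the nonzerodivisor α is invertible. -/
lemma iInf_powSections (U : S.Opens) :
    (⨅ n : ℕ, powSections p.σ.ker n (p.π ⁻¹ᵁ U)) = ⊥ := by
  refine le_bot_iff.mp fun x hx ↦ (Submodule.mem_bot _).mpr ?_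
  have hx' (n : ℕ) (V : p.C.affineOpens) (hV : V.1 ≤ p.π ⁻¹ᵁ U) :
      opensRes hV x ∈ p.σ.ker.ideal V ^ n := by
    have h1 := (Submodule.mem_iInf _).mp hx n
    rw [powSections, Submodule.mem_iInf] at h1
    have h2 := h1 V
    rw [Submodule.mem_iInf] at h2
    exact h2 hV
  refine section_ext fun z hz ↦ ?_
  obtain ⟨W, hzW, hWU⟩ := exists_mem_affine_le (show p.π z ∈ U from hz)
  have hle : p.π ⁻¹ᵁ W.toOpens ≤ p.π ⁻¹ᵁ U := p.π.preimage_mono hWU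
  have hs : opensRes ((p.Vs_le W).trans hle) x = 0 :=
    p.eq_zero_of_forall_mem_pow_Vs W fun n ↦ hx' n (p.affineVs W) ((p.Vs_le W).trans hle)
  rcases p.mem_Vs_or_mem_Vt (show z ∈ p.π ⁻¹ᵁ W.toOpens from hzW) with h | h
  · exact ⟨p.Vs W, (p.Vs_le W).trans hle, h, by rw [hs, map_zero]⟩
  · refine ⟨p.Vt W, (p.Vt_le W).trans hle, h, ?_⟩
    rw [map_zero]
    refine p.eq_zero_of_opensRes_α_eq_zero W ?_
    have h1 : p.C.basicOpen (p.α W) ≤ p.Vs W := (p.basicOpen_α W).le.trans inf_le_left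
    rw [opensRes_opensRes, ← opensRes_opensRes ((p.Vs_le W).trans hle) h1, hs, map_zero]

lemma basicOpen_le_Vt_of_mem_ker {U : S.AffineZariskiSite} {V : p.C.affineOpens}
    (hV : V.1 ≤ p.π ⁻¹ᵁ U.toOpens) {f : Γ(p.C, V)} (hf : f ∈ p.σ.ker.ideal V) :
    p.C.basicOpen f ≤ p.Vt U := by
  intro x hx
  refine p.mem_Vt_of_notMem_range U (hV (p.C.basicOpen_le f hx)) ?_
  rintro ⟨z, rfl⟩
  have h1 : z ∈ p.σ ⁻¹ᵁ p.C.basicOpen f := hx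
  rw [mem_ker_ideal_iff, constantCoeff_Φ] at hf
  rw [Scheme.preimage_basicOpen, hf, Scheme.basicOpen_zero] at h1
  exact h1

/-- `Vt` is schematically dense over U: locally P is cut out by a nonzerodivisor f, and the locus
where f is invertible lies in `Vt`. -/
lemma eq_of_opensRes_Vt_eq {U : S.AffineZariskiSite} {W : p.C.Opens}
    (hW : W ≤ p.π ⁻¹ᵁ U.toOpens) {x y : Γ(p.C, W)}
    (h : opensRes (inf_le_left : W ⊓ p.Vt U ≤ W) x = opensRes inf_le_left y) : x = y := by
  refine section_ext fun z hz ↦ ?_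
  obtain ⟨V₀, hz₀, hV₀⟩ := p.exists_hasParameter z
  obtain ⟨g, hg, hzg⟩ := V₀.2.exists_basicOpen_le ⟨z, hz⟩ hz₀
  obtain ⟨f, hf, hI, -⟩ := hV₀.of_eq_basicOpen p (V' := p.C.affineBasicOpen g) rfl
  refine ⟨p.C.basicOpen g, hg, hzg, ?_⟩
  have hfI : f ∈ p.σ.ker.ideal (p.C.affineBasicOpen g) := hI ▸ Ideal.mem_span_singleton_self f
  have hle : p.C.basicOpen f ≤ p.C.basicOpen g := p.C.basicOpen_le f
  have hle' : p.C.basicOpen f ≤ W ⊓ p.Vt U :=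
    le_inf (hle.trans hg) (p.basicOpen_le_Vt_of_mem_ker (hg.trans hW) hfI)
  have h1 : opensRes hle (opensRes hg x) = opensRes hle (opensRes hg y) := by
    rw [opensRes_opensRes, opensRes_opensRes, ← opensRes_opensRes inf_le_left hle' x, h,
      opensRes_opensRes]
  obtain ⟨n, hn⟩ := exists_pow_mul_eq_of_opensRes_eq (V₀.2.basicOpen g) hle rfl h1
  exact (mul_cancel_left_mem_nonZeroDivisors (pow_mem hf n)).mp hn

end SchurPair

/-! ### Sections of 𝒪(nP) and relative ampleness. -/

lemma exists_gluing {X : Scheme.{u}} {V : X.Opens} {ι : Type*} (W : ι → X.Opens)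
    (hW : ∀ i, W i ≤ V) (hcover : ∀ z ∈ V, ∃ i, z ∈ W i) (s : ∀ i, Γ(X, W i))
    (h : ∀ i j, opensRes (inf_le_left : W i ⊓ W j ≤ W i) (s i) = opensRes inf_le_right (s j)) :
    ∃ x : Γ(X, V), ∀ i, opensRes (hW i) x = s i :=
  (X.sheaf.existsUnique_gluing' W V (fun i ↦ homOfLE (hW i))
    (fun z hz ↦ TopologicalSpace.Opens.mem_iSup.mpr (hcover z hz)) s h).exists

namespace SchurPair

open Scheme.AffineZariskiSite

variable {S : Scheme.{u}} {r : ℕ} (p : SchurPair S r)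

section

variable (U : S.AffineZariskiSite)

/-- The punctured formal neighbourhood `Spec 𝒪_S(U)((z)) ⟶ C` of the section at infinity. -/
def punctured : Spec (.of (LaurentSeries Γ(S, U.toOpens))) ⟶ p.C :=
  Spec.map (CommRingCat.ofHom (p.A U).val.toRingHom) ≫ p.specAToC U

/-- The morphism defined through D₊(1) also factors through D₊(s), because ab is a unit of R((z)).
Functions on the two charts can thus be compared as Laurent series. -/
lemma punctured_eq : p.punctured U = Spec.map (CommRingCat.ofHom
    ((HahnSeries.ofPowerSeries ℤ Γ(S, U.toOpens)).comp (p.chart U).expand)) ≫ p.ιs U := by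
  have hs : ((p.A U).val.toRingHom.comp (Grd.sumHom (p.A U))) (p.chart U).s =
    (p.chart U).a * (p.chart U).b := Grd.sumHom_monomial _
  have hu : IsUnit (((p.A U).val.toRingHom.comp (Grd.sumHom (p.A U))) (p.chart U).s) := by
    rw [hs]; exact (p.chart U).isUnit_ab
  rw [punctured, p.specAToC_eq U (p.isUnit_sumHom_oneOne U), ← Category.assoc, specMap_projMk,
    projMk_congr _ _ _ _ (p.chart U).s_mem (p.chart U).d_pos hu, ιs, ← Category.assoc, projMk]
  congr 4
  refine (liftAway_ext _ (p.chart U).s_mem _ _ _ fun n x hx ↦ ?_).symm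
  rw [hs]
  have key (y : LaurentSeries Γ(S, U.toOpens)) (hy : y ∈ grdComp (p.A U) (n • (p.chart U).d))
      (hx : x = Grd.monomial _ _ y hy) :
      ((HahnSeries.ofPowerSeries ℤ Γ(S, U.toOpens)).comp (p.chart U).expand)
        (Away.mk _ (p.chart U).s_mem n x ‹_›) * ((p.chart U).a * (p.chart U).b) ^ n =
      ((p.A U).val.toRingHom.comp (Grd.sumHom (p.A U))) x := by
    subst hx
    exact ((p.chart U).expand_frac_mul n y hy).trans (Grd.sumHom_monomial hy).symm
  exact key _ (x.coeff_mem _) (Grd.eq_monomial_of_mem hx)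

lemma punctured_preimage_Vt : p.punctured U ⁻¹ᵁ p.Vt U = ⊤ :=
  preimage_specMap_comp _ (p.specAToC_preimage_Vt U)

lemma punctured_preimage_Vs : p.punctured U ⁻¹ᵁ p.Vs U = ⊤ := by
  rw [punctured_eq]
  exact preimage_specMap_comp _ (p.ιs_preimage_Vs U)

lemma punctured_preimage_inf : p.punctured U ⁻¹ᵁ (p.Vs U ⊓ p.Vt U) = ⊤ := by
  rw [Scheme.Hom.preimage_inf, punctured_preimage_Vs, punctured_preimage_Vt, inf_top_eq]

lemma evalOn_punctured_Vt (x : Γ(p.C, p.Vt U)) :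
    evalOn (p.punctured U) (p.Vt U) (p.punctured_preimage_Vt U) x = (p.equivA U x).1 :=
  evalOn_specMap_comp _ _ _ (p.specAToC_preimage_Vt U) _ _

lemma evalOn_punctured_Vs (x : Γ(p.C, p.Vs U)) :
    evalOn (p.punctured U) (p.Vs U) (p.punctured_preimage_Vs U) x =
      HahnSeries.ofPowerSeries ℤ _ ((p.chart U).expand (p.equivB U x)) :=
  (evalOn_congr (p.punctured_eq U) _ (preimage_specMap_comp _ (p.ιs_preimage_Vs U)) _).trans
    (evalOn_specMap_comp _ _ _ (p.ιs_preimage_Vs U) _ _)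

/-- The overlap is the locus in `Vt` where α is invertible, so a power of α brings a function on it
into A, which embeds in R((z)). -/
lemma evalOn_punctured_injective :
    Function.Injective (evalOn (p.punctured U) _ (p.punctured_preimage_inf U)) := by
  rw [injective_iff_map_eq_zero]
  intro y hy
  obtain ⟨n, x, hx⟩ := exists_opensRes_eq_pow_mul (p.isAffineOpen_Vt U) inf_le_right
    (p.basicOpen_α U).symm y
  have h1 := congrArg (evalOn (p.punctured U) _ (p.punctured_preimage_inf U)) hx
  rw [evalOn_opensRes _ _ (p.punctured_preimage_Vt U), evalOn_punctured_Vt, map_mul, hy,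
    mul_zero] at h1
  have h2 : x = 0 := (map_eq_zero_iff _ (p.equivA U).injective).mp (Subtype.ext h1)
  rw [h2, map_zero] at hx
  have hu := isUnit_opensRes (p.isAffineOpen_Vt U) (f := p.α U)
    (inf_le_right : p.Vs U ⊓ p.Vt U ≤ p.Vt U) (p.basicOpen_α U).symm
  exact ((hu.pow n).mul_right_eq_zero).mp hx.symm

/-- The function `1ᵈ / s` on `V_s`. -/
def κ : Γ(p.C, p.Vs U) := (p.equivB U).symm (p.chart U).κ

lemma α_mul_κ : opensRes (inf_le_right : p.Vs U ⊓ p.Vt U ≤ p.Vt U) (p.α U) *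
    opensRes inf_le_left (p.κ U) = 1 := by
  refine p.evalOn_punctured_injective U ?_
  rw [map_mul, map_one, evalOn_opensRes _ _ (p.punctured_preimage_Vt U),
    evalOn_opensRes _ _ (p.punctured_preimage_Vs U), evalOn_punctured_Vt, evalOn_punctured_Vs,
    equivA_α, κ, RingEquiv.apply_symm_apply, mul_comm]
  have h := (p.chart U).expand_frac_mul 1 1 (by
      rw [one_smul]
      refine (mem_grdComp_of_pos _ (p.chart U).d_pos).mpr ⟨(p.A U).one_mem, fun k hk ↦ ?_⟩
      rw [HahnSeries.coeff_one, if_neg (by lia)])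
  rw [pow_one] at h
  exact h

lemma ker_ideal_Vs_pow :
    p.σ.ker.ideal (p.affineVs U) ^ (p.chart U).d = Ideal.span {p.κ U} := by
  obtain ⟨g, hg, h⟩ := (p.chart U).exists_κ_eq
  exact span_singleton_symm_pow_eq (p.equivB U) (p.ker_ideal_Vs U) hg h

variable {U} in
lemma ker_ideal_pow_of_le_Vs {V : p.C.affineOpens} (h : V.1 ≤ p.Vs U) :
    p.σ.ker.ideal V ^ (p.chart U).d = Ideal.span {opensRes h (p.κ U)} :=
  p.ker_ideal_pow_eq_span (V := p.affineVs U) h (p.ker_ideal_Vs_pow U)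

/-- The function `s` on `V` is the product of `g` on `V_t` and `x` on `V`. -/
def IsProduct (g : Γ(p.C, p.Vt U)) (V : p.C.Opens) (x s : Γ(p.C, V)) : Prop :=
  opensRes (inf_le_left : V ⊓ p.Vt U ≤ V) s = opensRes inf_le_right g * opensRes inf_le_left x

variable {U}

lemma IsProduct.opensRes {g : Γ(p.C, p.Vt U)} {V V' : p.C.Opens} {x s : Γ(p.C, V)}
    (h : p.IsProduct U g V x s) (i : V' ≤ V) :
    p.IsProduct U g V' (opensRes i x) (opensRes i s) := by
  have h1 := congrArg (RelativeCurve.opensRes (inf_le_inf_right (p.Vt U) i)) h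
  rw [map_mul] at h1
  simp only [opensRes_opensRes] at h1
  rw [IsProduct]
  simp only [opensRes_opensRes]
  exact h1

lemma IsProduct.unique {g : Γ(p.C, p.Vt U)} {V : p.C.Opens} (hV : V ≤ p.π ⁻¹ᵁ U.toOpens)
    {x s s' : Γ(p.C, V)} (h : p.IsProduct U g V x s) (h' : p.IsProduct U g V x s') : s = s' :=
  p.eq_of_opensRes_Vt_eq hV (h.trans h'.symm)

/-- Local products agree on overlaps by the density of `Vt`, hence they glue. -/
lemma exists_isProduct_of_locally {g : Γ(p.C, p.Vt U)} {V : p.C.Opens}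
    (hV : V ≤ p.π ⁻¹ᵁ U.toOpens) (x : Γ(p.C, V))
    (h : ∀ z ∈ V, ∃ (V' : p.C.Opens) (i : V' ≤ V), z ∈ V' ∧
      ∃ s, p.IsProduct U g V' (opensRes i x) s) : ∃ s, p.IsProduct U g V x s := by
  choose W hW hz s hs using fun z : V ↦ h z.1 z.2
  obtain ⟨y, hy⟩ := exists_gluing W hW (fun z hz' ↦ ⟨⟨z, hz'⟩, hz ⟨z, hz'⟩⟩) s fun i j ↦ by
    refine IsProduct.unique p ((inf_le_left.trans (hW i)).trans hV) ((hs i).opensRes p inf_le_left)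
      ?_
    have := (hs j).opensRes p (inf_le_right : W i ⊓ W j ≤ W j)
    rwa [opensRes_opensRes] at this ⊢
  refine ⟨y, section_ext fun z hz' ↦ ⟨W ⟨z, hz'.1⟩ ⊓ p.Vt U,
    inf_le_inf_right _ (hW _), ⟨hz ⟨z, hz'.1⟩, hz'.2⟩, ?_⟩⟩
  have h1 := hs ⟨z, hz'.1⟩
  rw [← hy, IsProduct] at h1
  rw [map_mul]
  simp only [opensRes_opensRes] at h1 ⊢
  exact h1

/-- Multiplication by a function on `V_t` with poles of order at most `n` along the section at
infinity. -/
def divisorSection (g : Γ(p.C, p.Vt U)) (n : ℕ)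
    (H : ∀ V : p.C.affineOpens, V.1 ≤ p.π ⁻¹ᵁ U.toOpens → ∀ x ∈ p.σ.ker.ideal V ^ n,
      ∃ s, p.IsProduct U g V.1 x s) : DivisorSection p.σ.ker n (p.π ⁻¹ᵁ U.toOpens) where
  hom V hV :=
    { toFun x := (H V hV x.1 x.2).choose
      map_add' x y := by
        refine IsProduct.unique p hV (H V hV _ (x + y).2).choose_spec ?_
        have hx := (H V hV x.1 x.2).choose_spec
        have hy := (H V hV y.1 y.2).choose_spec
        rw [IsProduct] at hx hy ⊢
        rw [map_add, hx, hy, Submodule.coe_add, map_add, mul_add]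
      map_smul' c x := by
        refine IsProduct.unique p hV (H V hV _ (c • x).2).choose_spec ?_
        have hx := (H V hV x.1 x.2).choose_spec
        rw [IsProduct] at hx ⊢
        rw [RingHom.id_apply, smul_eq_mul, map_mul, hx, Submodule.coe_smul, smul_eq_mul, map_mul,
          mul_left_comm] }
  restrict V V' hV hV' a a' h := by
    refine IsProduct.unique p (hV'.trans hV) (H V' (hV'.trans hV) a'.1 a'.2).choose_spec ?_
    rw [h]
    exact (H V hV a.1 a.2).choose_spec.opensRes p hV'

lemma isProduct_divisorSection (g : Γ(p.C, p.Vt U)) (n : ℕ) (H) (V : p.C.affineOpens)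
    (hV : V.1 ≤ p.π ⁻¹ᵁ U.toOpens) (x : ↥(p.σ.ker.ideal V ^ n)) :
    p.IsProduct U g V.1 x.1 ((p.divisorSection g n H).hom V hV x) :=
  (H V hV x.1 x.2).choose_spec

lemma mem_nonvanishing {n : ℕ} {W : p.C.Opens} {s : DivisorSection p.σ.ker n W} {x : p.C} :
    x ∈ s.nonvanishing ↔ ∃ V hV a, x ∈ p.C.basicOpen (s.hom V hV a) := by
  simp only [DivisorSection.nonvanishing, TopologicalSpace.Opens.mem_iSup]

variable (U)

/-- The section is the inclusion of I into 𝒪. Elements of I are invertible only off P, and on `Vt`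
the ideal is the unit ideal. -/
lemma exists_divisorSection_Vt : ∃ s : DivisorSection p.σ.ker 1 (p.π ⁻¹ᵁ U.toOpens),
    s.nonvanishing = p.Vt U := by
  have hprod (V : p.C.affineOpens) (x : Γ(p.C, V)) : p.IsProduct U 1 V.1 x x := by
    rw [IsProduct, map_one, one_mul]
  refine ⟨p.divisorSection 1 1 fun V _ x _ ↦ ⟨x, hprod V x⟩, ?_⟩
  have hhom (V : p.C.affineOpens) (hV : V.1 ≤ p.π ⁻¹ᵁ U.toOpens) (x : ↥(p.σ.ker.ideal V ^ 1)) :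
      (p.divisorSection 1 1 fun V _ x _ ↦ ⟨x, hprod V x⟩).hom V hV x = x.1 :=
    IsProduct.unique p hV (p.isProduct_divisorSection 1 1 _ V hV x) (hprod V x.1)
  ext x
  rw [SetLike.mem_coe, mem_nonvanishing]
  constructor
  · rintro ⟨V, hV, a, hx⟩
    rw [hhom] at hx
    exact p.basicOpen_le_Vt_of_mem_ker hV (by simpa using a.2) hx
  · intro hx
    have h1 : (1 : Γ(p.C, p.Vt U)) ∈ p.σ.ker.ideal ⟨p.Vt U, p.isAffineOpen_Vt U⟩ ^ 1 := by
      rw [pow_one]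
      refine (p.mem_ker_ideal_iff _ _).mpr ?_
      have : Subsingleton Γ(S, p.σ ⁻¹ᵁ p.Vt U) := by rw [σ_preimage_Vt]; infer_instance
      exact Subsingleton.elim _ _
    refine ⟨⟨p.Vt U, p.isAffineOpen_Vt U⟩, p.Vt_le U, ⟨1, h1⟩, ?_⟩
    rw [hhom]
    rw [Scheme.basicOpen_of_isUnit _ isUnit_one]
    exact hx

variable {U} in
lemma opensRes_α_mul_opensRes_κ {V : p.C.Opens} (hs : V ≤ p.Vs U) (ht : V ≤ p.Vt U) :
    opensRes ht (p.α U) * opensRes hs (p.κ U) = 1 := by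
  have h := congrArg (opensRes (le_inf hs ht)) (p.α_mul_κ U)
  rwa [map_mul, map_one, opensRes_opensRes, opensRes_opensRes] at h

variable {U} in
lemma isProduct_of_le_Vs {V : p.C.Opens} (h : V ≤ p.Vs U) (c : Γ(p.C, V)) :
    p.IsProduct U (p.α U) V (opensRes h (p.κ U) * c) c := by
  rw [IsProduct, map_mul, opensRes_opensRes, ← mul_assoc, opensRes_α_mul_opensRes_κ, one_mul]

variable {U} in
lemma isProduct_of_le_Vt {V : p.C.Opens} (h : V ≤ p.Vt U) (g : Γ(p.C, p.Vt U)) (x : Γ(p.C, V)) :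
    p.IsProduct U g V x (opensRes h g * x) := by
  rw [IsProduct, map_mul, opensRes_opensRes]

/-- On `Vs` the ideal Iᵈ is generated by κ, and ακ = 1 on the overlap, so the product of α with cκ
extends as c. On `Vt` the function α is itself regular. -/
lemma exists_isProduct_α (V : p.C.affineOpens) (hV : V.1 ≤ p.π ⁻¹ᵁ U.toOpens) (x : Γ(p.C, V))
    (hx : x ∈ p.σ.ker.ideal V ^ (p.chart U).d) : ∃ s, p.IsProduct U (p.α U) V.1 x s := by
  refine p.exists_isProduct_of_locally hV x fun z hz ↦ ?_
  rcases p.mem_Vs_or_mem_Vt (hV hz) with h | h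
  · obtain ⟨f, g, e, hf⟩ := exists_basicOpen_le_affine_inter V.2 (p.isAffineOpen_Vs U) z ⟨hz, h⟩
    have hs : p.C.basicOpen f ≤ p.Vs U := e.le.trans (p.C.basicOpen_le g)
    have hle : (p.C.affineBasicOpen f).1 ≤ V.1 := p.C.basicOpen_le f
    have h1 : affineRes hle x ∈ p.σ.ker.ideal (p.C.affineBasicOpen f) ^ (p.chart U).d := by
      rw [← map_ker_ideal p hle, ← Ideal.map_pow]
      exact Ideal.mem_map_of_mem _ hx
    rw [ker_ideal_pow_of_le_Vs p hs, Ideal.mem_span_singleton] at h1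
    obtain ⟨c, hc⟩ := h1
    refine ⟨(p.C.affineBasicOpen f).1, hle, hf, c, ?_⟩
    have h2 := p.isProduct_of_le_Vs (V := (p.C.affineBasicOpen f).1) hs c
    rwa [← hc] at h2
  · exact ⟨V.1 ⊓ p.Vt U, inf_le_left, ⟨hz, h⟩, _, p.isProduct_of_le_Vt inf_le_right _ _⟩

lemma mem_Vs_of_isProduct {V : p.C.Opens} (hV : V ≤ p.π ⁻¹ᵁ U.toOpens) {x s : Γ(p.C, V)}
    (h : p.IsProduct U (p.α U) V x s) {z : p.C} (hz : z ∈ p.C.basicOpen s) : z ∈ p.Vs U := by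
  have hzV := p.C.basicOpen_le s hz
  refine (p.mem_Vs_or_mem_Vt (hV hzV)).elim id fun ht ↦ ?_
  have h1 : z ∈ p.C.basicOpen (opensRes (inf_le_left : V ⊓ p.Vt U ≤ V) s) :=
    (p.C.basicOpen_res s (homOfLE inf_le_left).op).ge ⟨⟨hzV, ht⟩, hz⟩
  rw [h, Scheme.basicOpen_mul] at h1
  have h2 : z ∈ p.C.basicOpen (p.α U) :=
    ((p.C.basicOpen_res (p.α U) (homOfLE (inf_le_right : V ⊓ p.Vt U ≤ p.Vt U)).op).le h1.1).2
  rw [basicOpen_α] at h2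
  exact h2.1

/-- On `Vs` multiplication by α takes the generator κ of Iᵈ to 1. At a point of `Vt`, a product with
α can be invertible only where α is, that is, in `Vs`. -/
lemma exists_divisorSection_Vs :
    ∃ s : DivisorSection p.σ.ker (p.chart U).d (p.π ⁻¹ᵁ U.toOpens), s.nonvanishing = p.Vs U := by
  refine ⟨p.divisorSection (p.α U) _ (p.exists_isProduct_α U), ?_⟩
  ext z
  rw [SetLike.mem_coe, mem_nonvanishing]
  constructor
  · rintro ⟨V, hV, a, hz⟩
    exact p.mem_Vs_of_isProduct U hV (p.isProduct_divisorSection _ _ _ V hV a) hz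
  · intro hz
    have h1 : p.κ U ∈ p.σ.ker.ideal (p.affineVs U) ^ (p.chart U).d :=
      (p.ker_ideal_Vs_pow U).ge (Ideal.mem_span_singleton_self _)
    refine ⟨p.affineVs U, p.Vs_le U, ⟨p.κ U, h1⟩, ?_⟩
    have h2 := p.isProduct_of_le_Vs (le_refl (p.Vs U)) 1
    rw [mul_one, opensRes_refl] at h2
    have h3 := IsProduct.unique p (p.Vs_le U) (p.isProduct_divisorSection (p.α U) _
      (p.exists_isProduct_α U) (p.affineVs U) (p.Vs_le U) ⟨p.κ U, h1⟩) h2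
    exact ((congrArg p.C.basicOpen h3).trans (Scheme.basicOpen_of_isUnit _ isUnit_one)).ge hz

end

lemma isRelativelyAmple : IsRelativelyAmple p.π p.σ.ker := by
  refine ⟨p.quasiCompact_π, fun U x hx ↦ ?_⟩
  rcases p.mem_Vs_or_mem_Vt (U := ⟨U.1, U.2⟩) hx with h | h
  · obtain ⟨s, hs⟩ := p.exists_divisorSection_Vs ⟨U.1, U.2⟩
    exact ⟨_, (p.chart ⟨U.1, U.2⟩).d_pos, s, hs.ge h, hs ▸ p.isAffineOpen_Vs _⟩
  · obtain ⟨s, hs⟩ := p.exists_divisorSection_Vt ⟨U.1, U.2⟩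
    exact ⟨1, one_pos, s, hs.ge h, hs ▸ p.isAffineOpen_Vt _⟩

end SchurPair

end RelativeCurve

end

/-- The curve `C = Proj (grd(𝒜))` of a Schur pair, its section `P` (the image of `σ`), and the
formal completion along `P`. -/
theorem mainTheorem4 {S : AlgebraicGeometry.Scheme.{u}} [IsLocallyNoetherian S] {r : ℕ}
    (p : RelativeCurve.SchurPair S r) :
    ∃ σ : S ⟶ p.C, σ ≫ p.π = 𝟙 S ∧ IsClosedImmersion σ ∧
      (∃ j : p.specA ⟶ p.C, IsOpenImmersion j ∧ j ≫ p.π = p.specAToBase ∧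
        (∀ U : S.AffineZariskiSite, p.ιSpecA U ≫ j = p.specAToC U) ∧
        Set.range j = (Set.range σ)ᶜ) ∧
      RelativeCurve.IsEffectiveCartier σ.ker ∧
      RelativeCurve.IsRelativelyAmple p.π σ.ker ∧
      RelativeCurve.IsConormalFreeOfRankOne σ.ker ∧
      Nonempty (RelativeCurve.FormalTrivialization p.π σ) ∧
      ∀ U : S.Opens, (⨅ n : ℕ, RelativeCurve.powSections σ.ker n (p.π ⁻¹ᵁ U)) = ⊥ := by
  refine ⟨p.σ, p.σ_π, p.isClosedImmersion_σ,
    ⟨p.j, p.isOpenImmersion_j, p.j_π, p.ιSpecA_j, p.range_j⟩, p.isEffectiveCartier,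
    p.isRelativelyAmple, p.isConormalFreeOfRankOne, ⟨p.formalTrivialization⟩, p.iInf_powSections⟩
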